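/- Let $M$ be a smooth oriented Riemannian $3$-manifold (Hausdorff, $\sigma$-compact, with possibly empty boundary $\partial M$), let $\zeta\in\Omega^2(M)$ be a closed two-form, let $G$ be a compact subgroup of $SO(N)$ with Lie algebra $\mathfrak g$, and let $P\to M$ be a smooth principal $G$-bundle. Let $A$ be a smooth connection on $P$ and $B\in\Omega^0(M,\mathrm{Ad}\,P)$ a smooth section of the adjoint bundle. Locally write $F_A=dA+A\wedge A$, $d_A\eta=d\eta+[A\wedge\eta]$, and let $d_A^*=(-1)^{3k+3+1}*d_A*$ on $k$-forms and $\zeta^*=(-1)^{(3-k)k}*(\zeta\wedge *\,\cdot\,)$ on $k$-forms, where $*$ is the Hodge star. Let $\varepsilon\in\{1,-1\}$ and consider the duality condition (generalized Bogomolny equation) $$F_A+\zeta B=\varepsilon * d_AB. \tag{D$_\varepsilon$}$$ 1. If $(A,B)$ satisfies (D$_\varepsilon$), then it satisfies both cone Yang-Mills (Euler-Lagrange) equations $$d_A^*(F_A+\zeta B)+[B,d_AB]=0,\qquad \zeta^*(F_A+\zeta B)+d_A^*d_AB=0 .$$ 2. Let $\langle\cdot,\cdot\rangle$ be any $\mathrm{Ad}(G)$-invariant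 inner product on $\mathfrak g$ (for example $-c\,\mathrm{tr}(XY)$ with $c>0$), and put $$S(A,B)=\int_M\langle (F_A+\zeta B)\wedge *(F_A+\zeta B)\rangle+\langle d_AB\wedge * d_AB\rangle,\qquad Q(A,B)=\int_M\langle (F_A+\zeta B)\wedge d_AB\rangle .$$ If $S(A,B)<\infty$, then the integral $Q(A,B)$ converges absolutely, and $$S(A,B)\ \ge\ 2\varepsilon\, Q(A,B),$$ with equality if and only if $(A,B)$ satisfies (D$_\varepsilon$). 3. If $M$ is compact, then $S(A,B)<\infty$ and $Q$ is a boundary term: $$Q(A,B)=\int_{\partial M}\Big(\langle F_A,B\rangle+\tfrac12\,\zeta\,\langle B,B\rangle\Big),$$ where $\partial M$ carries the boundary orientation (outward normal first). -/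

import Mathlib

open Set Manifold ContDiff MeasureTheory
open scoped Matrix.Norms.L2Operator

noncomputable section

namespace ConeYM

/-! ### Alternating forms on `ℝ³` with values in a normed space -/

abbrev E3 : Type := EuclideanSpace ℝ (Fin 3)

/-- The model for 3-manifolds with (possibly empty) boundary: the half-space `{y | 0 ≤ y 0}`. -/
abbrev I3 : ModelWithCorners ℝ E3 (EuclideanHalfSpace 3) := 𝓡∂ 3

/-- The half-space, as a subset of `ℝ³`. -/
abbrev halfSpace : Set E3 := range I3

/-- Constant-coefficient `k`-forms on `ℝ³` with values in `V`. -/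
abbrev Form (k : ℕ) (V : Type*) [NormedAddCommGroup V] [NormedSpace ℝ V] : Type _ :=
  E3 [⋀^Fin k]→L[ℝ] V

section Forms

variable {V W Z : Type*} [NormedAddCommGroup V] [NormedSpace ℝ V] [NormedAddCommGroup W]
  [NormedSpace ℝ W] [NormedAddCommGroup Z] [NormedSpace ℝ Z]

/-- A linear map as a `1`-form. -/
def oneForm (a : E3 →L[ℝ] V) : Form 1 V := ContinuousAlternatingMap.ofSubsingleton ℝ E3 V 0 a

/-- A vector as a `0`-form. -/
def zeroForm (b : V) : Form 0 V := ContinuousAlternatingMap.constOfIsEmpty ℝ E3 (Fin 0) b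

/-- The `1`-form as a linear map. -/
def toLin (α : Form 1 V) : E3 →L[ℝ] V := (ContinuousAlternatingMap.ofSubsingleton ℝ E3 V 0).symm α

/-- The wedge product `α ∧ η` of a `1`-form `α` and a `k`-form `η`, where the values are multiplied
by the bilinear map `β`:
`(α ∧ η)(v₀, …, v_k) = ∑ i, (-1)^i β (α v_i) (η (v₀, …, v̂_i, …, v_k))`. -/
def wedge {k : ℕ} (β : V →L[ℝ] W →L[ℝ] Z) (α : E3 →L[ℝ] V) (η : Form k W) : Form (k + 1) Z :=
  ContinuousAlternatingMap.alternatizeUncurryFin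
    (((ContinuousLinearMap.compContinuousAlternatingMapCLM (𝕜 := ℝ) (E := E3) (ι := Fin k)
      (F := W) (G := Z)).flip η).comp (β.comp α))

/-- The standard basis of `ℝ³`. -/
def e (a : Fin 3) : E3 := EuclideanSpace.single a 1

/-- The determinant, `dy⁰ ∧ dy¹ ∧ dy²`. -/
def detForm : Form 3 ℝ :=
  { (EuclideanSpace.basisFun (Fin 3) ℝ).toBasis.det with
    cont := by
      change Continuous fun v : Fin 3 → E3 => (EuclideanSpace.basisFun (Fin 3) ℝ).toBasis.det v
      simp only [Module.Basis.det_apply]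
      refine Continuous.matrix_det (continuous_matrix fun i j => ?_)
      simp only [Module.Basis.toMatrix_apply, OrthonormalBasis.coe_toBasis_repr_apply,
        EuclideanSpace.basisFun_repr]
      fun_prop }

/-! ### The Hodge star

`S` is the Gram matrix `S a b = g (e a) (e b)` of an inner product on `ℝ³`, which carries its
standard orientation. With indices raised by `S⁻¹`, the Hodge star of a `k`-form `α` is
`*α = (1 / k!) ∑ α (e^{a₁}, …, e^{a_k}) vol (e_{a₁}, …, e_{a_k}, ·)`, so that
`α ∧ *α' = ⟨α, α'⟩ vol`. -/

/-- The Riemannian volume form of the inner product with Gram matrix `S`. -/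
def volForm (S : Matrix (Fin 3) (Fin 3) ℝ) : Form 3 ℝ := √S.det • detForm

/-- The vectors `e^a = ∑ b, S⁻¹ a b • e b` (dual basis, identified with vectors by `S`). -/
def raised (S : Matrix (Fin 3) (Fin 3) ℝ) (a : Fin 3) : E3 := ∑ b, S⁻¹ a b • e b

/-- Hodge star `Ω¹ → Ω²`. -/
def star₁ (S : Matrix (Fin 3) (Fin 3) ℝ) (α : Form 1 V) : Form 2 V :=
  ∑ a, ((volForm S).curryLeft (e a)).smulRight (α ![raised S a])

/-- Hodge star `Ω² → Ω¹`. -/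
def star₂ (S : Matrix (Fin 3) (Fin 3) ℝ) (α : Form 2 V) : Form 1 V :=
  (1 / 2 : ℝ) • ∑ a, ∑ b,
    (((volForm S).curryLeft (e a)).curryLeft (e b)).smulRight (α ![raised S a, raised S b])

/-- Hodge star `Ω³ → Ω⁰`. -/
def star₃ (S : Matrix (Fin 3) (Fin 3) ℝ) (α : Form 3 V) : Form 0 V :=
  (1 / 6 : ℝ) • ∑ a, ∑ b, ∑ c,
    ((((volForm S).curryLeft (e a)).curryLeft (e b)).curryLeft (e c)).smulRight
      (α ![raised S a, raised S b, raised S c])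

end Forms

/-! ### Structure group, Lie algebra, invariant inner product -/

abbrev Mat (N : ℕ) : Type := Matrix (Fin N) (Fin N) ℝ

instance (N : ℕ) : ChartedSpace (Mat N) (Mat N) := chartedSpaceSelf _

abbrev SO (N : ℕ) : Submonoid (Mat N) := Matrix.specialOrthogonalGroup (Fin N) ℝ

/-- The Lie algebra of a subgroup `G` of `SO(N)`: the velocities at the identity of the curves in
`G` which start there. -/
def lieAlg {N : ℕ} (G : Subgroup (SO N)) : Set (Mat N) :=
  {X | ∃ γ : ℝ → Mat N, (∀ t, ∃ h ∈ G, (h : Mat N) = γ t) ∧ γ 0 = 1 ∧ HasDerivAt γ X 0}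

/-- Matrix product as a continuous bilinear map. -/
def mulL (N : ℕ) : Mat N →L[ℝ] Mat N →L[ℝ] Mat N := ContinuousLinearMap.mul ℝ (Mat N)

/-- Commutator `[X, Y] = X Y - Y X` as a continuous bilinear map. -/
def brL (N : ℕ) : Mat N →L[ℝ] Mat N →L[ℝ] Mat N := mulL N - (mulL N).flip

/-- An `Ad`-invariant inner product on the Lie algebra of `G`, written as the restriction to the Lie
algebra of a bilinear form on matrices; only its values on the Lie algebra matter. An example is
`- c * tr (X * Y)` with `0 < c`. -/
structure InvInner {N : ℕ} (G : Subgroup (SO N)) where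
  form : Mat N →L[ℝ] Mat N →L[ℝ] ℝ
  symm : ∀ X ∈ lieAlg G, ∀ Y ∈ lieAlg G, form X Y = form Y X
  pos : ∀ X ∈ lieAlg G, X ≠ 0 → 0 < form X X
  invariant : ∀ h ∈ G, ∀ X ∈ lieAlg G, ∀ Y ∈ lieAlg G,
    form ((h : Mat N) * X * ((h⁻¹ : SO N) : Mat N)) ((h : Mat N) * Y * ((h⁻¹ : SO N) : Mat N))
      = form X Y

/-! ### Cone Yang-Mills theory in one chart and one local trivialization -/

/-- Coordinate expressions, in one chart and one local trivialization: Gram matrix of the metric,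
the two-form `ζ`, the connection one-form `A` and the section `B`. -/
structure LocalData (N : ℕ) where
  gram : E3 → Matrix (Fin 3) (Fin 3) ℝ
  zeta : E3 → Form 2 ℝ
  A : E3 → E3 →L[ℝ] Mat N
  B : E3 → Mat N

namespace LocalData

variable {N : ℕ} (D : LocalData N)

/-- Covariant exterior derivative `d_A η = dη + [A ∧ η]`. -/
def covD {k : ℕ} (η : E3 → Form k (Mat N)) (y : E3) : Form (k + 1) (Mat N) :=
  extDerivWithin η halfSpace y + wedge (brL N) (D.A y) (η y)

/-- Curvature `F_A = dA + A ∧ A`. -/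
def curv (y : E3) : Form 2 (Mat N) :=
  extDerivWithin (fun z => oneForm (D.A z)) halfSpace y + wedge (mulL N) (D.A y) (oneForm (D.A y))

/-- `F_A + ζ B`. -/
def coneCurv (y : E3) : Form 2 (Mat N) := D.curv y + (D.zeta y).smulRight (D.B y)

/-- `d_A B`. -/
def dB : E3 → Form 1 (Mat N) := D.covD fun z => zeroForm (D.B z)

/-- `d_A^* = (-1)^(m k + m + 1) * d_A *` on `1`-forms (`m = 3`, `k = 1`). -/
def codiff₁ (η : E3 → Form 1 (Mat N)) (y : E3) : Form 0 (Mat N) :=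
  (-1 : ℝ) ^ (3 * 1 + 3 + 1) • star₃ (D.gram y) (D.covD (fun z => star₁ (D.gram z) (η z)) y)

/-- `d_A^* = (-1)^(m k + m + 1) * d_A *` on `2`-forms (`m = 3`, `k = 2`). -/
def codiff₂ (η : E3 → Form 2 (Mat N)) (y : E3) : Form 1 (Mat N) :=
  (-1 : ℝ) ^ (3 * 2 + 3 + 1) • star₂ (D.gram y) (D.covD (fun z => star₂ (D.gram z) (η z)) y)

/-- `ζ^* = (-1)^((m - k) k) * ζ *` on `2`-forms (`m = 3`, `k = 2`). The `3`-form `ζ ∧ α` of the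
`2`-form `ζ` and the `1`-form `α = *η` is written `α ∧ ζ`. -/
def zetaStar (η : E3 → Form 2 (Mat N)) (y : E3) : Form 0 (Mat N) :=
  (-1 : ℝ) ^ ((3 - 2) * 2) • star₃ (D.gram y)
    (wedge (ContinuousLinearMap.lsmul ℝ ℝ (E := Mat N)).flip
      (toLin (star₂ (D.gram y) (η y))) (D.zeta y))

/-- First cone Yang-Mills equation at `y`: `d_A^* (F_A + ζ B) + [B, d_A B] = 0`. -/
def ConeYM₁ (y : E3) : Prop :=
  D.codiff₂ D.coneCurv y + (brL N (D.B y)).compContinuousAlternatingMap (D.dB y) = 0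

/-- Second cone Yang-Mills equation at `y`: `ζ^* (F_A + ζ B) + d_A^* d_A B = 0`. -/
def ConeYM₂ (y : E3) : Prop := D.zetaStar D.coneCurv y + D.codiff₁ D.dB y = 0

/-- Duality condition at `y`: `F_A + ζ B = ε * d_A B`. -/
def Duality (ε : ℝ) (y : E3) : Prop := D.coneCurv y = ε • star₁ (D.gram y) (D.dB y)

variable (κ : Mat N →L[ℝ] Mat N →L[ℝ] ℝ)

/-- The integrand `⟨(F_A + ζ B) ∧ *(F_A + ζ B)⟩ + ⟨d_A B ∧ *d_A B⟩` of the cone Yang-Mills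
functional (in the first term, a `2`-form and a `1`-form are interchanged). -/
def energyForm (y : E3) : Form 3 ℝ :=
  wedge κ (toLin (star₂ (D.gram y) (D.coneCurv y))) (D.coneCurv y)
    + wedge κ (toLin (D.dB y)) (star₁ (D.gram y) (D.dB y))

/-- The `3`-form `⟨(F_A + ζ B) ∧ d_A B⟩` (with a `2`-form and a `1`-form interchanged). -/
def chargeForm (y : E3) : Form 3 ℝ := wedge κ (toLin (D.dB y)) (D.coneCurv y)

/-- The `2`-form `⟨F_A, B⟩ + ½ ζ ⟨B, B⟩`. -/
def boundaryForm (y : E3) : Form 2 ℝ :=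
  (κ (D.B y)).compContinuousAlternatingMap (D.curv y) + (1 / 2 * κ (D.B y) (D.B y)) • D.zeta y

end LocalData

/-! ### Manifolds, bundles, connections -/

section Global

variable (M : Type*) [TopologicalSpace M] [ChartedSpace (EuclideanHalfSpace 3) M]

/-- Charts of the smooth structure. -/
abbrev smoothCharts : Set (OpenPartialHomeomorph M (EuclideanHalfSpace 3)) :=
  IsManifold.maximalAtlas I3 ∞ M

/-- An orientation of `M`, given by an atlas of smooth charts whose transition maps have positive
Jacobian determinants. -/
structure OrientedAtlas where
  charts : Set (OpenPartialHomeomorph M (EuclideanHalfSpace 3))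
  smooth : charts ⊆ smoothCharts M
  cover : ∀ x : M, ∃ c ∈ charts, x ∈ c.source
  positive : ∀ c ∈ charts, ∀ c' ∈ charts, ∀ x ∈ c.source ∩ c'.source,
    0 < (fderivWithin ℝ (c'.extend I3 ∘ (c.extend I3).symm) halfSpace (c.extend I3 x)).det

variable {M}

/-- The point of `M` with coordinates `y`. -/
def pt (c : OpenPartialHomeomorph M (EuclideanHalfSpace 3)) (y : E3) : M := (c.extend I3).symm y

/-- Derivative of the inverse of a chart. -/
def dpt (c : OpenPartialHomeomorph M (EuclideanHalfSpace 3)) (y : E3) :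
    E3 →L[ℝ] TangentSpace I3 (pt c y) :=
  mfderivWithin 𝓘(ℝ, E3) I3 (c.extend I3).symm halfSpace y

/-- Differential of a matrix-valued function on `M`. -/
def dMat {N : ℕ} (f : M → Mat N) (x : M) : TangentSpace I3 x →L[ℝ] Mat N :=
  mfderiv I3 𝓘(ℝ, Mat N) f x

/-- A closed two-form on `M`. -/
structure ClosedTwoForm (M : Type*) [TopologicalSpace M]
    [ChartedSpace (EuclideanHalfSpace 3) M] where
  toFun : ∀ x : M, TangentSpace I3 x [⋀^Fin 2]→L[ℝ] ℝ
  smooth : ∀ c ∈ smoothCharts M, ContDiffOn ℝ ∞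
    (fun y => ((toFun (pt c y)).compContinuousLinearMap (dpt c y) : Form 2 ℝ)) (c.extend I3).target
  closed : ∀ c ∈ smoothCharts M, ∀ y ∈ (c.extend I3).target,
    extDerivWithin (fun z => ((toFun (pt c z)).compContinuousLinearMap (dpt c z) : Form 2 ℝ))
      halfSpace y = 0

/-- A principal `G`-bundle over `M`, given by its transition functions `g i j` with respect to
trivializations over an open cover `U`: local sections are related by `s j = s i * g i j`. -/
structure PrincipalBundle (M : Type*) [TopologicalSpace M] [ChartedSpace (EuclideanHalfSpace 3) M]
    {N : ℕ} (G : Subgroup (SO N)) (ι : Type*) where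
  U : ι → Set M
  isOpen : ∀ i, IsOpen (U i)
  cover : ∀ x, ∃ i, x ∈ U i
  g : ι → ι → M → SO N
  mem : ∀ i j, ∀ x ∈ U i ∩ U j, g i j x ∈ G
  smooth : ∀ i j, ContMDiffOn I3 𝓘(ℝ, Mat N) ∞ (fun x => (g i j x : Mat N)) (U i ∩ U j)
  cocycle : ∀ i j k, ∀ x ∈ U i ∩ U j ∩ U k, g i j x * g j k x = g i k x

variable {N : ℕ} {G : Subgroup (SO N)} {ι : Type*}

/-- A connection on a principal bundle, given by its connection one-forms `A i` in the local
trivializations, with `A j = g⁻¹ (A i) g + g⁻¹ dg` for `g = g i j`. -/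
structure Connection (P : PrincipalBundle M G ι) where
  toFun : ι → ∀ x : M, TangentSpace I3 x →L[ℝ] Mat N
  mem : ∀ i, ∀ x ∈ P.U i, ∀ v, toFun i x v ∈ lieAlg G
  smooth : ∀ i, ∀ c ∈ smoothCharts M, ContDiffOn ℝ ∞
    (fun y => ((toFun i (pt c y)).comp (dpt c y) : E3 →L[ℝ] Mat N))
    ((c.extend I3).target ∩ pt c ⁻¹' P.U i)
  transform : ∀ i j, ∀ x ∈ P.U i ∩ P.U j, ∀ v : TangentSpace I3 x,
    toFun j x v = (((P.g i j x)⁻¹ : SO N) : Mat N) * toFun i x v * (P.g i j x : Mat N)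
      + (((P.g i j x)⁻¹ : SO N) : Mat N)
        * dMat (fun z => (P.g i j z : Mat N)) x v

/-- A section of the adjoint bundle, given by its expressions `B i` in the local trivializations,
with `B j = g⁻¹ (B i) g` for `g = g i j`. -/
structure AdSection (P : PrincipalBundle M G ι) where
  toFun : ι → M → Mat N
  mem : ∀ i, ∀ x ∈ P.U i, toFun i x ∈ lieAlg G
  smooth : ∀ i, ContMDiffOn I3 𝓘(ℝ, Mat N) ∞ (toFun i) (P.U i)
  transform : ∀ i j, ∀ x ∈ P.U i ∩ P.U j,
    toFun j x = (((P.g i j x)⁻¹ : SO N) : Mat N) * toFun i x * (P.g i j x : Mat N)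

variable [IsManifold I3 ∞ M]

/-- Smooth Riemannian metrics on `M`. -/
abbrev Metric (M : Type*) [TopologicalSpace M] [ChartedSpace (EuclideanHalfSpace 3) M]
    [IsManifold I3 ∞ M] : Type _ :=
  Bundle.ContMDiffRiemannianMetric I3 ∞ E3 (fun x : M => TangentSpace I3 x)

variable (O : OrientedAtlas M) (met : Metric M) (ζ : ClosedTwoForm M) {P : PrincipalBundle M G ι}
  (A : Connection P) (B : AdSection P)

/-- Coordinate expressions of the metric, `ζ`, `A`, `B` in the chart `c` and the trivialization `i`.
-/
def localData (c : OpenPartialHomeomorph M (EuclideanHalfSpace 3)) (i : ι) : LocalData N where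
  gram y := Matrix.of fun a b => met.inner (pt c y) (dpt c y (e a)) (dpt c y (e b))
  zeta y := (ζ.toFun (pt c y)).compContinuousLinearMap (dpt c y)
  A y := (A.toFun i (pt c y)).comp (dpt c y)
  B y := B.toFun i (pt c y)

/-- `p` holds for the expressions in all oriented charts and all local trivializations, at all
points of their common domain. -/
def Everywhere (p : LocalData N → E3 → Prop) : Prop :=
  ∀ c ∈ O.charts, ∀ i, ∀ y ∈ (c.extend I3).target, pt c y ∈ P.U i →
    p (localData met ζ A B c i) y

/-- The first cone Yang-Mills equation on `M`. -/
def ConeYM₁ : Prop := Everywhere O met ζ A B fun D y => D.ConeYM₁ y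

/-- The second cone Yang-Mills equation on `M`. -/
def ConeYM₂ : Prop := Everywhere O met ζ A B fun D y => D.ConeYM₂ y

/-- The duality condition `F_A + ζ B = ε * d_A B` on `M`. -/
def Duality (ε : ℝ) : Prop := Everywhere O met ζ A B fun D y => D.Duality ε y

/-- The scalar-valued form on `M` with local expressions `f D`, where `f` is gauge-invariant: at
each point any trivialization may be used. -/
def glue {k : ℕ} (f : LocalData N → E3 → Form k ℝ)
    (c : OpenPartialHomeomorph M (EuclideanHalfSpace 3)) (y : E3) : Form k ℝ :=
  f (localData met ζ A B c (P.cover (pt c y)).choose) y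

/-! ### Integration of forms -/

variable [T2Space M] [SigmaCompactSpace M]

/-- A smooth partition of unity subordinate to the domains of the oriented charts. -/
def partition : SmoothPartitionOfUnity O.charts I3 M univ :=
  (SmoothPartitionOfUnity.exists_isSubordinate I3 isClosed_univ
    (fun c : O.charts => c.1.source) (fun c => c.1.open_source)
    (fun x _ => by
      obtain ⟨c, hc, hx⟩ := O.cover x
      exact mem_iUnion.2 ⟨⟨c, hc⟩, hx⟩)).choose

/-- The contribution of the chart `c` to the integral of the 3-form with local expressions `τ`. -/
def chartDensity (τ : OpenPartialHomeomorph M (EuclideanHalfSpace 3) → E3 → Form 3 ℝ)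
    (c : O.charts) (y : E3) : ℝ :=
  partition O c (pt c.1 y) * τ c.1 y ![e 0, e 1, e 2]

/-- Absolute integrability of a 3-form over `M`. -/
def FormIntegrable (τ : OpenPartialHomeomorph M (EuclideanHalfSpace 3) → E3 → Form 3 ℝ) : Prop :=
  (∀ c : O.charts, IntegrableOn (chartDensity O τ c) (c.1.extend I3).target) ∧
    Summable fun c : O.charts => ∫ y in (c.1.extend I3).target, |chartDensity O τ c y|

/-- The integral of a 3-form over the oriented manifold `M`. -/
def formIntegral (τ : OpenPartialHomeomorph M (EuclideanHalfSpace 3) → E3 → Form 3 ℝ) : ℝ :=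
  ∑' c : O.charts, ∫ y in (c.1.extend I3).target, chartDensity O τ c y

/-- The boundary point `(0, z)` of the half-space. -/
def bdryPt (z : EuclideanSpace ℝ (Fin 2)) : E3 := !₂[0, z 0, z 1]

/-- The integral of a 2-form over `∂M` with the boundary orientation (outward normal first). The
outward normal of the half-space is `-e 0`, so `(e 1, e 2)` is a negative basis of the boundary. -/
def boundaryIntegral (μ : OpenPartialHomeomorph M (EuclideanHalfSpace 3) → E3 → Form 2 ℝ) : ℝ :=
  ∑' c : O.charts, -∫ z in bdryPt ⁻¹' (c.1.extend I3).target,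
    partition O c (pt c.1 (bdryPt z)) * μ c.1 (bdryPt z) ![e 1, e 2]

variable (κ : InvInner G)

/-- The integrand of the cone Yang-Mills functional. -/
def energyForm := glue met ζ A B fun D y => D.energyForm κ.form y

/-- The integrand `⟨(F_A + ζ B) ∧ d_A B⟩` of the charge. -/
def chargeForm := glue met ζ A B fun D y => D.chargeForm κ.form y

/-- The integrand `⟨F_A, B⟩ + ½ ζ ⟨B, B⟩` of the boundary term. -/
def boundaryForm := glue met ζ A B fun D y => D.boundaryForm κ.form y

/-- The cone Yang-Mills action is finite. -/
def FiniteAction : Prop := FormIntegrable O (energyForm met ζ A B κ)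

/-- The cone Yang-Mills functional `‖F_A + ζ B‖² + ‖d_A B‖²`. -/
def action : ℝ := formIntegral O (energyForm met ζ A B κ)

/-- `Q = ∫_M ⟨(F_A + ζ B) ∧ d_A B⟩`. -/
def charge : ℝ := formIntegral O (chargeForm met ζ A B κ)

/-- `∫_{∂M} (⟨F_A, B⟩ + ½ ζ ⟨B, B⟩)`. -/
def boundaryTerm : ℝ := boundaryIntegral O (boundaryForm met ζ A B κ)

end Global

end ConeYM

end

/-!
In a chart and a local trivialization the Hodge star of a three-dimensional Riemannian metric is an
involution exchanging `Ω¹` and `Ω²` (`star₂_star₁`, `star₁_star₂`). Hence the duality condition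
`F_A + ζ B = ε * d_A B` may also be read as `* (F_A + ζ B) = ε d_A B`.

* The Yang-Mills equations. With this reading, `d_A * (F_A + ζ B) = ε d_A d_A B = ε [F_A, B]`, and
  `d_A * d_A B = ε d_A (F_A + ζ B) = ε ζ ∧ d_A B`. So the two equations are consequences of the two
  Bianchi identities `d_A d_A B = [F_A, B]` (`LocalData.covD_dB`) and
  `d_A (F_A + ζ B) = ζ ∧ d_A B` (`LocalData.covD_coneCurv`, which needs `dζ = 0`).

* The energy bound. Put `φ = * (F_A + ζ B)`. The energy density is `(|φ|² + |d_A B|²) vol` and the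
  charge density is `⟨φ, d_A B⟩ vol`, so that their difference is a square,
  `energy - 2 ε charge = |φ - ε d_A B|² vol` (`LocalData.energy_sub_charge`). It is nonnegative, and
  vanishes exactly where the duality condition holds. Applied to both signs, this bounds the charge
  density by the energy density and gives absolute convergence. A nonnegative density which is
  continuous and has integral zero vanishes on the interior of each chart domain, hence everywhere
  by continuity (`formIntegral_le_and_eq_iff`).

* The boundary term. By the Bianchi identity and the infinitesimal invariance of `⟨·, ·⟩`
  (`InvInner.bracket`), the charge density is exact, with primitive `⟨F_A, B⟩ + ½ ζ ⟨B, B⟩`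
  (`LocalData.extDerivWithin_boundaryForm`). It remains to prove Stokes' theorem on a compact
  oriented manifold with boundary (`formIntegral_extDerivWithin`). In each chart it is the divergence
  theorem on a half-space (`integral_divergence_halfSpace`), applied to `ρ μ` for a function `ρ` of the
  partition of unity. The error terms `dρ ∧ μ` cancel in total, which uses the invariance of the
  integral under oriented coordinate changes (`sum_integral_differentialWedge`).

The densities are defined by choosing a trivialization at each point and are integrated chart by
chart. This is meaningful because they are gauge invariant (`densities_gauge`, from the
`Ad`-invariance of the inner product) and natural under oriented coordinate changes
(`densities_trans`).

Smoothness is expressed throughout by `ContDiffWithinAt ℝ ∞ · halfSpace y`, so that boundary points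
need no separate treatment: the half-space has unique derivatives.
-/

noncomputable section

namespace ConeYM

/-! ### Evaluating forms on `ℝ³` -/

section Eval

variable {V W Z : Type*} [NormedAddCommGroup V] [NormedSpace ℝ V] [NormedAddCommGroup W]
  [NormedSpace ℝ W] [NormedAddCommGroup Z] [NormedSpace ℝ Z]

theorem e_apply (a b : Fin 3) : e a b = if b = a then 1 else 0 := by
  simp [e]

theorem eq_sum_e (v : E3) : v = v 0 • e 0 + v 1 • e 1 + v 2 • e 2 := by
  ext i
  fin_cases i <;> simp [e_apply]

theorem form_one_ext {α β : Form 1 V} (h : ∀ v, α ![v] = β ![v]) : α = β := by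
  ext v
  have hv : v = ![v 0] := by ext i; fin_cases i; rfl
  rw [hv, h]

theorem form_two_ext {α β : Form 2 V} (h : ∀ v w, α ![v, w] = β ![v, w]) : α = β := by
  ext v
  have hv : v = ![v 0, v 1] := by ext i; fin_cases i <;> rfl
  rw [hv, h]

theorem form_three_ext {α β : Form 3 V} (h : ∀ u v w, α ![u, v, w] = β ![u, v, w]) : α = β := by
  ext v
  have hv : v = ![v 0, v 1, v 2] := by ext i; fin_cases i <;> rfl
  rw [hv, h]

theorem form_one_eq_sum (α : Form 1 V) (v : E3) :
    α ![v] = v 0 • α ![e 0] + v 1 • α ![e 1] + v 2 • α ![e 2] := by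
  have h : ∀ u, α ![u] = (ContinuousAlternatingMap.ofSubsingleton ℝ E3 V 0).symm α u := by
    intro u
    rw [ContinuousAlternatingMap.ofSubsingleton_symm_apply_apply]
    congr 1; ext i; fin_cases i; rfl
  simp only [h]
  conv_lhs => rw [eq_sum_e v]
  rw [map_add, map_add, map_smul, map_smul, map_smul]

theorem toLin_apply (α : Form 1 V) (v : E3) : toLin α v = α ![v] := by
  rw [toLin, ContinuousAlternatingMap.ofSubsingleton_symm_apply_apply]
  congr 1; ext i; fin_cases i; rfl

theorem oneForm_apply (a : E3 →L[ℝ] V) (v : Fin 1 → E3) : oneForm a v = a (v 0) := rfl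

theorem zeroForm_apply (b : V) (v : Fin 0 → E3) : zeroForm b v = b := rfl

section Linear

variable (α : Form 2 V) (γ : Form 3 V)

theorem two_add_left (u u' v : E3) : α ![u + u', v] = α ![u, v] + α ![u', v] := by
  have h : ∀ x, α ![x, v] = α.curryLeft x ![v] := fun x => by
    rw [ContinuousAlternatingMap.curryLeft_apply_apply]
  rw [h, h, h, map_add, ContinuousAlternatingMap.add_apply]

theorem two_smul_left (r : ℝ) (u v : E3) : α ![r • u, v] = r • α ![u, v] := by
  have h : ∀ x, α ![x, v] = α.curryLeft x ![v] := fun x => by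
    rw [ContinuousAlternatingMap.curryLeft_apply_apply]
  rw [h, h, map_smul, ContinuousAlternatingMap.smul_apply]

theorem two_swap (u v : E3) : α ![v, u] = - α ![u, v] := by
  refine Eq.trans (congrArg α ?_) (α.map_swap ![u, v] (i := 0) (j := 1) (by simp))
  funext i; fin_cases i <;> rfl

theorem two_self (u : E3) : α ![u, u] = 0 :=
  α.map_eq_zero_of_eq ![u, u] (i := 0) (j := 1) rfl (by simp)

theorem two_add_right (u v v' : E3) : α ![u, v + v'] = α ![u, v] + α ![u, v'] := by
  rw [two_swap α (v + v') u, two_add_left, two_swap α u v, two_swap α u v']; abel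

theorem two_smul_right (r : ℝ) (u v : E3) : α ![u, r • v] = r • α ![u, v] := by
  rw [two_swap α (r • v) u, two_smul_left, two_swap α u v, smul_neg, neg_neg]

theorem form_two_eq_sum (v w : E3) :
    α ![v, w] = (v 0 * w 1 - v 1 * w 0) • α ![e 0, e 1] + (v 0 * w 2 - v 2 * w 0) • α ![e 0, e 2]
      + (v 1 * w 2 - v 2 * w 1) • α ![e 1, e 2] := by
  conv_lhs => rw [eq_sum_e v, eq_sum_e w]
  simp only [two_add_left, two_add_right, two_smul_left, two_smul_right, two_self,
    two_swap α (e 0) (e 1), two_swap α (e 0) (e 2), two_swap α (e 1) (e 2)]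
  module

theorem three_curry (u v w : E3) : γ ![u, v, w] = γ.curryLeft u ![v, w] := by
  rw [ContinuousAlternatingMap.curryLeft_apply_apply]

theorem three_self (u v : E3) : γ ![u, u, v] = 0 ∧ γ ![u, v, u] = 0 ∧ γ ![v, u, u] = 0 :=
  ⟨γ.map_eq_zero_of_eq ![u, u, v] (i := 0) (j := 1) rfl (by simp),
    γ.map_eq_zero_of_eq ![u, v, u] (i := 0) (j := 2) rfl (by simp),
    γ.map_eq_zero_of_eq ![v, u, u] (i := 1) (j := 2) rfl (by simp)⟩

theorem three_swap (u v w : E3) : γ ![v, u, w] = - γ ![u, v, w] := by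
  refine Eq.trans (congrArg γ ?_) (γ.map_swap ![u, v, w] (i := 0) (j := 1) (by simp))
  funext i; fin_cases i <;> rfl

/-- The determinant of three vectors of `ℝ³`. -/
def det3 (u v w : E3) : ℝ :=
  u 0 * (v 1 * w 2 - v 2 * w 1) - u 1 * (v 0 * w 2 - v 2 * w 0) + u 2 * (v 0 * w 1 - v 1 * w 0)

theorem form_three_eq_smul (u v w : E3) :
    γ ![u, v, w] = det3 u v w • γ ![e 0, e 1, e 2] := by
  conv_lhs => rw [eq_sum_e u, three_curry]
  simp only [map_add, map_smul, ContinuousAlternatingMap.add_apply,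
    ContinuousAlternatingMap.smul_apply]
  rw [form_two_eq_sum _ v w, form_two_eq_sum (γ.curryLeft (e 1)) v w,
    form_two_eq_sum (γ.curryLeft (e 2)) v w]
  simp only [← three_curry, (three_self γ _ _).1, (three_self γ _ _).2.1]
  have h1 : γ ![e 1, e 0, e 2] = - γ ![e 0, e 1, e 2] := three_swap _ _ _ _
  have h2 : γ ![e 2, e 0, e 1] = γ ![e 0, e 1, e 2] := by
    rw [three_swap, three_curry, two_swap, ← three_curry, neg_neg]
  rw [h1, h2, det3]
  module

end Linear

theorem detForm_apply (u v w : E3) : detForm ![u, v, w] = det3 u v w := by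
  change (EuclideanSpace.basisFun (Fin 3) ℝ).toBasis.det ![u, v, w] = _
  rw [Module.Basis.det_apply, Matrix.det_fin_three]
  simp [Module.Basis.toMatrix_apply, det3]
  ring

theorem wedge_apply {k : ℕ} (β : V →L[ℝ] W →L[ℝ] Z) (α : E3 →L[ℝ] V) (η : Form k W)
    (v : Fin (k + 1) → E3) :
    wedge β α η v = ∑ i : Fin (k + 1), (-1 : ℝ) ^ (i : ℕ) • β (α (v i)) (η (i.removeNth v)) := by
  rw [wedge, ContinuousAlternatingMap.alternatizeUncurryFin_apply]
  refine Finset.sum_congr rfl fun i _ => ?_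
  rcases Nat.even_or_odd (i : ℕ) with h | h <;> simp [h.neg_one_pow]

theorem removeNth_one (v : E3) : (0 : Fin 1).removeNth ![v] = ![] := Subsingleton.elim _ _

theorem removeNth_two (v w : E3) :
    (0 : Fin 2).removeNth ![v, w] = ![w] ∧ (1 : Fin 2).removeNth ![v, w] = ![v] :=
  ⟨by funext i; fin_cases i; rfl, by funext i; fin_cases i; rfl⟩

theorem removeNth_three (u v w : E3) :
    (0 : Fin 3).removeNth ![u, v, w] = ![v, w] ∧ (1 : Fin 3).removeNth ![u, v, w] = ![u, w] ∧
      (2 : Fin 3).removeNth ![u, v, w] = ![u, v] :=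
  ⟨by funext i; fin_cases i <;> rfl, by funext i; fin_cases i <;> rfl,
    by funext i; fin_cases i <;> rfl⟩

theorem wedge_zero_apply (β : V →L[ℝ] W →L[ℝ] Z) (α : E3 →L[ℝ] V) (b : Form 0 W) (v : E3) :
    wedge β α b ![v] = β (α v) (b ![]) := by
  rw [wedge_apply, Fin.sum_univ_one, removeNth_one]
  simp

theorem wedge_one_apply (β : V →L[ℝ] W →L[ℝ] Z) (α : E3 →L[ℝ] V) (η : Form 1 W) (v w : E3) :
    wedge β α η ![v, w] = β (α v) (η ![w]) - β (α w) (η ![v]) := by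
  rw [wedge_apply, Fin.sum_univ_two, (removeNth_two v w).1, (removeNth_two v w).2]
  simp [sub_eq_add_neg]

theorem wedge_two_apply (β : V →L[ℝ] W →L[ℝ] Z) (α : E3 →L[ℝ] V) (η : Form 2 W) (u v w : E3) :
    wedge β α η ![u, v, w]
      = β (α u) (η ![v, w]) - β (α v) (η ![u, w]) + β (α w) (η ![u, v]) := by
  rw [wedge_apply, Fin.sum_univ_three, (removeNth_three u v w).1, (removeNth_three u v w).2.1,
    (removeNth_three u v w).2.2]
  simp [sub_eq_add_neg]

end Eval

/-! ### The Hodge star in coordinates -/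

section Star

variable {V W : Type*} [NormedAddCommGroup V] [NormedSpace ℝ V] [NormedAddCommGroup W]
  [NormedSpace ℝ W]

theorem volForm_apply (S : Matrix (Fin 3) (Fin 3) ℝ) (u v w : E3) :
    volForm S ![u, v, w] = √S.det * det3 u v w := by
  rw [volForm, ContinuousAlternatingMap.smul_apply, detForm_apply, smul_eq_mul]

theorem raised_apply (S : Matrix (Fin 3) (Fin 3) ℝ) (a i : Fin 3) : raised S a i = S⁻¹ a i := by
  fin_cases i <;> simp [raised, Fin.sum_univ_three, e_apply]

theorem star₁_apply (S : Matrix (Fin 3) (Fin 3) ℝ) (α : Form 1 V) (v w : E3) :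
    star₁ S α ![v, w] = ∑ a, (√S.det * det3 (e a) v w) • α ![raised S a] := by
  simp only [star₁, ContinuousAlternatingMap.sum_apply, ContinuousAlternatingMap.smulRight_apply,
    ContinuousAlternatingMap.curryLeft_apply_apply, ← volForm_apply]

theorem star₂_apply (S : Matrix (Fin 3) (Fin 3) ℝ) (β : Form 2 V) (v : E3) :
    star₂ S β ![v]
      = (1 / 2 : ℝ) • ∑ a, ∑ b, (√S.det * det3 (e a) (e b) v) • β ![raised S a, raised S b] := by
  simp only [star₂, ContinuousAlternatingMap.sum_apply, ContinuousAlternatingMap.smulRight_apply,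
    ContinuousAlternatingMap.curryLeft_apply_apply, ← volForm_apply,
    ContinuousAlternatingMap.smul_apply]

theorem star₁_apply_e (S : Matrix (Fin 3) (Fin 3) ℝ) (α : Form 1 V) :
    star₁ S α ![e 0, e 1] = √S.det • α ![raised S 2] ∧
      star₁ S α ![e 0, e 2] = -(√S.det • α ![raised S 1]) ∧
      star₁ S α ![e 1, e 2] = √S.det • α ![raised S 0] := by
  refine ⟨?_, ?_, ?_⟩ <;> simp [star₁_apply, det3, e_apply]

/-- The components of `*β` have no factor `1 / 2`: each pair of indices is met twice. -/
theorem star₂_apply_e (S : Matrix (Fin 3) (Fin 3) ℝ) (β : Form 2 V) :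
    star₂ S β ![e 0] = √S.det • β ![raised S 1, raised S 2] ∧
      star₂ S β ![e 1] = -(√S.det • β ![raised S 0, raised S 2]) ∧
      star₂ S β ![e 2] = √S.det • β ![raised S 0, raised S 1] := by
  refine ⟨?_, ?_, ?_⟩ <;>
  · simp [star₂_apply, Fin.sum_univ_three, det3, e_apply, two_swap β (raised S 1) (raised S 2),
      two_swap β (raised S 0) (raised S 2), two_swap β (raised S 0) (raised S 1)]
    module

theorem form_one_ext_e {α β : Form 1 V} (h : ∀ i, α ![e i] = β ![e i]) : α = β :=
  form_one_ext fun v => by rw [form_one_eq_sum, form_one_eq_sum β, h, h, h]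

theorem form_two_ext_e {α β : Form 2 V} (h₁ : α ![e 0, e 1] = β ![e 0, e 1])
    (h₂ : α ![e 0, e 2] = β ![e 0, e 2]) (h₃ : α ![e 1, e 2] = β ![e 1, e 2]) : α = β :=
  form_two_ext fun v w => by rw [form_two_eq_sum, form_two_eq_sum β, h₁, h₂, h₃]

theorem sqrt_det_mul_det_inv {S : Matrix (Fin 3) (Fin 3) ℝ} (hS : S.PosDef) :
    √S.det * √S.det * S⁻¹.det = 1 := by
  rw [Real.mul_self_sqrt hS.det_pos.le, ← Matrix.det_mul, Matrix.mul_nonsing_inv, Matrix.det_one]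
  exact hS.det_pos.ne'.isUnit

theorem inv_symm_apply {S : Matrix (Fin 3) (Fin 3) ℝ} (hS : S.PosDef) (a b : Fin 3) :
    S⁻¹ a b = S⁻¹ b a := by
  have := hS.inv.isHermitian.apply a b
  simpa using this.symm

/-- The Hodge star is an involution in dimension three: in coordinates, `**` is
multiplication by `det S * det S⁻¹`, with `det S⁻¹` expanded along a row. -/
theorem star₂_star₁ {S : Matrix (Fin 3) (Fin 3) ℝ} (hS : S.PosDef) (α : Form 1 V) :
    star₂ S (star₁ S α) = α := by
  have hd := sqrt_det_mul_det_inv hS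
  rw [Matrix.det_fin_three S⁻¹, inv_symm_apply hS 1 0, inv_symm_apply hS 2 0,
    inv_symm_apply hS 2 1] at hd
  have hk : ∀ i, star₂ S (star₁ S α) ![e i] = α ![e i] := by
    obtain ⟨h₀, h₁, h₂⟩ := star₂_apply_e S (star₁ S α)
    obtain ⟨k₀, k₁, k₂⟩ := star₁_apply_e S α
    intro i
    fin_cases i
    all_goals
      simp only [Fin.zero_eta, Fin.mk_one, Fin.reduceFinMk, h₀, h₁, h₂]
      simp only [form_two_eq_sum, k₀, k₁, k₂, form_one_eq_sum α (raised S _), raised_apply,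
        inv_symm_apply hS 1 0, inv_symm_apply hS 2 0, inv_symm_apply hS 2 1]
      match_scalars
    all_goals first | linear_combination hd | ring
  exact form_one_ext_e hk

theorem star₁_star₂ {S : Matrix (Fin 3) (Fin 3) ℝ} (hS : S.PosDef) (β : Form 2 V) :
    star₁ S (star₂ S β) = β := by
  have hd := sqrt_det_mul_det_inv hS
  rw [Matrix.det_fin_three S⁻¹, inv_symm_apply hS 1 0, inv_symm_apply hS 2 0,
    inv_symm_apply hS 2 1] at hd
  obtain ⟨h₀, h₁, h₂⟩ := star₂_apply_e S β
  obtain ⟨k₀, k₁, k₂⟩ := star₁_apply_e S (star₂ S β)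
  apply form_two_ext_e
  all_goals
    simp only [k₀, k₁, k₂]
    simp only [form_one_eq_sum (star₂ S β) (raised S _), h₀, h₁, h₂]
    simp only [form_two_eq_sum β (raised S _), raised_apply,
      inv_symm_apply hS 1 0, inv_symm_apply hS 2 0, inv_symm_apply hS 2 1]
    match_scalars
  all_goals first | linear_combination hd | ring

theorem star₂_smul (S : Matrix (Fin 3) (Fin 3) ℝ) (r : ℝ) (β : Form 2 V) :
    star₂ S (r • β) = r • star₂ S β :=
  form_one_ext fun v => by
    simp only [star₂_apply, ContinuousAlternatingMap.smul_apply, Finset.smul_sum]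
    simp only [smul_smul, mul_comm, mul_left_comm]

theorem star₂_comp (S : Matrix (Fin 3) (Fin 3) ℝ) (L : V →L[ℝ] W) (β : Form 2 V) :
    star₂ S (L.compContinuousAlternatingMap β) = L.compContinuousAlternatingMap (star₂ S β) :=
  form_one_ext fun v => by
    simp only [star₂_apply, ContinuousLinearMap.compContinuousAlternatingMap_coe,
      Function.comp_apply, map_smul, map_sum]

theorem star₃_smul (S : Matrix (Fin 3) (Fin 3) ℝ) (r : ℝ) (γ : Form 3 V) :
    star₃ S (r • γ) = r • star₃ S γ := by
  ext v
  simp only [star₃, ContinuousAlternatingMap.sum_apply, ContinuousAlternatingMap.smulRight_apply,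
    ContinuousAlternatingMap.smul_apply, Finset.smul_sum]
  simp only [smul_smul, mul_comm, mul_left_comm]

/-- The pairing `⟨α, β⟩_S` of `1`-forms: `κ` on the values and the inner product dual to `S` on the
covectors. -/
def pairing (S : Matrix (Fin 3) (Fin 3) ℝ) (κ : V →L[ℝ] V →L[ℝ] ℝ) (α β : Form 1 V) : ℝ :=
  ∑ a, ∑ b, S⁻¹ a b * κ (α ![e a]) (β ![e b])

/-- The defining property of the Hodge star, `α ∧ *β = ⟨α, β⟩ vol`. -/
theorem wedge_star₁ (S : Matrix (Fin 3) (Fin 3) ℝ) (κ : V →L[ℝ] V →L[ℝ] ℝ) (α β : Form 1 V) :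
    wedge κ (toLin α) (star₁ S β) ![e 0, e 1, e 2] = √S.det * pairing S κ α β := by
  obtain ⟨k₀, k₁, k₂⟩ := star₁_apply_e S β
  rw [wedge_two_apply]
  simp only [k₀, k₁, k₂, toLin_apply, form_one_eq_sum β (raised S _), raised_apply, pairing,
    Fin.sum_univ_three, map_add, map_smul, map_neg, smul_eq_mul]
  ring

open scoped MatrixOrder in
/-- If `κ` is positive definite on `L` then so is the pairing of `1`-forms with values in `L`: a
square root of the Gram matrix turns it into a sum of three values of `κ`. -/
theorem pairing_self {S : Matrix (Fin 3) (Fin 3) ℝ} (hS : S.PosDef) {κ : V →L[ℝ] V →L[ℝ] ℝ}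
    {L : Submodule ℝ V} (pos : ∀ x ∈ L, x ≠ 0 → 0 < κ x x) {α : Form 1 V} (hα : ∀ v, α ![v] ∈ L) :
    0 ≤ pairing S κ α α ∧ (pairing S κ α α = 0 → α = 0) := by
  obtain ⟨R, hR⟩ : ∃ R : Matrix (Fin 3) (Fin 3) ℝ, S⁻¹ = R.transpose * R := by
    obtain ⟨R, hR⟩ := CStarAlgebra.nonneg_iff_eq_star_mul_self.mp hS.inv.posSemidef.nonneg
    exact ⟨R, by simpa [Matrix.star_eq_conjTranspose] using hR⟩
  have nn : ∀ x ∈ L, 0 ≤ κ x x := fun x hx => by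
    by_cases h : x = 0
    · simp [h]
    · exact (pos x hx h).le
  set f : Fin 3 → V := fun c => ∑ a, R c a • α ![e a] with hf
  have fm : ∀ c, f c ∈ L := fun c => L.sum_mem fun a _ => L.smul_mem _ (hα _)
  have key : pairing S κ α α = ∑ c, κ (f c) (f c) := by
    rw [pairing, hR]
    simp only [hf, Matrix.mul_apply, Matrix.transpose_apply, Fin.sum_univ_three, map_add, map_smul,
      add_apply, smul_apply, smul_eq_mul]
    ring
  rw [key]
  refine ⟨Finset.sum_nonneg fun c _ => nn _ (fm c), fun h0 => ?_⟩
  have f0 : ∀ c, f c = 0 := fun c => by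
    by_contra hc
    have h1 := (Finset.sum_eq_zero_iff_of_nonneg fun c _ => nn _ (fm c)).1 h0 c (Finset.mem_univ c)
    exact (pos _ (fm c) hc).ne' h1
  have hdet : IsUnit R.det := by
    have h1 : S⁻¹.det ≠ 0 := hS.inv.det_pos.ne'
    rw [hR, Matrix.det_mul, Matrix.det_transpose] at h1
    exact (left_ne_zero_of_mul h1).isUnit
  refine form_one_ext_e fun a => ?_
  have h2 : ∑ c, R⁻¹ a c • f c = α ![e a] := by
    simp only [hf, Finset.smul_sum, smul_smul]
    rw [Finset.sum_comm]
    simp only [← Finset.sum_smul, ← Matrix.mul_apply, Matrix.nonsing_inv_mul R hdet,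
      Matrix.one_apply, ite_smul, one_smul, zero_smul]
    simp
  rw [← h2]
  simp [f0]

end Star

/-! ### Pull-back by linear maps and the Hodge star -/

section Pullback

variable {V W Z : Type*} [NormedAddCommGroup V] [NormedSpace ℝ V] [NormedAddCommGroup W]
  [NormedSpace ℝ W] [NormedAddCommGroup Z] [NormedSpace ℝ Z]

theorem pullback_one (J : E3 →L[ℝ] E3) (α : Form 1 V) (v : E3) :
    α.compContinuousLinearMap J ![v] = α ![J v] :=
  congrArg α (by funext i; fin_cases i; rfl)

theorem pullback_two (J : E3 →L[ℝ] E3) (α : Form 2 V) (v w : E3) :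
    α.compContinuousLinearMap J ![v, w] = α ![J v, J w] :=
  congrArg α (by funext i; fin_cases i <;> rfl)

theorem pullback_three (J : E3 →L[ℝ] E3) (α : Form 3 V) (u v w : E3) :
    α.compContinuousLinearMap J ![u, v, w] = α ![J u, J v, J w] :=
  congrArg α (by funext i; fin_cases i <;> rfl)

theorem wedge_pullback {k : ℕ} (β : V →L[ℝ] W →L[ℝ] Z) (α : E3 →L[ℝ] V) (η : Form k W)
    (J : E3 →L[ℝ] E3) :
    wedge β (α.comp J) (η.compContinuousLinearMap J)
      = (wedge β α η).compContinuousLinearMap J := by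
  ext v
  rw [ContinuousAlternatingMap.compContinuousLinearMap_apply, wedge_apply, wedge_apply]
  rfl

/-- The matrix of a linear map of `ℝ³`. -/
def mat (J : E3 →L[ℝ] E3) : Matrix (Fin 3) (Fin 3) ℝ := Matrix.of fun i a => J (e a) i

theorem map_e (J : E3 →L[ℝ] E3) (a : Fin 3) : J (e a) = ∑ i, mat J i a • e i := by
  conv_lhs => rw [eq_sum_e (J (e a))]
  rw [Fin.sum_univ_three]; rfl

theorem det_mat (J : E3 →L[ℝ] E3) : (mat J).det = J.det := by
  have h := LinearMap.det_toMatrix (EuclideanSpace.basisFun (Fin 3) ℝ).toBasis (J : E3 →ₗ[ℝ] E3)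
  rw [ContinuousLinearMap.det, ← h]
  congr 1

theorem det3_map (J : E3 →L[ℝ] E3) (u v w : E3) : det3 (J u) (J v) (J w) = J.det * det3 u v w := by
  rw [← detForm_apply, ← pullback_three, form_three_eq_smul, pullback_three, detForm_apply,
    ← det_mat, Matrix.det_fin_three, smul_eq_mul]
  simp only [det3, mat, Matrix.of_apply]
  ring

/-- Pulling back a `3`-form of `ℝ³` multiplies it by the determinant. -/
theorem pullback_three_e (γ : Form 3 ℝ) (J : E3 →L[ℝ] E3) :
    γ.compContinuousLinearMap J ![e 0, e 1, e 2] = J.det * γ ![e 0, e 1, e 2] := by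
  rw [pullback_three, form_three_eq_smul, det3_map, smul_eq_mul]
  simp [det3, e_apply]

/-- The Hodge star is natural under orientation preserving linear maps; `S'` is the Gram matrix of
the pulled-back inner product. -/
theorem star₁_pullback {S S' : Matrix (Fin 3) (Fin 3) ℝ} (J : E3 →L[ℝ] E3)
    (hJ : 0 < J.det) (hS' : S' = (mat J).transpose * S * mat J) (α : Form 1 V) :
    star₁ S' (α.compContinuousLinearMap J) = (star₁ S α).compContinuousLinearMap J := by
  have hd : √S'.det = J.det * √S.det := by
    rw [hS', Matrix.det_mul, Matrix.det_mul, Matrix.det_transpose, det_mat,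
      show J.det * S.det * J.det = J.det ^ 2 * S.det by ring, Real.sqrt_mul (sq_nonneg _),
      Real.sqrt_sq hJ.le]
  have hinv : mat J * S'⁻¹ * (mat J).transpose = S⁻¹ := by
    have hJu : IsUnit (mat J).det := by rw [det_mat]; exact hJ.ne'.isUnit
    rw [hS', Matrix.mul_inv_rev, Matrix.mul_inv_rev, ← Matrix.mul_assoc,
      Matrix.mul_nonsing_inv _ hJu, Matrix.one_mul, Matrix.mul_assoc, Matrix.nonsing_inv_mul,
      Matrix.mul_one]
    rwa [Matrix.det_transpose]
  refine form_two_ext fun v w => ?_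
  rw [pullback_two, star₁_apply, star₁_apply, hd]
  -- both sides are contractions of `S⁻¹ = J S'⁻¹ Jᵀ` with `det (·, J v, J w)` and `α`
  have h1 : ∀ a, α.compContinuousLinearMap J ![raised S' a]
      = ∑ k, (∑ b, S'⁻¹ a b * mat J k b) • α ![e k] := by
    intro a
    rw [pullback_one, form_one_eq_sum, Fin.sum_univ_three]
    simp only [raised, Fin.sum_univ_three]
    simp [mat]
  have h2 : ∀ a, J.det * det3 (e a) v w = ∑ i, mat J i a * det3 (e i) (J v) (J w) := by
    intro a
    rw [← det3_map, map_e]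
    simp only [Fin.sum_univ_three, det3]
    simp [e_apply]
    ring
  have h3 : ∀ i, α ![raised S i]
      = ∑ k, (∑ a, ∑ b, mat J i a * S'⁻¹ a b * mat J k b) • α ![e k] := by
    intro i
    rw [form_one_eq_sum, Fin.sum_univ_three]
    simp only [raised_apply, ← hinv, Matrix.mul_apply, Matrix.transpose_apply, Finset.sum_mul]
    simp only [Fin.sum_univ_three]
    module
  simp only [h1, h3]
  simp only [show ∀ a, J.det * √S.det * det3 (e a) v w = √S.det * (J.det * det3 (e a) v w) from
    fun a => by ring, h2]
  simp only [Fin.sum_univ_three]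
  module

end Pullback

/-! ### The Lie algebra of the structure group -/

section Lie

variable {N : ℕ} {G : Subgroup (SO N)}

/-- The inverse in `SO(N)` is, by definition, the transpose. -/
theorem coe_inv_SO (h : SO N) : ((h⁻¹ : SO N) : Mat N) = (h : Mat N).transpose := rfl

theorem coe_mul_inv_SO (h : SO N) : (h : Mat N) * ((h⁻¹ : SO N) : Mat N) = 1 := by
  rw [← Submonoid.coe_mul, mul_inv_cancel]; rfl

theorem coe_inv_mul_SO (h : SO N) : ((h⁻¹ : SO N) : Mat N) * (h : Mat N) = 1 := by
  rw [← Submonoid.coe_mul, inv_mul_cancel]; rfl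

/-- The Lie algebra of `G` as a linear subspace. -/
def lieSub (G : Subgroup (SO N)) : Submodule ℝ (Mat N) where
  carrier := lieAlg G
  zero_mem' := ⟨fun _ => 1, fun _ => ⟨1, G.one_mem, rfl⟩, rfl, hasDerivAt_const _ _⟩
  add_mem' := by
    rintro X Y ⟨γ, hγ, h0, hX⟩ ⟨δ, hδ, k0, hY⟩
    refine ⟨fun t => γ t * δ t, fun t => ?_, by simp [h0, k0], ?_⟩
    · obtain ⟨g, hg, e1⟩ := hγ t
      obtain ⟨h, hh, e2⟩ := hδ t
      exact ⟨g * h, G.mul_mem hg hh, by simp [← e1, ← e2]⟩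
    · exact (hX.mul hY).congr_deriv (by simp [h0, k0])
  smul_mem' := by
    rintro r X ⟨γ, hγ, h0, hX⟩
    refine ⟨fun t => γ (r * t), fun t => hγ _, by simpa using h0, ?_⟩
    have h1 : HasDerivAt (fun t : ℝ => r * t) r 0 := by
      simpa using (hasDerivAt_id (0 : ℝ)).const_mul r
    have h2 : HasDerivAt γ X (r * 0) := by simpa using hX
    exact h2.scomp (0 : ℝ) h1

theorem conj_mem {h : SO N} (hh : h ∈ G) {X : Mat N} (hX : X ∈ lieSub G) :
    (h : Mat N) * X * ((h⁻¹ : SO N) : Mat N) ∈ lieSub G := by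
  obtain ⟨γ, hγ, h0, hd⟩ := hX
  refine ⟨fun t => (h : Mat N) * γ t * ((h⁻¹ : SO N) : Mat N), fun t => ?_, ?_, ?_⟩
  · obtain ⟨g, hg, e1⟩ := hγ t
    exact ⟨h * g * h⁻¹, G.mul_mem (G.mul_mem hh hg) (G.inv_mem hh), by simp [← e1]⟩
  · simp only [h0, mul_one, coe_mul_inv_SO]
  · exact (hd.const_mul _).mul_const _

/-- Velocities of curves in a finite-dimensional subspace lie in it. -/
theorem mem_of_hasDerivAt {V : Type*} [NormedAddCommGroup V] [NormedSpace ℝ V]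
    [FiniteDimensional ℝ V] {L : Submodule ℝ V} {f : ℝ → V} {f' : V} {x : ℝ}
    (h : HasDerivAt f f' x) (hf : ∀ t, f t ∈ L) : f' ∈ L := by
  refine L.closed_of_finiteDimensional.mem_of_tendsto h.tendsto_slope
    (Filter.Eventually.of_forall fun t => ?_)
  exact L.smul_mem _ (L.sub_mem (hf _) (hf _))

/-- The adjoint action of a curve in `G` has the bracket as its derivative. -/
theorem hasDerivAt_conj {γ : ℝ → Mat N} {X : Mat N} (hγ : ∀ t, ∃ h ∈ G, (h : Mat N) = γ t)
    (h0 : γ 0 = 1) (hX : HasDerivAt γ X 0) (Y : Mat N) :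
    HasDerivAt (fun t => γ t * Y * (γ t).transpose) (X * Y - Y * X) 0 := by
  have hT : HasDerivAt (fun t => (γ t).transpose) X.transpose 0 :=
    (Matrix.transposeLinearEquiv (Fin N) (Fin N) ℝ ℝ).toLinearMap.toContinuousLinearMap
      |>.hasFDerivAt.comp_hasDerivAt 0 hX
  -- the curve is orthogonal, so its velocity is skew-symmetric
  have hskew : X.transpose = -X := by
    have h1 : HasDerivAt (fun t => γ t * (γ t).transpose) (X + X.transpose) 0 := by
      exact (hX.mul hT).congr_deriv (by simp [h0])
    have h2 : (fun t => γ t * (γ t).transpose) = fun _ => 1 := by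
      funext t
      obtain ⟨g, -, e1⟩ := hγ t
      rw [← e1, ← coe_inv_SO, coe_mul_inv_SO]
    rw [h2] at h1
    exact eq_neg_of_add_eq_zero_right (h1.unique (hasDerivAt_const _ _))
  exact ((hX.mul_const Y).mul hT).congr_deriv (by simp [h0, hskew, sub_eq_add_neg])

/-- The Lie algebra is closed under brackets: `[X, Y]` is the velocity of a curve
`t ↦ γ t Y (γ t)⁻¹` in the Lie algebra, which is a closed subspace. -/
theorem bracket_mem {X Y : Mat N} (hX : X ∈ lieSub G) (hY : Y ∈ lieSub G) :
    X * Y - Y * X ∈ lieSub G := by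
  obtain ⟨γ, hγ, h0, hd⟩ := hX
  refine mem_of_hasDerivAt (hasDerivAt_conj hγ h0 hd Y) fun t => ?_
  obtain ⟨g, hg, e1⟩ := hγ t
  rw [← e1, ← coe_inv_SO]
  exact conj_mem hg hY

theorem hasDerivAt_bilin {V W Z : Type*} [NormedAddCommGroup V] [NormedSpace ℝ V]
    [NormedAddCommGroup W] [NormedSpace ℝ W] [NormedAddCommGroup Z] [NormedSpace ℝ Z]
    (β : V →L[ℝ] W →L[ℝ] Z) {f : ℝ → V} {g : ℝ → W} {f' : V} {g' : W} {t : ℝ}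
    (hf : HasDerivAt f f' t) (hg : HasDerivAt g g' t) :
    HasDerivAt (fun s => β (f s) (g s)) (β f' (g t) + β (f t) g') t :=
  (β.hasFDerivAt.comp_hasDerivAt t hf).clm_apply hg

theorem InvInner.conj_inv (κ : InvInner G) {h : SO N} (hh : h ∈ G) {X Y : Mat N}
    (hX : X ∈ lieSub G) (hY : Y ∈ lieSub G) :
    κ.form (((h⁻¹ : SO N) : Mat N) * X * (h : Mat N)) (((h⁻¹ : SO N) : Mat N) * Y * (h : Mat N))
      = κ.form X Y := by
  simpa using κ.invariant h⁻¹ (G.inv_mem hh) X hX Y hY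

/-- Infinitesimal invariance of an `Ad`-invariant inner product. -/
theorem InvInner.bracket (κ : InvInner G) {X Y Z : Mat N} (hX : X ∈ lieSub G)
    (hY : Y ∈ lieSub G) (hZ : Z ∈ lieSub G) :
    κ.form (X * Y - Y * X) Z + κ.form Y (X * Z - Z * X) = 0 := by
  obtain ⟨γ, hγ, h0, hd⟩ := hX
  have h1 := hasDerivAt_conj hγ h0 hd Y
  have h2 := hasDerivAt_conj hγ h0 hd Z
  have h3 := hasDerivAt_bilin κ.form h1 h2
  have h4 : (fun t => κ.form (γ t * Y * (γ t).transpose) (γ t * Z * (γ t).transpose))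
      = fun _ => κ.form Y Z := by
    funext t
    obtain ⟨g, hg, e1⟩ := hγ t
    rw [← e1, ← coe_inv_SO]
    exact κ.invariant g hg Y hY Z hZ
  have h5 := HasDerivAt.unique (h4 ▸ h3) (hasDerivAt_const _ _)
  simpa [h0] using h5

end Lie

/-! ### Calculus of forms on the half-space -/

section Calculus

variable {V W Z : Type*} [NormedAddCommGroup V] [NormedSpace ℝ V] [NormedAddCommGroup W]
  [NormedSpace ℝ W] [NormedAddCommGroup Z] [NormedSpace ℝ Z] {y : E3}

theorem uniqueDiffOn_halfSpace : UniqueDiffOn ℝ halfSpace := I3.uniqueDiffOn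

theorem mem_closure_interior_halfSpace (hy : y ∈ halfSpace) : y ∈ closure (interior halfSpace) :=
  I3.range_subset_closure_interior hy

theorem fderivWithin_bilin (β : V →L[ℝ] W →L[ℝ] Z) {f : E3 → V} {g : E3 → W} (hy : y ∈ halfSpace)
    (hf : DifferentiableWithinAt ℝ f halfSpace y) (hg : DifferentiableWithinAt ℝ g halfSpace y)
    (u : E3) :
    fderivWithin ℝ (fun z => β (f z) (g z)) halfSpace y u
      = β (fderivWithin ℝ f halfSpace y u) (g y) + β (f y) (fderivWithin ℝ g halfSpace y u) := by
  rw [β.fderivWithin_of_bilinear hf hg (uniqueDiffOn_halfSpace y hy), add_comm]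
  rfl

theorem fderivWithin_apply_const {f : E3 → V →L[ℝ] W} (hy : y ∈ halfSpace)
    (hf : DifferentiableWithinAt ℝ f halfSpace y) (v : V) (u : E3) :
    fderivWithin ℝ (fun z => f z v) halfSpace y u = fderivWithin ℝ f halfSpace y u v := by
  rw [fderivWithin_clm_apply (uniqueDiffOn_halfSpace y hy) hf (differentiableWithinAt_const v)]
  simp

theorem diff_of_smooth {f : E3 → V} (h : ContDiffWithinAt ℝ ∞ f halfSpace y) :
    DifferentiableWithinAt ℝ f halfSpace y := h.differentiableWithinAt (by simp)

theorem contDiffWithinAt_clm (L : V →L[ℝ] W) {f : E3 → V}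
    (h : ContDiffWithinAt ℝ ∞ f halfSpace y) :
    ContDiffWithinAt ℝ ∞ (fun z => L (f z)) halfSpace y :=
  L.contDiff.comp_contDiffWithinAt h

theorem contDiffWithinAt_fderivWithin {f : E3 → V} (hy : y ∈ halfSpace)
    (h : ContDiffWithinAt ℝ ∞ f halfSpace y) :
    ContDiffWithinAt ℝ ∞ (fderivWithin ℝ f halfSpace) halfSpace y :=
  h.fderivWithin_right uniqueDiffOn_halfSpace (by simp) hy

theorem contDiffWithinAt_oneForm {f : E3 → E3 →L[ℝ] V} (h : ContDiffWithinAt ℝ ∞ f halfSpace y) :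
    ContDiffWithinAt ℝ ∞ (fun z => oneForm (f z)) halfSpace y :=
  (ContinuousAlternatingMap.ofSubsingletonLIE (𝕜 := ℝ) (E := E3) (F := V) (0 : Fin 1)).contDiff
    |>.comp_contDiffWithinAt h

theorem contDiffWithinAt_zeroForm {f : E3 → V} (h : ContDiffWithinAt ℝ ∞ f halfSpace y) :
    ContDiffWithinAt ℝ ∞ (fun z => zeroForm (f z)) halfSpace y :=
  (ContinuousAlternatingMap.constOfIsEmptyLIE ℝ E3 V (Fin 0)).contDiff.comp_contDiffWithinAt h

theorem contDiffWithinAt_extDerivWithin {k : ℕ} {f : E3 → Form k V} (hy : y ∈ halfSpace)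
    (h : ContDiffWithinAt ℝ ∞ f halfSpace y) :
    ContDiffWithinAt ℝ ∞ (extDerivWithin f halfSpace) halfSpace y :=
  contDiffWithinAt_clm (ContinuousAlternatingMap.alternatizeUncurryFinCLM ℝ E3 V)
    (contDiffWithinAt_fderivWithin hy h)

theorem contDiffWithinAt_comp_form {k : ℕ} {L : E3 → V →L[ℝ] W} {f : E3 → Form k V}
    (hL : ContDiffWithinAt ℝ ∞ L halfSpace y) (h : ContDiffWithinAt ℝ ∞ f halfSpace y) :
    ContDiffWithinAt ℝ ∞ (fun z => (L z).compContinuousAlternatingMap (f z)) halfSpace y :=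
  (contDiffWithinAt_clm (ContinuousLinearMap.compContinuousAlternatingMapCLM (𝕜 := ℝ) (E := E3)
    (ι := Fin k) (F := V) (G := W)) hL).clm_apply h

theorem contDiffWithinAt_wedge {k : ℕ} (β : V →L[ℝ] W →L[ℝ] Z) {α : E3 → E3 →L[ℝ] V}
    {η : E3 → Form k W} (hα : ContDiffWithinAt ℝ ∞ α halfSpace y)
    (hη : ContDiffWithinAt ℝ ∞ η halfSpace y) :
    ContDiffWithinAt ℝ ∞ (fun z => wedge β (α z) (η z)) halfSpace y :=
  contDiffWithinAt_clm (ContinuousAlternatingMap.alternatizeUncurryFinCLM ℝ E3 Z)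
    ((contDiffWithinAt_clm (ContinuousLinearMap.compContinuousAlternatingMapCLM (𝕜 := ℝ) (E := E3)
      (ι := Fin k) (F := W) (G := Z)).flip hη).clm_comp (contDiffWithinAt_const.clm_comp hα))

theorem smulRight_eq_comp {k : ℕ} (ζ : Form k ℝ) (b : V) :
    ζ.smulRight b
      = ((ContinuousLinearMap.lsmul ℝ ℝ (E := V)).flip b).compContinuousAlternatingMap ζ := by
  ext v; rfl

theorem contDiffWithinAt_smulRight {k : ℕ} {ζ : E3 → Form k ℝ} {b : E3 → V}
    (hζ : ContDiffWithinAt ℝ ∞ ζ halfSpace y) (hb : ContDiffWithinAt ℝ ∞ b halfSpace y) :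
    ContDiffWithinAt ℝ ∞ (fun z => (ζ z).smulRight (b z)) halfSpace y := by
  simp only [smulRight_eq_comp]
  exact contDiffWithinAt_comp_form
    (contDiffWithinAt_clm (ContinuousLinearMap.lsmul ℝ ℝ (E := V)).flip hb) hζ

theorem contDiffWithinAt_form_apply {k : ℕ} {f : E3 → Form k V}
    (h : ContDiffWithinAt ℝ ∞ f halfSpace y) (v : Fin k → E3) :
    ContDiffWithinAt ℝ ∞ (fun z => f z v) halfSpace y :=
  contDiffWithinAt_clm (ContinuousAlternatingMap.apply ℝ E3 V v) h

theorem extDerivWithin_one_apply {f : E3 → Form 1 V} (hy : y ∈ halfSpace)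
    (h : ContDiffWithinAt ℝ ∞ f halfSpace y) (v w : E3) :
    extDerivWithin f halfSpace y ![v, w]
      = fderivWithin ℝ (fun z => f z ![w]) halfSpace y v
        - fderivWithin ℝ (fun z => f z ![v]) halfSpace y w := by
  rw [extDerivWithin_apply (diff_of_smooth h) (uniqueDiffOn_halfSpace y hy), Fin.sum_univ_two,
    (removeNth_two v w).1, (removeNth_two v w).2]
  simp [sub_eq_add_neg]

theorem extDerivWithin_two_apply {f : E3 → Form 2 V} (hy : y ∈ halfSpace)
    (h : ContDiffWithinAt ℝ ∞ f halfSpace y) (u v w : E3) :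
    extDerivWithin f halfSpace y ![u, v, w]
      = fderivWithin ℝ (fun z => f z ![v, w]) halfSpace y u
        - fderivWithin ℝ (fun z => f z ![u, w]) halfSpace y v
        + fderivWithin ℝ (fun z => f z ![u, v]) halfSpace y w := by
  rw [extDerivWithin_apply (diff_of_smooth h) (uniqueDiffOn_halfSpace y hy), Fin.sum_univ_three,
    (removeNth_three u v w).1, (removeNth_three u v w).2.1, (removeNth_three u v w).2.2]
  simp [sub_eq_add_neg]

theorem extDerivWithin_zeroForm (hy : y ∈ halfSpace) (f : E3 → V) :
    extDerivWithin (fun z => zeroForm (f z)) halfSpace y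
      = oneForm (fderivWithin ℝ f halfSpace y) :=
  extDerivWithin_constOfIsEmpty f (uniqueDiffOn_halfSpace y hy)

theorem extDerivWithin_extDerivWithin {k : ℕ} {f : E3 → Form k V} (hy : y ∈ halfSpace)
    (h : ContDiffWithinAt ℝ ∞ f halfSpace y) :
    extDerivWithin (extDerivWithin f halfSpace) halfSpace y = 0 :=
  extDerivWithin_extDerivWithin_apply h
    (by rw [minSmoothness_of_isRCLikeNormedField]; exact ENat.LEInfty.out) uniqueDiffOn_halfSpace
    (mem_closure_interior_halfSpace hy) hy

theorem extDerivWithin_add_of_smooth {k : ℕ} {f g : E3 → Form k V} (hy : y ∈ halfSpace)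
    (hf : ContDiffWithinAt ℝ ∞ f halfSpace y) (hg : ContDiffWithinAt ℝ ∞ g halfSpace y) :
    extDerivWithin (fun z => f z + g z) halfSpace y
      = extDerivWithin f halfSpace y + extDerivWithin g halfSpace y :=
  extDerivWithin_fun_add (uniqueDiffOn_halfSpace y hy) (diff_of_smooth hf) (diff_of_smooth hg)

/-- The derivative of a function with values in a linear subspace has values in it. -/
theorem fderivWithin_mem [FiniteDimensional ℝ V] {L : Submodule ℝ V} {f : E3 → V}
    (hy : y ∈ halfSpace) (hf : DifferentiableWithinAt ℝ f halfSpace y)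
    (hL : ∀ᶠ z in nhdsWithin y halfSpace, f z ∈ L) (u : E3) :
    fderivWithin ℝ f halfSpace y u ∈ L := by
  by_contra hu
  obtain ⟨φ, h1, h2⟩ := Submodule.exists_le_ker_of_notMem (K := ℝ) (p := L) hu
  have h3 : (fun z => LinearMap.toContinuousLinearMap φ (f z)) =ᶠ[nhdsWithin y halfSpace]
      fun _ => (0 : ℝ) := hL.mono fun z hz => h2 hz
  have h4 := h3.fderivWithin_eq (𝕜 := ℝ) (h2 (hL.self_of_nhdsWithin hy))
  have h5 := ((LinearMap.toContinuousLinearMap φ).hasFDerivAt.comp_hasFDerivWithinAt y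
    hf.hasFDerivWithinAt).fderivWithin (uniqueDiffOn_halfSpace y hy)
  have h6 := DFunLike.congr_fun (h5.symm.trans h4) u
  exact h1 (by simpa using h6)

end Calculus

/-! ### Structure equations of cone Yang-Mills theory in coordinates -/

namespace LocalData

variable {N : ℕ} {D D' : LocalData N} {y : E3}

/-- The fields `A`, `B` and `ζ` are smooth at `y`, within the half-space. The Gram matrix is left
out: only its continuity is needed, for the energy density. -/
structure SmoothAt (D : LocalData N) (y : E3) : Prop where
  mem : y ∈ halfSpace
  A : ContDiffWithinAt ℝ ∞ D.A halfSpace y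
  B : ContDiffWithinAt ℝ ∞ D.B halfSpace y
  zeta : ContDiffWithinAt ℝ ∞ D.zeta halfSpace y

theorem mulL_apply (X Y : Mat N) : mulL N X Y = X * Y := rfl

theorem brL_apply (X Y : Mat N) : brL N X Y = X * Y - Y * X := rfl

theorem curv_apply (h : D.SmoothAt y) (v w : E3) :
    D.curv y ![v, w] = fderivWithin ℝ D.A halfSpace y v w - fderivWithin ℝ D.A halfSpace y w v
      + (D.A y v * D.A y w - D.A y w * D.A y v) := by
  rw [curv, ContinuousAlternatingMap.add_apply, wedge_one_apply,
    extDerivWithin_one_apply h.mem (contDiffWithinAt_oneForm h.A)]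
  simp only [oneForm_apply, Matrix.cons_val_zero]
  rw [fderivWithin_apply_const h.mem (diff_of_smooth h.A),
    fderivWithin_apply_const h.mem (diff_of_smooth h.A)]
  rfl

theorem dB_apply (hy : y ∈ halfSpace) (v : E3) :
    D.dB y ![v] = fderivWithin ℝ D.B halfSpace y v + (D.A y v * D.B y - D.B y * D.A y v) := by
  rw [dB, covD, ContinuousAlternatingMap.add_apply, wedge_zero_apply, extDerivWithin_zeroForm hy]
  rfl

theorem coneCurv_apply (v w : E3) :
    D.coneCurv y ![v, w] = D.curv y ![v, w] + D.zeta y ![v, w] • D.B y := rfl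

theorem SmoothAt.curv (h : D.SmoothAt y) : ContDiffWithinAt ℝ ∞ D.curv halfSpace y :=
  (contDiffWithinAt_extDerivWithin h.mem (contDiffWithinAt_oneForm h.A)).add
    (contDiffWithinAt_wedge _ h.A (contDiffWithinAt_oneForm h.A))

theorem SmoothAt.coneCurv (h : D.SmoothAt y) : ContDiffWithinAt ℝ ∞ D.coneCurv halfSpace y :=
  h.curv.add (contDiffWithinAt_smulRight h.zeta h.B)

theorem SmoothAt.dB (h : D.SmoothAt y) : ContDiffWithinAt ℝ ∞ D.dB halfSpace y :=
  (contDiffWithinAt_extDerivWithin h.mem (contDiffWithinAt_zeroForm h.B)).add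
    (contDiffWithinAt_wedge _ h.A (contDiffWithinAt_zeroForm h.B))

theorem contDiffWithinAt_eval {f : E3 → E3 →L[ℝ] Mat N} (h : ContDiffWithinAt ℝ ∞ f halfSpace y)
    (v : E3) : ContDiffWithinAt ℝ ∞ (fun z => f z v) halfSpace y :=
  h.clm_apply contDiffWithinAt_const

theorem fderivWithin_mat_mul {f g : E3 → Mat N} (hy : y ∈ halfSpace)
    (hf : ContDiffWithinAt ℝ ∞ f halfSpace y) (hg : ContDiffWithinAt ℝ ∞ g halfSpace y) (u : E3) :
    fderivWithin ℝ (fun z => f z * g z) halfSpace y u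
      = fderivWithin ℝ f halfSpace y u * g y + f y * fderivWithin ℝ g halfSpace y u :=
  fderivWithin_bilin (mulL N) hy (diff_of_smooth hf) (diff_of_smooth hg) u

theorem fderivWithin_br {f g : E3 → Mat N} (hy : y ∈ halfSpace)
    (hf : ContDiffWithinAt ℝ ∞ f halfSpace y) (hg : ContDiffWithinAt ℝ ∞ g halfSpace y) (u : E3) :
    fderivWithin ℝ (fun z => f z * g z - g z * f z) halfSpace y u
      = fderivWithin ℝ f halfSpace y u * g y - g y * fderivWithin ℝ f halfSpace y u
        + (f y * fderivWithin ℝ g halfSpace y u - fderivWithin ℝ g halfSpace y u * f y) :=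
  fderivWithin_bilin (brL N) hy (diff_of_smooth hf) (diff_of_smooth hg) u

/-- The Bianchi identity `d_A d_A B = [F_A, B]`, with the right-hand side written as `-[B, F_A]`. -/
theorem covD_dB (h : D.SmoothAt y) :
    D.covD D.dB y = -(brL N (D.B y)).compContinuousAlternatingMap (D.curv y) := by
  have h0 : extDerivWithin D.dB halfSpace y
      = extDerivWithin (fun z => wedge (brL N) (D.A z) (zeroForm (D.B z))) halfSpace y := by
    have h1 := extDerivWithin_add_of_smooth h.mem
      (contDiffWithinAt_extDerivWithin h.mem (contDiffWithinAt_zeroForm h.B))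
      (contDiffWithinAt_wedge (brL N) h.A (contDiffWithinAt_zeroForm h.B))
    rw [extDerivWithin_extDerivWithin h.mem (contDiffWithinAt_zeroForm h.B)] at h1
    exact h1.trans (zero_add _)
  refine form_two_ext fun v w => ?_
  rw [covD, h0, ContinuousAlternatingMap.add_apply, wedge_one_apply, dB_apply h.mem,
    dB_apply h.mem, extDerivWithin_one_apply h.mem
      (contDiffWithinAt_wedge _ h.A (contDiffWithinAt_zeroForm h.B))]
  simp only [wedge_zero_apply, brL_apply, zeroForm_apply]
  rw [fderivWithin_br h.mem (contDiffWithinAt_eval h.A _) h.B,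
    fderivWithin_br h.mem (contDiffWithinAt_eval h.A _) h.B,
    fderivWithin_apply_const h.mem (diff_of_smooth h.A),
    fderivWithin_apply_const h.mem (diff_of_smooth h.A), ContinuousAlternatingMap.neg_apply,
    ContinuousLinearMap.compContinuousAlternatingMap_coe, Function.comp_apply, curv_apply h,
    brL_apply]
  noncomm_ring

/-- The Bianchi identity `d F_A + [A ∧ F_A] = 0`. -/
theorem extDerivWithin_curv (h : D.SmoothAt y) :
    extDerivWithin D.curv halfSpace y = -wedge (brL N) (D.A y) (D.curv y) := by
  have hw := contDiffWithinAt_wedge (mulL N) h.A (contDiffWithinAt_oneForm h.A)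
  have h0 : extDerivWithin D.curv halfSpace y
      = extDerivWithin (fun z => wedge (mulL N) (D.A z) (oneForm (D.A z))) halfSpace y := by
    have h1 := extDerivWithin_add_of_smooth h.mem
      (contDiffWithinAt_extDerivWithin h.mem (contDiffWithinAt_oneForm h.A)) hw
    rw [extDerivWithin_extDerivWithin h.mem (contDiffWithinAt_oneForm h.A)] at h1
    exact h1.trans (zero_add _)
  refine form_three_ext fun u v w => ?_
  rw [h0, extDerivWithin_two_apply h.mem hw, ContinuousAlternatingMap.neg_apply, wedge_two_apply]
  simp only [wedge_one_apply, mulL_apply, brL_apply, oneForm_apply, Matrix.cons_val_zero]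
  rw [fderivWithin_br h.mem (contDiffWithinAt_eval h.A _) (contDiffWithinAt_eval h.A _),
    fderivWithin_br h.mem (contDiffWithinAt_eval h.A _) (contDiffWithinAt_eval h.A _),
    fderivWithin_br h.mem (contDiffWithinAt_eval h.A _) (contDiffWithinAt_eval h.A _)]
  simp only [fderivWithin_apply_const h.mem (diff_of_smooth h.A), curv_apply h]
  noncomm_ring

/-- The Bianchi identity of the cone curvature, `d_A (F_A + ζ B) = ζ ∧ d_A B`. -/
theorem covD_coneCurv (h : D.SmoothAt y) (hζ : extDerivWithin D.zeta halfSpace y = 0) :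
    D.covD D.coneCurv y
      = wedge (ContinuousLinearMap.lsmul ℝ ℝ (E := Mat N)).flip (toLin (D.dB y)) (D.zeta y) := by
  have hs := contDiffWithinAt_smulRight h.zeta h.B
  have h1 : extDerivWithin D.coneCurv halfSpace y = _ :=
    extDerivWithin_add_of_smooth h.mem h.curv hs
  refine form_three_ext fun u v w => ?_
  have hζ' := extDerivWithin_two_apply h.mem h.zeta u v w
  rw [hζ] at hζ'
  change (0 : ℝ) = _ at hζ'
  have h2 : ∀ v w u, fderivWithin ℝ (fun z => (D.zeta z).smulRight (D.B z) ![v, w]) halfSpace y u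
      = fderivWithin ℝ (fun z => D.zeta z ![v, w]) halfSpace y u • D.B y
        + D.zeta y ![v, w] • fderivWithin ℝ D.B halfSpace y u := fun v w u =>
    fderivWithin_bilin (ContinuousLinearMap.lsmul ℝ ℝ (E := Mat N)) h.mem
      (diff_of_smooth (contDiffWithinAt_form_apply h.zeta _)) (diff_of_smooth h.B) u
  rw [covD, h1, extDerivWithin_curv h]
  simp only [ContinuousAlternatingMap.add_apply, ContinuousAlternatingMap.neg_apply]
  rw [extDerivWithin_two_apply h.mem hs]
  simp only [wedge_two_apply, h2, coneCurv_apply, toLin_apply, dB_apply h.mem, brL_apply,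
    ContinuousLinearMap.flip_apply, ContinuousLinearMap.lsmul_apply]
  have h3 : fderivWithin ℝ (fun z => D.zeta z ![v, w]) halfSpace y u
      = fderivWithin ℝ (fun z => D.zeta z ![u, w]) halfSpace y v
        - fderivWithin ℝ (fun z => D.zeta z ![u, v]) halfSpace y w := by linarith
  rw [h3]
  simp only [mul_add, add_mul, mul_smul_comm, smul_mul_assoc]
  module

end LocalData

/-! ### Exactness of the charge density, gauge transformations, coordinate changes -/

namespace LocalData

variable {N : ℕ} {D D' : LocalData N} {y : E3} {G : Subgroup (SO N)}

/-- The fields have values in the Lie algebra near `y`, within the half-space. -/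
structure ValuedAt (D : LocalData N) (G : Subgroup (SO N)) (y : E3) : Prop where
  A : ∀ᶠ z in nhdsWithin y halfSpace, ∀ v, D.A z v ∈ lieSub G
  B : ∀ᶠ z in nhdsWithin y halfSpace, D.B z ∈ lieSub G

theorem ValuedAt.A_mem (hv : D.ValuedAt G y) (hy : y ∈ halfSpace) (v : E3) : D.A y v ∈ lieSub G :=
  hv.A.self_of_nhdsWithin hy v

theorem ValuedAt.B_mem (hv : D.ValuedAt G y) (hy : y ∈ halfSpace) : D.B y ∈ lieSub G :=
  hv.B.self_of_nhdsWithin hy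

theorem ValuedAt.curv_mem (hv : D.ValuedAt G y) (h : D.SmoothAt y) (v w : E3) :
    D.curv y ![v, w] ∈ lieSub G := by
  have hA : ∀ v w, fderivWithin ℝ D.A halfSpace y v w ∈ lieSub G := fun v w => by
    rw [← fderivWithin_apply_const h.mem (diff_of_smooth h.A)]
    exact fderivWithin_mem h.mem (diff_of_smooth (contDiffWithinAt_eval h.A w))
      (hv.A.mono fun z hz => hz w) v
  rw [curv_apply h]
  exact (lieSub G).add_mem ((lieSub G).sub_mem (hA _ _) (hA _ _))
    (bracket_mem (hv.A_mem h.mem _) (hv.A_mem h.mem _))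

theorem ValuedAt.dB_mem (hv : D.ValuedAt G y) (h : D.SmoothAt y) (v : E3) :
    D.dB y ![v] ∈ lieSub G := by
  rw [dB_apply h.mem]
  exact (lieSub G).add_mem (fderivWithin_mem h.mem (diff_of_smooth h.B) hv.B v)
    (bracket_mem (hv.A_mem h.mem _) (hv.B_mem h.mem))

theorem ValuedAt.coneCurv_mem (hv : D.ValuedAt G y) (h : D.SmoothAt y) (v w : E3) :
    D.coneCurv y ![v, w] ∈ lieSub G := by
  rw [coneCurv_apply]
  exact (lieSub G).add_mem (hv.curv_mem h v w) ((lieSub G).smul_mem _ (hv.B_mem h.mem))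

theorem contDiffWithinAt_bilin {V W Z : Type*} [NormedAddCommGroup V] [NormedSpace ℝ V]
    [NormedAddCommGroup W] [NormedSpace ℝ W] [NormedAddCommGroup Z] [NormedSpace ℝ Z]
    (β : V →L[ℝ] W →L[ℝ] Z) {f : E3 → V} {g : E3 → W} (hf : ContDiffWithinAt ℝ ∞ f halfSpace y)
    (hg : ContDiffWithinAt ℝ ∞ g halfSpace y) :
    ContDiffWithinAt ℝ ∞ (fun z => β (f z) (g z)) halfSpace y :=
  (contDiffWithinAt_clm β hf).clm_apply hg

theorem SmoothAt.boundaryForm (h : D.SmoothAt y) (κ : Mat N →L[ℝ] Mat N →L[ℝ] ℝ) :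
    ContDiffWithinAt ℝ ∞ (D.boundaryForm κ) halfSpace y := by
  have c : ContDiffWithinAt ℝ ∞ (fun z => 1 / 2 * κ (D.B z) (D.B z)) halfSpace y :=
    contDiffWithinAt_const.mul (contDiffWithinAt_bilin κ h.B h.B)
  exact (contDiffWithinAt_comp_form (contDiffWithinAt_clm κ h.B) h.curv).add (c.smul h.zeta)

/-- The charge density is exact: `d (⟨F_A, B⟩ + ½ ζ ⟨B, B⟩) = ⟨(F_A + ζ B) ∧ d_A B⟩`, by the
Bianchi identity and the invariance of the inner product. -/
theorem extDerivWithin_boundaryForm (h : D.SmoothAt y) (hv : D.ValuedAt G y)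
    (hζ : extDerivWithin D.zeta halfSpace y = 0) (κ : InvInner G) :
    extDerivWithin (D.boundaryForm κ.form) halfSpace y = D.chargeForm κ.form y := by
  refine form_three_ext fun u v w => ?_
  have hζ' := extDerivWithin_two_apply h.mem h.zeta u v w
  rw [hζ] at hζ'
  change (0 : ℝ) = _ at hζ'
  have hF := extDerivWithin_two_apply h.mem h.curv u v w
  rw [extDerivWithin_curv h] at hF
  simp only [ContinuousAlternatingMap.neg_apply, wedge_two_apply, brL_apply] at hF
  have hF' := congrArg (κ.form (D.B y)) hF
  have hd : ∀ v w u, fderivWithin ℝ (fun z => D.boundaryForm κ.form z ![v, w]) halfSpace y u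
      = κ.form (fderivWithin ℝ D.B halfSpace y u) (D.curv y ![v, w])
        + κ.form (D.B y) (fderivWithin ℝ (fun z => D.curv z ![v, w]) halfSpace y u)
        + (κ.form (fderivWithin ℝ D.B halfSpace y u) (D.B y) * D.zeta y ![v, w]
          + 1 / 2 * κ.form (D.B y) (D.B y)
            * fderivWithin ℝ (fun z => D.zeta z ![v, w]) halfSpace y u) := by
    intro v w u
    have c1 := contDiffWithinAt_bilin κ.form h.B (contDiffWithinAt_form_apply h.curv ![v, w])
    have c2 := contDiffWithinAt_bilin κ.form h.B h.B
    have c3 := contDiffWithinAt_form_apply h.zeta ![v, w]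
    have e1 := fderivWithin_bilin κ.form h.mem (diff_of_smooth h.B)
      (diff_of_smooth (contDiffWithinAt_form_apply h.curv ![v, w])) u
    have e2 := fderivWithin_bilin κ.form h.mem (diff_of_smooth h.B) (diff_of_smooth h.B) u
    have e3 := fderivWithin_bilin (ContinuousLinearMap.mul ℝ ℝ) h.mem
      (diff_of_smooth (contDiffWithinAt_const (c := (1 / 2 : ℝ)))) (diff_of_smooth (c2.mul c3)) u
    have e4 := fderivWithin_bilin (ContinuousLinearMap.mul ℝ ℝ) h.mem (diff_of_smooth c2)
      (diff_of_smooth c3) u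
    have hsym := κ.symm _ (fderivWithin_mem h.mem (diff_of_smooth h.B) hv.B u) _ (hv.B_mem h.mem)
    have hf : (fun z => D.boundaryForm κ.form z ![v, w])
        = fun z => κ.form (D.B z) (D.curv z ![v, w])
          + (1 / 2 : ℝ) * (κ.form (D.B z) (D.B z) * D.zeta z ![v, w]) := by
      funext z
      simp only [LocalData.boundaryForm, ContinuousAlternatingMap.add_apply,
        ContinuousAlternatingMap.smul_apply, ContinuousLinearMap.compContinuousAlternatingMap_coe,
        Function.comp_apply, smul_eq_mul]
      ring
    rw [hf, fderivWithin_fun_add (uniqueDiffOn_halfSpace y h.mem) (diff_of_smooth c1)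
      (diff_of_smooth (contDiffWithinAt_const.mul (c2.mul c3))), add_apply, e1]
    simp only [ContinuousLinearMap.mul_apply'] at e3 e4
    rw [e3, e4, e2, hsym]
    simp
    ring
  have hinv : ∀ u v w, κ.form (D.A y u * D.B y - D.B y * D.A y u) (D.curv y ![v, w])
      + κ.form (D.B y) (D.A y u * D.curv y ![v, w] - D.curv y ![v, w] * D.A y u) = 0 :=
    fun u v w => κ.bracket (hv.A_mem h.mem u) (hv.B_mem h.mem) (hv.curv_mem h v w)
  have hBB : ∀ u, κ.form (D.A y u * D.B y - D.B y * D.A y u) (D.B y) = 0 := fun u => by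
    have h1 := κ.bracket (hv.A_mem h.mem u) (hv.B_mem h.mem) (hv.B_mem h.mem)
    have h2 := κ.symm _ (bracket_mem (hv.A_mem h.mem u) (hv.B_mem h.mem)) _ (hv.B_mem h.mem)
    linarith
  rw [extDerivWithin_two_apply h.mem (h.boundaryForm _), hd, hd, hd, LocalData.chargeForm,
    wedge_two_apply]
  simp only [toLin_apply, dB_apply h.mem, coneCurv_apply, map_add, add_apply, map_smul,
    smul_eq_mul, hBB]
  simp only [map_add, map_sub, map_neg] at hF' hinv
  have i1 := hinv u v w
  have i2 := hinv v u w
  have i3 := hinv w u v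
  simp only [map_sub, sub_apply] at i1 i2 i3 hF' ⊢
  linear_combination (-1/2 * κ.form (D.B y) (D.B y)) * hζ' - hF' - i1 + i2 - i3

/-- Under a gauge transformation `g`, with inverse `h`, the curvature and the covariant derivative
are conjugated. -/
theorem gauge (hD : D.SmoothAt y) (hD' : D'.SmoothAt y) {g h : E3 → Mat N}
    (hg : ContDiffWithinAt ℝ ∞ g halfSpace y) (hh : ContDiffWithinAt ℝ ∞ h halfSpace y)
    (hgh : ∀ᶠ z in nhdsWithin y halfSpace, g z * h z = 1)
    (hhg : ∀ᶠ z in nhdsWithin y halfSpace, h z * g z = 1)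
    (hA : ∀ᶠ z in nhdsWithin y halfSpace, ∀ v,
      D'.A z v = h z * D.A z v * g z + h z * fderivWithin ℝ g halfSpace z v)
    (hB : ∀ᶠ z in nhdsWithin y halfSpace, D'.B z = h z * D.B z * g z) :
    (∀ v w, D'.curv y ![v, w] = h y * D.curv y ![v, w] * g y) ∧
      ∀ v, D'.dB y ![v] = h y * D.dB y ![v] * g y := by
  have hy := hD.mem
  have gh : g y * h y = 1 := hgh.self_of_nhdsWithin hy
  have hg1 : h y * g y = 1 := hhg.self_of_nhdsWithin hy
  have cancel : ∀ X, g y * (h y * X) = X := fun X => by rw [← mul_assoc, gh, one_mul]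
  -- derivative of the inverse
  have dh : ∀ u, fderivWithin ℝ h halfSpace y u
      = -(h y * fderivWithin ℝ g halfSpace y u * h y) := by
    intro u
    have h1 := fderivWithin_mat_mul hy hh hg u
    have h2 : (fun z => h z * g z) =ᶠ[nhdsWithin y halfSpace] fun _ => 1 := hhg
    rw [h2.fderivWithin_eq hg1] at h1
    have h3 : fderivWithin ℝ h halfSpace y u * g y = -(h y * fderivWithin ℝ g halfSpace y u) :=
      eq_neg_of_add_eq_zero_left (h1.symm.trans (by simp))
    calc fderivWithin ℝ h halfSpace y u = fderivWithin ℝ h halfSpace y u * g y * h y := by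
          rw [mul_assoc, gh, mul_one]
      _ = _ := by rw [h3, neg_mul]
  have hdg := contDiffWithinAt_fderivWithin hy hg
  -- second derivatives of `g` are symmetric
  have hsymm : ∀ v w, fderivWithin ℝ (fderivWithin ℝ g halfSpace) halfSpace y v w
      = fderivWithin ℝ (fderivWithin ℝ g halfSpace) halfSpace y w v := fun v w =>
    (hg.isSymmSndFDerivWithinAt
      (by rw [minSmoothness_of_isRCLikeNormedField]; exact ENat.LEInfty.out)
      uniqueDiffOn_halfSpace (mem_closure_interior_halfSpace hy) hy).eq v w
  have dA : ∀ v w, fderivWithin ℝ D'.A halfSpace y v w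
      = fderivWithin ℝ h halfSpace y v * D.A y w * g y
        + h y * fderivWithin ℝ D.A halfSpace y v w * g y
        + h y * D.A y w * fderivWithin ℝ g halfSpace y v
        + (fderivWithin ℝ h halfSpace y v * fderivWithin ℝ g halfSpace y w
          + h y * fderivWithin ℝ (fderivWithin ℝ g halfSpace) halfSpace y v w) := by
    intro v w
    rw [← fderivWithin_apply_const hy (diff_of_smooth hD'.A)]
    have e0 : (fun z => D'.A z w) =ᶠ[nhdsWithin y halfSpace]
        fun z => h z * D.A z w * g z + h z * fderivWithin ℝ g halfSpace z w :=
      hA.mono fun z hz => hz w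
    have c1 : ContDiffWithinAt ℝ ∞ (fun z => h z * D.A z w) halfSpace y :=
      contDiffWithinAt_bilin (mulL N) hh (contDiffWithinAt_eval hD.A w)
    have c2 : ContDiffWithinAt ℝ ∞ (fun z => h z * D.A z w * g z) halfSpace y :=
      contDiffWithinAt_bilin (mulL N) c1 hg
    have c3 : ContDiffWithinAt ℝ ∞ (fun z => h z * fderivWithin ℝ g halfSpace z w) halfSpace y :=
      contDiffWithinAt_bilin (mulL N) hh (contDiffWithinAt_eval hdg w)
    rw [e0.fderivWithin_eq (e0.self_of_nhdsWithin hy),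
      fderivWithin_fun_add (uniqueDiffOn_halfSpace y hy) (diff_of_smooth c2) (diff_of_smooth c3),
      add_apply, fderivWithin_mat_mul hy c1 hg,
      fderivWithin_mat_mul hy hh (contDiffWithinAt_eval hD.A w),
      fderivWithin_mat_mul hy hh (contDiffWithinAt_eval hdg w),
      fderivWithin_apply_const hy (diff_of_smooth hD.A),
      fderivWithin_apply_const hy (diff_of_smooth hdg), add_mul]
  have hAy : ∀ v, D'.A y v = h y * D.A y v * g y + h y * fderivWithin ℝ g halfSpace y v :=
    hA.self_of_nhdsWithin hy
  have hBy : D'.B y = h y * D.B y * g y := hB.self_of_nhdsWithin hy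
  refine ⟨fun v w => ?_, fun v => ?_⟩
  · rw [curv_apply hD, curv_apply hD', dA, dA, dh, dh, hAy, hAy, hsymm w v]
    simp only [mul_add, add_mul, mul_sub, sub_mul, neg_mul, mul_assoc, cancel]
    abel
  · have e0 : D'.B =ᶠ[nhdsWithin y halfSpace] fun z => h z * D.B z * g z := hB
    have c1 : ContDiffWithinAt ℝ ∞ (fun z => h z * D.B z) halfSpace y :=
      contDiffWithinAt_bilin (mulL N) hh hD.B
    rw [dB_apply hy, dB_apply hy, hAy, hBy, e0.fderivWithin_eq hBy, fderivWithin_mat_mul hy c1 hg,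
      fderivWithin_mat_mul hy hh hD.B, dh]
    simp only [mul_add, add_mul, mul_sub, sub_mul, neg_mul, mul_assoc, cancel]
    abel

/-- The exterior derivative commutes with a change of coordinates which is defined only near `y`. -/
theorem extDerivWithin_pullback_of_eventually {V : Type*} [NormedAddCommGroup V] [NormedSpace ℝ V]
    {k : ℕ} {τ η : E3 → Form k V} {φ : E3 → E3} (hy : y ∈ halfSpace)
    (hτ : ContDiffWithinAt ℝ ∞ τ halfSpace (φ y)) (hφ : ContDiffWithinAt ℝ ∞ φ halfSpace y)
    (hst : ∀ᶠ z in nhdsWithin y halfSpace, φ z ∈ halfSpace)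
    (hη : ∀ᶠ z in nhdsWithin y halfSpace,
      η z = (τ (φ z)).compContinuousLinearMap (fderivWithin ℝ φ halfSpace z)) :
    extDerivWithin η halfSpace y
      = (extDerivWithin τ halfSpace (φ y)).compContinuousLinearMap
        (fderivWithin ℝ φ halfSpace y) := by
  classical
  -- where `φ` leaves the half-space, it is changed so as to map the half-space to itself
  set ψ : E3 → E3 := fun z => if φ z ∈ halfSpace then φ z else y with hψ
  have e : ψ =ᶠ[nhdsWithin y halfSpace] φ := hst.mono fun z hz => if_pos hz
  have ey : ψ y = φ y := e.self_of_nhdsWithin hy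
  have e' := e.fderivWithin (𝕜 := ℝ)
  have maps : MapsTo ψ halfSpace halfSpace := fun z _ => by
    by_cases h : φ z ∈ halfSpace
    · simp only [hψ, if_pos h, h]
    · simp only [hψ, if_neg h, hy]
  have h1 := extDerivWithin_pullback (r := ∞) (t := halfSpace) (x := y)
    (show DifferentiableWithinAt ℝ τ halfSpace (ψ y) by rw [ey]; exact diff_of_smooth hτ)
    (hφ.congr_of_eventuallyEq e ey)
    (by rw [minSmoothness_of_isRCLikeNormedField]; exact ENat.LEInfty.out)
    uniqueDiffOn_halfSpace (mem_closure_interior_halfSpace hy) hy maps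
  rw [ey, e'.self_of_nhdsWithin hy] at h1
  rw [← h1]
  refine Filter.EventuallyEq.extDerivWithin_eq_of_mem ?_ hy
  filter_upwards [hη, e, e'] with z h2 h3 h4
  rw [h2, h3, h4]

/-- Naturality of the curvature and of `d_A B` under a change of coordinates `φ`. -/
theorem pullback {φ : E3 → E3} (hD' : D'.SmoothAt (φ y)) (hy : y ∈ halfSpace)
    (hφ : ContDiffWithinAt ℝ ∞ φ halfSpace y)
    (hst : ∀ᶠ z in nhdsWithin y halfSpace, φ z ∈ halfSpace)
    (hA : ∀ᶠ z in nhdsWithin y halfSpace,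
      D.A z = (D'.A (φ z)).comp (fderivWithin ℝ φ halfSpace z))
    (hB : ∀ᶠ z in nhdsWithin y halfSpace, D.B z = D'.B (φ z)) :
    D.curv y = (D'.curv (φ y)).compContinuousLinearMap (fderivWithin ℝ φ halfSpace y) ∧
      D.dB y = (D'.dB (φ y)).compContinuousLinearMap (fderivWithin ℝ φ halfSpace y) := by
  have hA1 : ∀ᶠ z in nhdsWithin y halfSpace, oneForm (D.A z)
      = (oneForm (D'.A (φ z))).compContinuousLinearMap (fderivWithin ℝ φ halfSpace z) :=
    hA.mono fun z hz => by rw [hz]; rfl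
  have hB1 : ∀ᶠ z in nhdsWithin y halfSpace, zeroForm (D.B z)
      = (zeroForm (D'.B (φ z))).compContinuousLinearMap (fderivWithin ℝ φ halfSpace z) :=
    hB.mono fun z hz => by rw [hz]; rfl
  refine ⟨?_, ?_⟩
  · rw [LocalData.curv, LocalData.curv, hA1.self_of_nhdsWithin hy, hA.self_of_nhdsWithin hy,
      wedge_pullback, extDerivWithin_pullback_of_eventually
        (τ := fun z => oneForm (D'.A z)) hy (contDiffWithinAt_oneForm hD'.A) hφ hst hA1]
    rfl
  · rw [LocalData.dB, LocalData.dB, covD, covD, hB1.self_of_nhdsWithin hy,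
      hA.self_of_nhdsWithin hy, wedge_pullback, extDerivWithin_pullback_of_eventually
        (τ := fun z => zeroForm (D'.B z)) hy (contDiffWithinAt_zeroForm hD'.B) hφ hst hB1]
    rfl

end LocalData

/-! ### The duality condition at a point -/

theorem pairing_comm {N : ℕ} {G : Subgroup (SO N)} (κ : InvInner G)
    {S : Matrix (Fin 3) (Fin 3) ℝ} (hS : S.PosDef) {α β : Form 1 (Mat N)}
    (hα : ∀ v, α ![v] ∈ lieSub G) (hβ : ∀ v, β ![v] ∈ lieSub G) :
    pairing S κ.form α β = pairing S κ.form β α := by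
  rw [pairing, pairing, Finset.sum_comm]
  refine Finset.sum_congr rfl fun a _ => Finset.sum_congr rfl fun b _ => ?_
  rw [inv_symm_apply hS, κ.symm _ (hα _) _ (hβ _)]

namespace LocalData

variable {N : ℕ} {D D' : LocalData N} {y : E3} {G : Subgroup (SO N)}

theorem star₂_coneCurv_of_duality {ε : ℝ} (hS : (D.gram y).PosDef) (hd : D.Duality ε y) :
    star₂ (D.gram y) (D.coneCurv y) = ε • D.dB y := by
  rw [hd, star₂_smul, star₂_star₁ hS]

theorem star₁_dB_of_duality {ε : ℝ} (hε : ε * ε = 1) (hd : D.Duality ε y) :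
    star₁ (D.gram y) (D.dB y) = ε • D.coneCurv y := by
  rw [hd, smul_smul, hε, one_smul]

theorem covD_congr {k : ℕ} {η τ : E3 → Form k (Mat N)} (hy : y ∈ halfSpace)
    (h : η =ᶠ[nhdsWithin y halfSpace] τ) : D.covD η y = D.covD τ y := by
  rw [covD, covD, h.extDerivWithin_eq_of_mem hy, h.self_of_nhdsWithin hy]

theorem covD_smul {k : ℕ} (r : ℝ) (η : E3 → Form k (Mat N)) (hy : y ∈ halfSpace) :
    D.covD (fun z => r • η z) y = r • D.covD η y := by
  rw [covD, covD, extDerivWithin_fun_smul r η (uniqueDiffOn_halfSpace y hy), smul_add]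
  congr 1
  ext1 v
  simp only [wedge_apply, ContinuousAlternatingMap.smul_apply, map_smul, Finset.smul_sum]
  exact Finset.sum_congr rfl fun i _ => smul_comm _ _ _

/-- The duality condition near `y` implies the first cone Yang-Mills equation at `y`. The condition
is needed near `y` since the equation contains a derivative of it. -/
theorem coneYM₁_of_duality {ε : ℝ} (hε : ε * ε = 1) (h : D.SmoothAt y)
    (hS : ∀ᶠ z in nhdsWithin y halfSpace, (D.gram z).PosDef)
    (hd : ∀ᶠ z in nhdsWithin y halfSpace, D.Duality ε z) : D.ConeYM₁ y := by
  have h1 : (fun z => star₂ (D.gram z) (D.coneCurv z)) =ᶠ[nhdsWithin y halfSpace]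
      fun z => ε • D.dB z := by
    filter_upwards [hS, hd] with z hz1 hz2 using star₂_coneCurv_of_duality hz1 hz2
  -- `ζ B` commutes with `B`
  have h2 : (brL N (D.B y)).compContinuousAlternatingMap (D.curv y)
      = (brL N (D.B y)).compContinuousAlternatingMap (D.coneCurv y) := by
    refine form_two_ext fun v w => ?_
    simp only [ContinuousLinearMap.compContinuousAlternatingMap_coe, Function.comp_apply,
      coneCurv_apply, brL_apply, mul_add, add_mul, mul_smul_comm, smul_mul_assoc]
    abel
  have hn : ∀ α : Form 2 (Mat N), star₂ (D.gram y) (-α) = -star₂ (D.gram y) α := fun α => by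
    rw [← neg_one_smul ℝ α, star₂_smul, neg_one_smul]
  rw [ConeYM₁, codiff₂, covD_congr h.mem h1, covD_smul ε D.dB h.mem, covD_dB h, h2, star₂_smul, hn,
    star₂_comp, star₂_coneCurv_of_duality (hS.self_of_nhdsWithin h.mem)
      (hd.self_of_nhdsWithin h.mem)]
  refine form_one_ext fun v => ?_
  simp only [ContinuousAlternatingMap.add_apply, ContinuousAlternatingMap.smul_apply,
    ContinuousAlternatingMap.neg_apply, ContinuousLinearMap.compContinuousAlternatingMap_coe,
    Function.comp_apply, map_smul, smul_neg, smul_smul]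
  norm_num [hε]

/-- The duality condition near `y` implies the second cone Yang-Mills equation at `y`. -/
theorem coneYM₂_of_duality {ε : ℝ} (hε : ε * ε = 1) (h : D.SmoothAt y)
    (hζ : extDerivWithin D.zeta halfSpace y = 0)
    (hS : (D.gram y).PosDef) (hd : ∀ᶠ z in nhdsWithin y halfSpace, D.Duality ε z) :
    D.ConeYM₂ y := by
  have h1 : (fun z => star₁ (D.gram z) (D.dB z)) =ᶠ[nhdsWithin y halfSpace]
      fun z => ε • D.coneCurv z := hd.mono fun z hz => star₁_dB_of_duality hε hz
  have h2 : toLin (ε • D.dB y) = ε • toLin (D.dB y) := by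
    ext1 v; rw [toLin_apply]; simp [toLin_apply]
  have h3 : wedge (ContinuousLinearMap.lsmul ℝ ℝ (E := Mat N)).flip (ε • toLin (D.dB y)) (D.zeta y)
      = ε • wedge (ContinuousLinearMap.lsmul ℝ ℝ (E := Mat N)).flip (toLin (D.dB y))
        (D.zeta y) := by
    refine form_three_ext fun u v w => ?_
    simp only [wedge_two_apply, ContinuousAlternatingMap.smul_apply, smul_apply, map_smul]
    module
  rw [ConeYM₂, zetaStar, codiff₁, covD_congr h.mem h1, covD_smul ε D.coneCurv h.mem,
    covD_coneCurv h hζ, star₂_coneCurv_of_duality hS (hd.self_of_nhdsWithin h.mem), h2, h3,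
    star₃_smul]
  module

theorem chargeForm_eq (hS : (D.gram y).PosDef) (κ : Mat N →L[ℝ] Mat N →L[ℝ] ℝ) :
    D.chargeForm κ y ![e 0, e 1, e 2] = √(D.gram y).det
      * pairing (D.gram y) κ (D.dB y) (star₂ (D.gram y) (D.coneCurv y)) := by
  rw [LocalData.chargeForm, ← wedge_star₁, star₁_star₂ hS]

theorem energyForm_eq (hS : (D.gram y).PosDef) (κ : Mat N →L[ℝ] Mat N →L[ℝ] ℝ) :
    D.energyForm κ y ![e 0, e 1, e 2] = √(D.gram y).det
      * (pairing (D.gram y) κ (star₂ (D.gram y) (D.coneCurv y)) (star₂ (D.gram y) (D.coneCurv y))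
        + pairing (D.gram y) κ (D.dB y) (D.dB y)) := by
  rw [LocalData.energyForm, ContinuousAlternatingMap.add_apply, mul_add, ← wedge_star₁,
    ← wedge_star₁, star₁_star₂ hS]

/-- Completing the square: the energy density is at least `2 ε` times the charge density, since the
difference is the square of the norm of `*(F_A + ζ B) - ε d_A B`. -/
theorem energy_sub_charge (hS : (D.gram y).PosDef) (h : D.SmoothAt y) (hv : D.ValuedAt G y)
    (κ : InvInner G) {ε : ℝ} (hε : ε * ε = 1) :
    ε * (2 * D.chargeForm κ.form y ![e 0, e 1, e 2]) ≤ D.energyForm κ.form y ![e 0, e 1, e 2] ∧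
      (D.energyForm κ.form y ![e 0, e 1, e 2]
        = ε * (2 * D.chargeForm κ.form y ![e 0, e 1, e 2]) ↔ D.Duality ε y) := by
  set S := D.gram y with hSdef
  set φ := star₂ S (D.coneCurv y) with hφ
  have hψm := hv.dB_mem h
  have hφm : ∀ v, φ ![v] ∈ lieSub G := fun v => by
    rw [hφ, star₂_apply]
    exact (lieSub G).smul_mem _ ((lieSub G).sum_mem fun a _ => (lieSub G).sum_mem fun b _ =>
      (lieSub G).smul_mem _ (hv.coneCurv_mem h _ _))
  have hsq : pairing S κ.form (φ - ε • D.dB y) (φ - ε • D.dB y)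
      = pairing S κ.form φ φ + pairing S κ.form (D.dB y) (D.dB y)
        - ε * (2 * pairing S κ.form (D.dB y) φ) := by
    have hc := pairing_comm κ hS hφm hψm
    have h1 : pairing S κ.form (φ - ε • D.dB y) (φ - ε • D.dB y)
        = pairing S κ.form φ φ + (ε * ε) * pairing S κ.form (D.dB y) (D.dB y)
          - ε * (pairing S κ.form φ (D.dB y) + pairing S κ.form (D.dB y) φ) := by
      simp only [pairing, ContinuousAlternatingMap.sub_apply, ContinuousAlternatingMap.smul_apply,
        map_sub, map_smul, sub_apply, smul_apply, smul_eq_mul, Fin.sum_univ_three]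
      ring
    rw [h1, hε, hc]
    ring
  have hsm : ∀ v, (φ - ε • D.dB y) ![v] ∈ lieSub G := fun v =>
    (lieSub G).sub_mem (hφm v) ((lieSub G).smul_mem _ (hψm v))
  obtain ⟨hp, hz⟩ := pairing_self hS κ.pos hsm
  have hdet : 0 < √S.det := Real.sqrt_pos.2 hS.det_pos
  have hE : D.energyForm κ.form y ![e 0, e 1, e 2]
      - ε * (2 * D.chargeForm κ.form y ![e 0, e 1, e 2])
      = √S.det * pairing S κ.form (φ - ε • D.dB y) (φ - ε • D.dB y) := by
    rw [energyForm_eq hS, chargeForm_eq hS, hsq]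
    ring
  refine ⟨?_, fun heq => ?_, fun hd => ?_⟩
  · have := mul_nonneg hdet.le hp
    linarith
  · rw [heq, sub_self] at hE
    have h0 := hz ((mul_eq_zero.1 hE.symm).resolve_left hdet.ne')
    have h1 : φ = ε • D.dB y := sub_eq_zero.1 h0
    have h2 : star₁ S φ = ε • star₁ S (D.dB y) := by
      rw [h1]
      refine form_two_ext fun v w => ?_
      simp only [star₁_apply, ContinuousAlternatingMap.smul_apply, Finset.smul_sum]
      exact Finset.sum_congr rfl fun i _ => smul_comm _ _ _
    rw [hφ, star₁_star₂ hS] at h2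
    exact h2
  · have h1 : φ - ε • D.dB y = 0 := sub_eq_zero.2 (star₂_coneCurv_of_duality hS hd)
    rw [h1] at hE
    have h2 : pairing S κ.form 0 0 = 0 := by simp [pairing]
    rw [h2, mul_zero] at hE
    linarith

end LocalData

/-! ### Charts -/

section Charts

variable {M : Type*} [TopologicalSpace M]
  {c c' : OpenPartialHomeomorph M (EuclideanHalfSpace 3)} {y : E3}

theorem target_subset : (c.extend I3).target ⊆ halfSpace := c.extend_target_subset_range

theorem pt_mem_source (hy : y ∈ (c.extend I3).target) : pt c y ∈ c.source := by
  have := (c.extend I3).map_target hy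
  rwa [c.extend_source] at this

theorem extend_pt (hy : y ∈ (c.extend I3).target) : c.extend I3 (pt c y) = y :=
  (c.extend I3).right_inv hy

theorem pt_extend {x : M} (hx : x ∈ c.source) : pt c (c.extend I3 x) = x := c.extend_left_inv hx

theorem extend_mem_target {x : M} (hx : x ∈ c.source) : c.extend I3 x ∈ (c.extend I3).target :=
  (c.extend I3).map_source (by rwa [c.extend_source])

theorem target_mem_nhdsWithin (hy : y ∈ (c.extend I3).target) :
    (c.extend I3).target ∈ nhdsWithin y halfSpace := by
  have := c.extend_target_mem_nhdsWithin (I := I3) (pt_mem_source hy)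
  rwa [extend_pt hy] at this

theorem continuousWithinAt_pt (hy : y ∈ (c.extend I3).target) :
    ContinuousWithinAt (pt c) halfSpace y :=
  (c.continuousAt_extend_symm' hy).continuousWithinAt

/-- Within the half-space, a neighbourhood of a point of the chart domain consists of points of the
chart domain, mapped to any given open set around its image. -/
theorem eventually_pt_mem {U : Set M} (hU : IsOpen U) (hy : y ∈ (c.extend I3).target)
    (hx : pt c y ∈ U) : ∀ᶠ z in nhdsWithin y halfSpace, z ∈ (c.extend I3).target ∧ pt c z ∈ U :=
  Filter.Eventually.and (target_mem_nhdsWithin hy)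
    ((continuousWithinAt_pt hy).eventually (hU.mem_nhds hx))

theorem measurableSet_target : MeasurableSet (c.extend I3).target := by
  rw [c.extend_target]
  exact (c.open_target.preimage I3.continuous_symm).measurableSet.inter
    I3.isClosed_range.measurableSet

/-- Boundary points of a chart domain are limits of interior ones, so that continuous functions on
it are determined almost everywhere. -/
theorem target_subset_closure_interior :
    (c.extend I3).target ⊆ closure (interior (c.extend I3).target) := by
  intro y hy
  have h1 := mem_closure_interior_halfSpace (target_subset hy)
  obtain ⟨U, hU, hyU, hsub⟩ := mem_nhdsWithin.1 (target_mem_nhdsWithin hy)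
  have h2 : U ∩ interior halfSpace ⊆ interior (c.extend I3).target :=
    interior_maximal (fun z hz => hsub ⟨hz.1, interior_subset hz.2⟩) (hU.inter isOpen_interior)
  exact closure_mono h2 (hU.inter_closure ⟨hyU, h1⟩)

/-- The coordinate change from the chart `c` to the chart `c'`. -/
def trans (c c' : OpenPartialHomeomorph M (EuclideanHalfSpace 3)) (y : E3) : E3 :=
  c'.extend I3 (pt c y)

theorem pt_trans (h' : pt c y ∈ c'.source) : pt c' (trans c c' y) = pt c y :=
  pt_extend h'

variable [ChartedSpace (EuclideanHalfSpace 3) M] (hc : c ∈ smoothCharts M)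
  (hc' : c' ∈ smoothCharts M)

include hc hc' in
theorem contDiffWithinAt_trans (hy : y ∈ (c.extend I3).target) (h' : pt c y ∈ c'.source) :
    ContDiffWithinAt ℝ ∞ (trans c c') halfSpace y := by
  refine I3.contDiffWithinAt_extendCoordChange hc hc' ?_
  rw [PartialEquiv.trans_source]
  exact ⟨hy, by rwa [c'.extend_source]⟩

include hc in
theorem mdifferentiableWithinAt_pt (hy : y ∈ (c.extend I3).target) :
    MDifferentiableWithinAt 𝓘(ℝ, E3) I3 (pt c) halfSpace y := by
  have h := (contMDiffOn_extend_symm hc).mdifferentiableOn (by simp) y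
    (by rwa [← c.extend_target'])
  refine h.mono_of_mem_nhdsWithin ?_
  rw [← c.extend_target']
  exact target_mem_nhdsWithin hy

theorem uniqueMDiffWithinAt_halfSpace (hy : y ∈ halfSpace) :
    UniqueMDiffWithinAt 𝓘(ℝ, E3) halfSpace y :=
  (uniqueDiffOn_halfSpace y hy).uniqueMDiffWithinAt

include hc hc' in
/-- The chain rule for the inverse charts. The tangent spaces of `M` at the equal points `pt c y`
and `pt c' (trans c c' y)` are both identified with `E3`. -/
theorem dpt_trans (hy : y ∈ (c.extend I3).target) (h' : pt c y ∈ c'.source) :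
    (dpt c y : E3 →L[ℝ] E3)
      = (dpt c' (trans c c' y) : E3 →L[ℝ] E3).comp (fderivWithin ℝ (trans c c') halfSpace y) := by
  have hy' : trans c c' y ∈ (c'.extend I3).target := extend_mem_target h'
  have h1 := mfderivWithin_comp_of_preimage_mem_nhdsWithin y (I := 𝓘(ℝ, E3)) (I' := 𝓘(ℝ, E3))
    (I'' := I3) (g := pt c') (f := trans c c') (s := halfSpace) (u := halfSpace)
    (mdifferentiableWithinAt_pt hc' hy')
    (diff_of_smooth (contDiffWithinAt_trans hc hc' hy h')).mdifferentiableWithinAt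
    (by filter_upwards [eventually_pt_mem c'.open_source hy h'] with z hz
        exact target_subset (extend_mem_target hz.2))
    (uniqueMDiffWithinAt_halfSpace (target_subset hy))
  have h2 : pt c =ᶠ[nhdsWithin y halfSpace] pt c' ∘ trans c c' := by
    filter_upwards [eventually_pt_mem c'.open_source hy h'] with z hz
    exact (pt_trans hz.2).symm
  have h3 := h2.mfderivWithin_eq_of_mem (I := 𝓘(ℝ, E3)) (I' := I3) (target_subset hy)
  rw [mfderivWithin_eq_fderivWithin] at h1
  exact h3.trans h1

include hc in
/-- The differential of an inverse chart has the differential of the chart as a left inverse. -/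
theorem dpt_injective (hy : y ∈ (c.extend I3).target) :
    Function.Injective (dpt c y : E3 →L[ℝ] E3) := by
  have hx := pt_mem_source hy
  have h0 : MDifferentiableAt I3 𝓘(ℝ, E3) (c.extend I3) (pt c y) :=
    (c.contMDiffAt_extend hc hx).mdifferentiableAt (by simp)
  have h1 := mfderiv_comp_mfderivWithin y h0 (mdifferentiableWithinAt_pt hc hy)
    (uniqueMDiffWithinAt_halfSpace (target_subset hy))
  have h2 : c.extend I3 ∘ pt c =ᶠ[nhdsWithin y halfSpace] id := by
    filter_upwards [target_mem_nhdsWithin hy] with z hz using extend_pt hz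
  rw [h2.mfderivWithin_eq_of_mem (target_subset hy), mfderivWithin_eq_fderivWithin,
    fderivWithin_id (uniqueDiffOn_halfSpace y (target_subset hy))] at h1
  intro v w hvw
  have h3 := fun u => DFunLike.congr_fun h1 u
  exact (h3 v).trans
    ((congrArg (mfderiv I3 𝓘(ℝ, E3) (c.extend I3) (pt c y)) hvw).trans (h3 w).symm)

include hc in
/-- The derivative of a matrix-valued function on `M` in a chart. -/
theorem fderivWithin_comp_pt {N : ℕ} {f : M → Mat N} (hy : y ∈ (c.extend I3).target)
    (hf : MDifferentiableAt I3 𝓘(ℝ, Mat N) f (pt c y)) (v : E3) :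
    fderivWithin ℝ (fun z => f (pt c z)) halfSpace y v = dMat f (pt c y) (dpt c y v) := by
  have h1 := mfderiv_comp_mfderivWithin y hf (mdifferentiableWithinAt_pt hc hy)
    (uniqueMDiffWithinAt_halfSpace (target_subset hy))
  rw [mfderivWithin_eq_fderivWithin] at h1
  exact DFunLike.congr_fun h1 v

include hc in
theorem contDiffWithinAt_comp_pt {F : Type*} [NormedAddCommGroup F] [NormedSpace ℝ F] {f : M → F}
    (hy : y ∈ (c.extend I3).target) (hf : ContMDiffAt I3 𝓘(ℝ, F) ∞ f (pt c y)) :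
    ContDiffWithinAt ℝ ∞ (fun z => f (pt c z)) halfSpace y := by
  have h := (contMDiffOn_extend_symm hc) y (by rwa [← c.extend_target'])
  have h1 : ContMDiffWithinAt 𝓘(ℝ, E3) I3 ∞ (pt c) halfSpace y := by
    refine h.mono_of_mem_nhdsWithin ?_
    rw [← c.extend_target']
    exact target_mem_nhdsWithin hy
  exact (hf.comp_contMDiffWithinAt y h1).contDiffWithinAt

end Charts

/-! ### Coordinate expressions of the global fields -/

section LocalFields

variable {M : Type*} [TopologicalSpace M] [ChartedSpace (EuclideanHalfSpace 3) M]
  [IsManifold I3 ∞ M] {N : ℕ} {G : Subgroup (SO N)} {ι : Type*} {P : PrincipalBundle M G ι}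
  (met : Metric M) (ζ : ClosedTwoForm M) (A : Connection P) (B : AdSection P)
  {c c' : OpenPartialHomeomorph M (EuclideanHalfSpace 3)} {y : E3} {i j : ι}

theorem smoothAt_localData (hc : c ∈ smoothCharts M) (hy : y ∈ (c.extend I3).target)
    (hi : pt c y ∈ P.U i) : (localData met ζ A B c i).SmoothAt y where
  mem := target_subset hy
  A := ((A.smooth i c hc) y ⟨hy, hi⟩).mono_of_mem_nhdsWithin
    (eventually_pt_mem (P.isOpen i) hy hi)
  B := contDiffWithinAt_comp_pt hc hy ((B.smooth i).contMDiffAt ((P.isOpen i).mem_nhds hi))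
  zeta := ((ζ.smooth c hc) y hy).mono_of_mem_nhdsWithin (target_mem_nhdsWithin hy)

theorem valuedAt_localData (hy : y ∈ (c.extend I3).target)
    (hi : pt c y ∈ P.U i) : (localData met ζ A B c i).ValuedAt G y where
  A := (eventually_pt_mem (P.isOpen i) hy hi).mono fun _ hz _ => A.mem i _ hz.2 _
  B := (eventually_pt_mem (P.isOpen i) hy hi).mono fun _ hz => B.mem i _ hz.2

theorem closed_localData (hc : c ∈ smoothCharts M) (hy : y ∈ (c.extend I3).target) :
    extDerivWithin (localData met ζ A B c i).zeta halfSpace y = 0 := ζ.closed c hc y hy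

theorem inner_sum_sum (x : M) (f g : Fin 3 → TangentSpace I3 x) (r s : Fin 3 → ℝ) :
    met.inner x (∑ a, r a • f a) (∑ b, s b • g b)
      = ∑ a, ∑ b, r a * s b * met.inner x (f a) (g b) := by
  simp only [map_sum, map_smul, sum_apply, smul_apply,
    smul_eq_mul, Finset.mul_sum]
  rw [Finset.sum_comm]
  exact Finset.sum_congr rfl fun a _ => Finset.sum_congr rfl fun b _ => by ring

theorem gram_apply (a b : Fin 3) : (localData met ζ A B c i).gram y a b
    = met.inner (pt c y) (dpt c y (e a)) (dpt c y (e b)) := rfl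

/-- The Gram matrix is positive definite, because the coordinate vectors are linearly
independent. -/
theorem posDef_gram (hc : c ∈ smoothCharts M) (hy : y ∈ (c.extend I3).target) :
    ((localData met ζ A B c i).gram y).PosDef := by
  refine Matrix.PosDef.of_dotProduct_mulVec_pos ?_ fun x hx => ?_
  · ext a b
    simp only [Matrix.conjTranspose_apply, gram_apply, star_trivial]
    exact met.symm _ _ _
  · have hv : ∑ a, x a • e a ≠ 0 := fun h => hx (by
      funext a
      have := congrArg (fun v : E3 => v a) h
      fin_cases a <;> simpa [Fin.sum_univ_three, e_apply] using this)
    have hd : dpt c y (∑ a, x a • e a) ≠ 0 := fun h =>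
      hv (dpt_injective hc hy (h.trans (map_zero (dpt c y)).symm))
    have h1 := met.pos (pt c y) _ hd
    rw [map_sum] at h1
    simp only [map_smul] at h1
    rw [inner_sum_sum met (pt c y)] at h1
    refine h1.trans_eq ?_
    simp only [dotProduct, Matrix.mulVec, star_trivial, Finset.mul_sum, gram_apply]
    exact Finset.sum_congr rfl fun a _ => Finset.sum_congr rfl fun b _ => by ring

/-- The Gram matrices of the metric in two charts are related by the Jacobian matrix. -/
theorem gram_trans (hc : c ∈ smoothCharts M) (hc' : c' ∈ smoothCharts M)
    (hy : y ∈ (c.extend I3).target) (h' : pt c y ∈ c'.source) :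
    (localData met ζ A B c i).gram y
      = (mat (fderivWithin ℝ (trans c c') halfSpace y)).transpose
        * (localData met ζ A B c' i).gram (trans c c' y)
        * mat (fderivWithin ℝ (trans c c') halfSpace y) := by
  ext a b
  have h1 : ∀ v w : E3, met.inner (pt c y) v w = met.inner (pt c' (trans c c' y)) v w := by
    intro v w
    have hx : ∀ {x x' : M}, x = x' → ∀ v w : E3, met.inner x v w = met.inner x' v w := by
      intro x x' h v w; subst h; rfl
    exact hx (pt_trans h').symm v w
  have h2 : ∀ a, dpt c y (e a) = ∑ k, mat (fderivWithin ℝ (trans c c') halfSpace y) k a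
      • (dpt c' (trans c c' y) (e k) : E3) := by
    intro a
    rw [dpt_trans hc hc' hy h']
    refine (congrArg (dpt c' (trans c c' y)) (map_e _ a)).trans ?_
    rw [map_sum]
    simp only [map_smul]
  rw [gram_apply]
  refine (h1 _ _).trans ?_
  rw [h2, h2]
  refine (inner_sum_sum met _ _ _ _ _).trans ?_
  simp only [Matrix.mul_apply, Matrix.transpose_apply, gram_apply, Fin.sum_univ_three]
  ring

/-- The coordinate vector fields are continuous sections of the tangent bundle: they are images of
constant sections under the tangent map of the inverse chart. -/
theorem contMDiffWithinAt_dpt (hc : c ∈ smoothCharts M) (hy : y ∈ (c.extend I3).target) (v : E3) :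
    ContMDiffWithinAt 𝓘(ℝ, E3) I3.tangent 0
      (fun z => (⟨pt c z, dpt c z v⟩ : TangentBundle I3 M)) halfSpace y := by
  have hs : ContMDiffOn 𝓘(ℝ, E3) I3 1 (pt c) (c.extend I3).target := by
    have h := (contMDiffOn_extend_symm hc).of_le (m := 1) (by exact_mod_cast le_top)
    rwa [← c.extend_target'] at h
  have hu : UniqueDiffOn ℝ (c.extend I3).target := by
    intro z hz
    exact ((uniqueDiffOn_halfSpace z (target_subset hz)).inter' (target_mem_nhdsWithin hz)).mono
      inter_subset_right
  have : IsManifold I3 1 M := IsManifold.of_le (n := ∞) (by exact_mod_cast le_top)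
  have h1 := hs.contMDiffOn_tangentMapWithin (m := 0) (by simp) hu.uniqueMDiffOn
  have h2 : ContMDiff 𝓘(ℝ, E3) 𝓘(ℝ, E3).tangent 0
      (fun z => (⟨z, v⟩ : TangentBundle 𝓘(ℝ, E3) E3)) :=
    contMDiff_vectorSpace_iff_contDiff.2 contDiff_const
  have h3 : ContMDiffWithinAt 𝓘(ℝ, E3) I3.tangent 0
      (fun z => tangentMapWithin 𝓘(ℝ, E3) I3 (pt c) (c.extend I3).target
        (⟨z, v⟩ : TangentBundle 𝓘(ℝ, E3) E3)) (c.extend I3).target y :=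
    (h1 ⟨y, v⟩ hy).comp y h2.contMDiffAt.contMDiffWithinAt (fun z hz => hz)
  have h4 := h3.mono_of_mem_nhdsWithin (target_mem_nhdsWithin hy)
  have h5 : ∀ z ∈ (c.extend I3).target, (⟨pt c z, dpt c z v⟩ : TangentBundle I3 M)
      = tangentMapWithin 𝓘(ℝ, E3) I3 (pt c) (c.extend I3).target
        (⟨z, v⟩ : TangentBundle 𝓘(ℝ, E3) E3) := by
    intro z hz
    have h6 := MDifferentiableWithinAt.mfderivWithin_mono_of_mem_nhdsWithin
      ((mdifferentiableWithinAt_pt hc hz).mono target_subset)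
      (uniqueMDiffWithinAt_halfSpace (target_subset hz)) (target_mem_nhdsWithin hz)
    exact congrArg (fun L : E3 →L[ℝ] TangentSpace I3 (pt c z) =>
      (⟨pt c z, L v⟩ : TangentBundle I3 M)) h6
  exact h4.congr_of_eventuallyEq (Filter.mem_of_superset (target_mem_nhdsWithin hy) h5) (h5 y hy)

theorem continuousWithinAt_gram (hc : c ∈ smoothCharts M) (hy : y ∈ (c.extend I3).target) :
    ContinuousWithinAt (localData met ζ A B c i).gram halfSpace y := by
  refine continuousWithinAt_pi.2 fun a => continuousWithinAt_pi.2 fun b => ?_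
  have hb : ContMDiffWithinAt 𝓘(ℝ, E3) I3 0 (pt c) halfSpace y := by
    have h := ((contMDiffOn_extend_symm hc).of_le (m := 0) (by simp)) y
      (by rwa [← c.extend_target'])
    refine h.mono_of_mem_nhdsWithin ?_
    rw [← c.extend_target']
    exact target_mem_nhdsWithin hy
  have h1 : ContMDiffWithinAt 𝓘(ℝ, E3) (I3.prod 𝓘(ℝ)) 0
      (fun m => Bundle.TotalSpace.mk' ℝ (E := Bundle.Trivial M ℝ) (pt c m)
        (met.inner (pt c m) (dpt c m (e a)) (dpt c m (e b)))) halfSpace y := by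
    apply ContMDiffWithinAt.clm_bundle_apply₂ (F₁ := E3) (F₂ := E3)
    · exact ContMDiffAt.comp_contMDiffWithinAt y
        (met.contMDiff.contMDiffAt.of_le (by simp)) hb
    · exact contMDiffWithinAt_dpt hc hy _
    · exact contMDiffWithinAt_dpt hc hy _
  simp only [Bundle.contMDiffWithinAt_totalSpace] at h1
  exact h1.2.continuousWithinAt

end LocalFields

/-! ### Gauge invariance and naturality of the densities -/

namespace LocalData

variable {N : ℕ} {D D' : LocalData N} {y : E3} {G : Subgroup (SO N)}

theorem star₂_mem {V : Type*} [NormedAddCommGroup V] [NormedSpace ℝ V] {L : Submodule ℝ V}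
    (S : Matrix (Fin 3) (Fin 3) ℝ) {β : Form 2 V} (h : ∀ v w, β ![v, w] ∈ L) (v : E3) :
    star₂ S β ![v] ∈ L := by
  rw [star₂_apply]
  exact L.smul_mem _ (L.sum_mem fun a _ => L.sum_mem fun b _ => L.smul_mem _ (h _ _))

/-- The densities do not change under conjugation of the fields by an element of `G`. -/
theorem densities_conj (h : D.SmoothAt y) (hv : D.ValuedAt G y) (κ : InvInner G)
    (hS : (D.gram y).PosDef) (hgram : D'.gram y = D.gram y) (hzeta : D'.zeta y = D.zeta y)
    {g : SO N} (hg : g ∈ G)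
    (hF : ∀ v w, D'.curv y ![v, w] = ((g⁻¹ : SO N) : Mat N) * D.curv y ![v, w] * (g : Mat N))
    (hdB : ∀ v, D'.dB y ![v] = ((g⁻¹ : SO N) : Mat N) * D.dB y ![v] * (g : Mat N))
    (hB : D'.B y = ((g⁻¹ : SO N) : Mat N) * D.B y * (g : Mat N)) :
    D'.energyForm κ.form y ![e 0, e 1, e 2] = D.energyForm κ.form y ![e 0, e 1, e 2] ∧
      D'.chargeForm κ.form y = D.chargeForm κ.form y ∧
      D'.boundaryForm κ.form y = D.boundaryForm κ.form y := by
  have hF' : ∀ v w, D'.coneCurv y ![v, w]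
      = ((g⁻¹ : SO N) : Mat N) * D.coneCurv y ![v, w] * (g : Mat N) := fun v w => by
    rw [coneCurv_apply, coneCurv_apply, hF, hB, hzeta]
    simp only [mul_add, add_mul, mul_smul_comm, smul_mul_assoc]
  have hstar : ∀ v, star₂ (D.gram y) (D'.coneCurv y) ![v] = ((g⁻¹ : SO N) : Mat N)
      * star₂ (D.gram y) (D.coneCurv y) ![v] * (g : Mat N) := fun v => by
    simp only [star₂_apply, hF', mul_smul_comm, smul_mul_assoc, Finset.mul_sum, Finset.sum_mul]
  have m1 := hv.coneCurv_mem h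
  have m2 := hv.dB_mem h
  have m3 := star₂_mem (D.gram y) m1
  refine ⟨?_, ?_, ?_⟩
  · rw [energyForm_eq hS, energyForm_eq (hgram ▸ hS), hgram]
    simp only [pairing, hstar, hdB, κ.conj_inv hg (m3 _) (m3 _), κ.conj_inv hg (m2 _) (m2 _)]
  · refine form_three_ext fun u v w => ?_
    simp only [LocalData.chargeForm, wedge_two_apply, toLin_apply, hdB, hF',
      κ.conj_inv hg (m2 _) (m1 _ _)]
  · refine form_two_ext fun v w => ?_
    simp only [LocalData.boundaryForm, ContinuousAlternatingMap.add_apply,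
      ContinuousAlternatingMap.smul_apply, ContinuousLinearMap.compContinuousAlternatingMap_coe,
      Function.comp_apply, hF, hB, hzeta, κ.conj_inv hg (hv.B_mem h.mem) (hv.B_mem h.mem),
      κ.conj_inv hg (hv.B_mem h.mem) (hv.curv_mem h _ _)]

/-- The densities are natural under orientation preserving linear maps. -/
theorem densities_pullback (κ : Mat N →L[ℝ] Mat N →L[ℝ] ℝ) {x : E3} {J : E3 →L[ℝ] E3}
    (hJ : 0 < J.det) (hS : (D.gram y).PosDef) (hS' : (D'.gram x).PosDef)
    (hgram : D.gram y = (mat J).transpose * D'.gram x * mat J)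
    (hzeta : D.zeta y = (D'.zeta x).compContinuousLinearMap J)
    (hF : D.curv y = (D'.curv x).compContinuousLinearMap J)
    (hdB : D.dB y = (D'.dB x).compContinuousLinearMap J) (hB : D.B y = D'.B x) :
    D.energyForm κ y = (D'.energyForm κ x).compContinuousLinearMap J ∧
      D.chargeForm κ y = (D'.chargeForm κ x).compContinuousLinearMap J ∧
      D.boundaryForm κ y = (D'.boundaryForm κ x).compContinuousLinearMap J := by
  have hF' : D.coneCurv y = (D'.coneCurv x).compContinuousLinearMap J := by
    rw [LocalData.coneCurv, LocalData.coneCurv, hF, hzeta, hB]; rfl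
  have hlin : ∀ α : Form 1 (Mat N), toLin (α.compContinuousLinearMap J) = (toLin α).comp J :=
    fun α => rfl
  have hstar : star₂ (D.gram y) (D.coneCurv y)
      = (star₂ (D'.gram x) (D'.coneCurv x)).compContinuousLinearMap J := by
    rw [hF']
    conv_lhs => rw [← star₁_star₂ hS' (D'.coneCurv x), ← star₁_pullback J hJ hgram]
    rw [star₂_star₁ hS]
  refine ⟨?_, ?_, ?_⟩
  · rw [LocalData.energyForm, LocalData.energyForm, hstar, hF', hdB, star₁_pullback J hJ hgram,
      hlin, hlin, wedge_pullback, wedge_pullback]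
    rfl
  · rw [LocalData.chargeForm, LocalData.chargeForm, hF', hdB, hlin, wedge_pullback]
  · rw [LocalData.boundaryForm, LocalData.boundaryForm, hF, hB, hzeta]; rfl

theorem continuousWithinAt_energyForm (h : D.SmoothAt y) (hS : (D.gram y).PosDef)
    (hc : ContinuousWithinAt D.gram halfSpace y) (κ : Mat N →L[ℝ] Mat N →L[ℝ] ℝ) :
    ContinuousWithinAt (fun z => D.energyForm κ z ![e 0, e 1, e 2]) halfSpace y := by
  have hinv : ContinuousWithinAt (fun z => (D.gram z)⁻¹) halfSpace y := by
    have h1 : ContinuousAt Ring.inverse (D.gram y) := by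
      obtain ⟨u, hu⟩ := (Matrix.isUnit_iff_isUnit_det _).2 hS.det_pos.ne'.isUnit
      rw [← hu]
      exact NormedRing.inverse_continuousAt u
    have h2 : ContinuousAt (fun S : Matrix (Fin 3) (Fin 3) ℝ => S⁻¹) (D.gram y) := by
      refine h1.congr (Filter.Eventually.of_forall fun S => ?_)
      exact (Matrix.nonsing_inv_eq_ringInverse S).symm
    exact ContinuousAt.comp_continuousWithinAt (f := D.gram) h2 hc
  have hent : ∀ a b, ContinuousWithinAt (fun z => (D.gram z)⁻¹ a b) halfSpace y := fun a b =>
    continuousWithinAt_pi.1 (continuousWithinAt_pi.1 hinv a) b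
  have hdet : ContinuousWithinAt (fun z => √(D.gram z).det) halfSpace y :=
    (Real.continuous_sqrt.comp (continuous_id.matrix_det)).continuousAt.comp_continuousWithinAt hc
  have hF : ∀ v w, ContinuousWithinAt (fun z => D.coneCurv z ![v, w]) halfSpace y := fun v w =>
    (contDiffWithinAt_form_apply h.coneCurv _).continuousWithinAt
  have hB : ∀ v, ContinuousWithinAt (fun z => D.dB z ![v]) halfSpace y := fun v =>
    (contDiffWithinAt_form_apply h.dB _).continuousWithinAt
  have hFr : ∀ a b, ContinuousWithinAt
      (fun z => D.coneCurv z ![raised (D.gram z) a, raised (D.gram z) b]) halfSpace y := by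
    intro a b
    simp only [form_two_eq_sum _ (raised _ _), raised_apply]
    exact ((((hent _ _).mul (hent _ _)).sub ((hent _ _).mul (hent _ _))).smul (hF _ _)).add
      ((((hent _ _).mul (hent _ _)).sub ((hent _ _).mul (hent _ _))).smul (hF _ _)) |>.add
      ((((hent _ _).mul (hent _ _)).sub ((hent _ _).mul (hent _ _))).smul (hF _ _))
  have hBr : ∀ a, ContinuousWithinAt (fun z => D.dB z ![raised (D.gram z) a]) halfSpace y := by
    intro a
    simp only [form_one_eq_sum _ (raised _ _), raised_apply]
    exact (((hent _ _).smul (hB _)).add ((hent _ _).smul (hB _))).add ((hent _ _).smul (hB _))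
  have hs2 : ∀ a, ContinuousWithinAt
      (fun z => star₂ (D.gram z) (D.coneCurv z) ![e a]) halfSpace y := by
    intro a
    fin_cases a
    · simp only [Fin.zero_eta, (star₂_apply_e _ _).1]
      exact hdet.smul (hFr _ _)
    · simp only [Fin.mk_one, (star₂_apply_e _ _).2.1]
      exact (hdet.smul (hFr _ _)).neg
    · simp only [Fin.reduceFinMk, (star₂_apply_e _ _).2.2]
      exact hdet.smul (hFr _ _)
  have hκ : ∀ {f g : E3 → Mat N}, ContinuousWithinAt f halfSpace y →
      ContinuousWithinAt g halfSpace y →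
      ContinuousWithinAt (fun z => κ (f z) (g z)) halfSpace y := fun hf hg =>
    (κ.continuous.continuousAt.comp_continuousWithinAt hf).clm_apply hg
  simp only [LocalData.energyForm, ContinuousAlternatingMap.add_apply, wedge_two_apply, toLin_apply,
    (star₁_apply_e _ _).1, (star₁_apply_e _ _).2.1, (star₁_apply_e _ _).2.2]
  exact (((hκ (hs2 _) (hF _ _)).sub (hκ (hs2 _) (hF _ _))).add (hκ (hs2 _) (hF _ _))).add
    (((hκ (hB _) (hdet.smul (hBr _))).sub (hκ (hB _) (hdet.smul (hBr _)).neg)).add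
      (hκ (hB _) (hdet.smul (hBr _))))

end LocalData

/-! ### The globally defined densities -/

section Glue

variable {M : Type*} [TopologicalSpace M] [ChartedSpace (EuclideanHalfSpace 3) M]
  [IsManifold I3 ∞ M] {N : ℕ} {G : Subgroup (SO N)} {ι : Type*} {P : PrincipalBundle M G ι}
  {O : OrientedAtlas M} (met : Metric M) (ζ : ClosedTwoForm M) (A : Connection P) (B : AdSection P)
  (κ : InvInner G)
  {c c' : OpenPartialHomeomorph M (EuclideanHalfSpace 3)} {y : E3} {i j : ι}

/-- Different local trivializations give the same densities. -/
theorem densities_gauge (hc : c ∈ smoothCharts M) (hy : y ∈ (c.extend I3).target)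
    (hi : pt c y ∈ P.U i) (hj : pt c y ∈ P.U j) :
    (localData met ζ A B c j).energyForm κ.form y ![e 0, e 1, e 2]
        = (localData met ζ A B c i).energyForm κ.form y ![e 0, e 1, e 2] ∧
      (localData met ζ A B c j).chargeForm κ.form y
        = (localData met ζ A B c i).chargeForm κ.form y ∧
      (localData met ζ A B c j).boundaryForm κ.form y
        = (localData met ζ A B c i).boundaryForm κ.form y := by
  have hDi := smoothAt_localData met ζ A B hc hy hi
  have hU : IsOpen (P.U i ∩ P.U j) := (P.isOpen i).inter (P.isOpen j)
  have hg : ∀ x ∈ P.U i ∩ P.U j, ContMDiffAt I3 𝓘(ℝ, Mat N) ∞ (fun x => (P.g i j x : Mat N)) x :=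
    fun x hx => (P.smooth i j).contMDiffAt (hU.mem_nhds hx)
  have hgy := contDiffWithinAt_comp_pt hc hy (hg _ ⟨hi, hj⟩)
  have hnear := eventually_pt_mem hU hy ⟨hi, hj⟩
  obtain ⟨hF, hdB⟩ := LocalData.gauge hDi (smoothAt_localData met ζ A B hc hy hj)
    (g := fun z => (P.g i j (pt c z) : Mat N))
    (h := fun z => (((P.g i j (pt c z))⁻¹ : SO N) : Mat N)) hgy
    (contDiffWithinAt_clm
      (LinearMap.toContinuousLinearMap
        (Matrix.transposeLinearEquiv (Fin N) (Fin N) ℝ ℝ).toLinearMap)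
      hgy)
    (Filter.Eventually.of_forall fun z => coe_mul_inv_SO _)
    (Filter.Eventually.of_forall fun z => coe_inv_mul_SO _)
    (hnear.mono fun z hz v => by
      rw [fderivWithin_comp_pt hc hz.1 ((hg _ hz.2).mdifferentiableAt (by simp))]
      exact A.transform i j _ hz.2 _)
    (hnear.mono fun z hz => B.transform i j _ hz.2)
  exact LocalData.densities_conj hDi (valuedAt_localData met ζ A B hy hi) κ
    (posDef_gram met ζ A B hc hy) rfl rfl (P.mem i j _ ⟨hi, hj⟩) hF hdB
    (B.transform i j _ ⟨hi, hj⟩)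

/-- The densities are natural under oriented changes of charts. -/
theorem densities_trans (hc : c ∈ smoothCharts M) (hc' : c' ∈ smoothCharts M)
    (hy : y ∈ (c.extend I3).target) (h' : pt c y ∈ c'.source) (hi : pt c y ∈ P.U i)
    (hJ : 0 < (fderivWithin ℝ (trans c c') halfSpace y).det) :
    (localData met ζ A B c i).energyForm κ.form y
        = ((localData met ζ A B c' i).energyForm κ.form (trans c c' y)).compContinuousLinearMap
          (fderivWithin ℝ (trans c c') halfSpace y) ∧
      (localData met ζ A B c i).chargeForm κ.form y
        = ((localData met ζ A B c' i).chargeForm κ.form (trans c c' y)).compContinuousLinearMap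
          (fderivWithin ℝ (trans c c') halfSpace y) ∧
      (localData met ζ A B c i).boundaryForm κ.form y
        = ((localData met ζ A B c' i).boundaryForm κ.form (trans c c' y)).compContinuousLinearMap
          (fderivWithin ℝ (trans c c') halfSpace y) := by
  have hy' : trans c c' y ∈ (c'.extend I3).target := extend_mem_target h'
  have hp := pt_trans h'
  have hi' : pt c' (trans c c' y) ∈ P.U i := by rwa [hp]
  have hnear := eventually_pt_mem c'.open_source hy h'
  have hA : ∀ z ∈ (c.extend I3).target, pt c z ∈ c'.source → (localData met ζ A B c i).A z
      = ((localData met ζ A B c' i).A (trans c c' z)).comp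
        (fderivWithin ℝ (trans c c') halfSpace z) := by
    intro z hz hz'
    -- `A` depends on the base point also through its type, so equal points are substituted
    have hx : ∀ {x x' : M}, x = x' → ∀ L : E3 →L[ℝ] E3,
        (A.toFun i x : E3 →L[ℝ] Mat N).comp L = (A.toFun i x' : E3 →L[ℝ] Mat N).comp L := by
      intro x x' h L; subst h; rfl
    refine (congrArg (fun L : E3 →L[ℝ] E3 => (A.toFun i (pt c z) : E3 →L[ℝ] Mat N).comp L)
      (dpt_trans hc hc' hz hz')).trans ?_
    exact hx (pt_trans hz').symm _
  have hB : ∀ z, pt c z ∈ c'.source → (localData met ζ A B c i).B z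
      = (localData met ζ A B c' i).B (trans c c' z) := fun z hz =>
    congrArg (B.toFun i) (pt_trans hz).symm
  have hzeta : (localData met ζ A B c i).zeta y
      = ((localData met ζ A B c' i).zeta (trans c c' y)).compContinuousLinearMap
        (fderivWithin ℝ (trans c c') halfSpace y) := by
    have hx : ∀ {x x' : M}, x = x' → ∀ L : E3 →L[ℝ] E3,
        (ζ.toFun x : Form 2 ℝ).compContinuousLinearMap L
          = (ζ.toFun x' : Form 2 ℝ).compContinuousLinearMap L := by
      intro x x' h L; subst h; rfl
    refine (congrArg (fun L : E3 →L[ℝ] E3 =>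
      (ζ.toFun (pt c y) : Form 2 ℝ).compContinuousLinearMap L) (dpt_trans hc hc' hy h')).trans ?_
    exact hx hp.symm _
  obtain ⟨hF, hdB⟩ := LocalData.pullback (D := localData met ζ A B c i)
    (D' := localData met ζ A B c' i) (φ := trans c c')
    (smoothAt_localData met ζ A B hc' hy' hi')
    (target_subset hy) (contDiffWithinAt_trans hc hc' hy h')
    (hnear.mono fun z hz => target_subset (extend_mem_target hz.2))
    (hnear.mono fun z hz => hA z hz.1 hz.2) (hnear.mono fun z hz => hB z hz.2)
  exact LocalData.densities_pullback κ.form hJ (posDef_gram met ζ A B hc hy)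
    (posDef_gram met ζ A B hc' hy') (gram_trans met ζ A B hc hc' hy h') hzeta hF hdB (hB y h')

omit [IsManifold I3 ∞ M] in
variable (O) in
theorem det_trans_pos (hc : c ∈ O.charts) (hc' : c' ∈ O.charts) (hy : y ∈ (c.extend I3).target)
    (h' : pt c y ∈ c'.source) : 0 < (fderivWithin ℝ (trans c c') halfSpace y).det := by
  have := O.positive c hc c' hc' (pt c y) ⟨pt_mem_source hy, h'⟩
  rwa [extend_pt hy] at this

/-- At each point the global densities may be computed in any local trivialization. -/
theorem glue_eq (hc : c ∈ smoothCharts M) (hy : y ∈ (c.extend I3).target) (hi : pt c y ∈ P.U i) :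
    energyForm met ζ A B κ c y ![e 0, e 1, e 2]
        = (localData met ζ A B c i).energyForm κ.form y ![e 0, e 1, e 2] ∧
      chargeForm met ζ A B κ c y = (localData met ζ A B c i).chargeForm κ.form y ∧
      boundaryForm met ζ A B κ c y = (localData met ζ A B c i).boundaryForm κ.form y :=
  densities_gauge met ζ A B κ hc hy hi (P.cover (pt c y)).choose_spec

variable (O) in
/-- The densities in two oriented charts: the `3`-forms scale by the Jacobian determinant and the
`2`-form is pulled back. -/
theorem glue_trans (hc : c ∈ O.charts) (hc' : c' ∈ O.charts) (hy : y ∈ (c.extend I3).target)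
    (h' : pt c y ∈ c'.source) :
    energyForm met ζ A B κ c y ![e 0, e 1, e 2]
        = (fderivWithin ℝ (trans c c') halfSpace y).det
          * energyForm met ζ A B κ c' (trans c c' y) ![e 0, e 1, e 2] ∧
      chargeForm met ζ A B κ c y ![e 0, e 1, e 2]
        = (fderivWithin ℝ (trans c c') halfSpace y).det
          * chargeForm met ζ A B κ c' (trans c c' y) ![e 0, e 1, e 2] ∧
      boundaryForm met ζ A B κ c y
        = (boundaryForm met ζ A B κ c' (trans c c' y)).compContinuousLinearMap
          (fderivWithin ℝ (trans c c') halfSpace y) := by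
  obtain ⟨i, hi⟩ := P.cover (pt c y)
  have hy' : trans c c' y ∈ (c'.extend I3).target := extend_mem_target h'
  have hi' : pt c' (trans c c' y) ∈ P.U i := by rwa [pt_trans h']
  obtain ⟨a1, a2, a3⟩ := glue_eq met ζ A B κ (O.smooth hc) hy hi
  obtain ⟨b1, b2, b3⟩ := glue_eq met ζ A B κ (O.smooth hc') hy' hi'
  obtain ⟨t1, t2, t3⟩ := densities_trans met ζ A B κ (O.smooth hc) (O.smooth hc') hy h' hi
    (det_trans_pos O hc hc' hy h')
  refine ⟨?_, ?_, ?_⟩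
  · rw [a1, b1, t1, pullback_three_e]
  · rw [a2, b2, t2, pullback_three_e]
  · rw [a3, b3, t3]

theorem continuousOn_energyForm (hc : c ∈ smoothCharts M) :
    ContinuousOn (fun y => energyForm met ζ A B κ c y ![e 0, e 1, e 2]) (c.extend I3).target := by
  intro y hy
  obtain ⟨i, hi⟩ := P.cover (pt c y)
  refine ContinuousWithinAt.mono ?_ (target_subset (c := c))
  refine (LocalData.continuousWithinAt_energyForm (smoothAt_localData met ζ A B hc hy hi)
    (posDef_gram met ζ A B hc hy) (continuousWithinAt_gram met ζ A B hc hy)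
    κ.form).congr_of_eventuallyEq ?_ (glue_eq met ζ A B κ hc hy hi).1
  filter_upwards [eventually_pt_mem (P.isOpen i) hy hi] with z hz
  exact (glue_eq met ζ A B κ hc hz.1 hz.2).1

theorem contDiffWithinAt_boundaryForm (hc : c ∈ smoothCharts M) (hy : y ∈ (c.extend I3).target) :
    ContDiffWithinAt ℝ ∞ (boundaryForm met ζ A B κ c) halfSpace y := by
  obtain ⟨i, hi⟩ := P.cover (pt c y)
  refine ((smoothAt_localData met ζ A B hc hy hi).boundaryForm κ.form).congr_of_eventuallyEq ?_
    (glue_eq met ζ A B κ hc hy hi).2.2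
  filter_upwards [eventually_pt_mem (P.isOpen i) hy hi] with z hz
  exact (glue_eq met ζ A B κ hc hz.1 hz.2).2.2

/-- The charge density is the exterior derivative of the boundary form. -/
theorem extDerivWithin_boundaryForm (hc : c ∈ smoothCharts M) (hy : y ∈ (c.extend I3).target) :
    extDerivWithin (boundaryForm met ζ A B κ c) halfSpace y = chargeForm met ζ A B κ c y := by
  obtain ⟨i, hi⟩ := P.cover (pt c y)
  have h1 : boundaryForm met ζ A B κ c =ᶠ[nhdsWithin y halfSpace]
      (localData met ζ A B c i).boundaryForm κ.form := by
    filter_upwards [eventually_pt_mem (P.isOpen i) hy hi] with z hz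
    exact (glue_eq met ζ A B κ hc hz.1 hz.2).2.2
  rw [h1.extDerivWithin_eq_of_mem (target_subset hy), (glue_eq met ζ A B κ hc hy hi).2.1]
  exact LocalData.extDerivWithin_boundaryForm (smoothAt_localData met ζ A B hc hy hi)
    (valuedAt_localData met ζ A B hy hi) (closed_localData met ζ A B hc hy) κ

theorem continuousOn_chargeForm (hc : c ∈ smoothCharts M) :
    ContinuousOn (fun y => chargeForm met ζ A B κ c y ![e 0, e 1, e 2]) (c.extend I3).target := by
  intro y hy
  refine ContinuousWithinAt.mono ?_ (target_subset (c := c))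
  have h1 := contDiffWithinAt_form_apply (contDiffWithinAt_extDerivWithin (target_subset hy)
    (contDiffWithinAt_boundaryForm met ζ A B κ hc hy)) ![e 0, e 1, e 2]
  refine h1.continuousWithinAt.congr_of_eventuallyEq ?_
    (by rw [extDerivWithin_boundaryForm met ζ A B κ hc hy])
  filter_upwards [target_mem_nhdsWithin hy] with z hz
  rw [extDerivWithin_boundaryForm met ζ A B κ hc hz]

/-- The pointwise inequality between energy and charge densities; equality in any chart and
trivialization characterizes the duality condition. -/
theorem glue_energy_sub_charge (hc : c ∈ smoothCharts M) (hy : y ∈ (c.extend I3).target)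
    (hi : pt c y ∈ P.U i) {ε : ℝ} (hε : ε * ε = 1) :
    ε * (2 * chargeForm met ζ A B κ c y ![e 0, e 1, e 2])
        ≤ energyForm met ζ A B κ c y ![e 0, e 1, e 2] ∧
      (energyForm met ζ A B κ c y ![e 0, e 1, e 2]
          = ε * (2 * chargeForm met ζ A B κ c y ![e 0, e 1, e 2]) ↔
        (localData met ζ A B c i).Duality ε y) := by
  rw [(glue_eq met ζ A B κ hc hy hi).1, (glue_eq met ζ A B κ hc hy hi).2.1]
  exact LocalData.energy_sub_charge (posDef_gram met ζ A B hc hy)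
    (smoothAt_localData met ζ A B hc hy hi) (valuedAt_localData met ζ A B hy hi) κ hε

/-- The duality condition implies both cone Yang-Mills equations. -/
theorem coneYM_of_duality {ε : ℝ} (hε : ε * ε = 1) (hd : Duality O met ζ A B ε) :
    ConeYM₁ O met ζ A B ∧ ConeYM₂ O met ζ A B := by
  have hnear : ∀ c ∈ O.charts, ∀ i, ∀ y ∈ (c.extend I3).target, pt c y ∈ P.U i →
      ∀ᶠ z in nhdsWithin y halfSpace, (localData met ζ A B c i).Duality ε z := by
    intro c hc i y hy hi
    filter_upwards [eventually_pt_mem (P.isOpen i) hy hi] with z hz using hd c hc i z hz.1 hz.2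
  refine ⟨fun c hc i y hy hi => ?_, fun c hc i y hy hi => ?_⟩
  · refine LocalData.coneYM₁_of_duality hε (smoothAt_localData met ζ A B (O.smooth hc) hy hi) ?_
      (hnear c hc i y hy hi)
    filter_upwards [target_mem_nhdsWithin hy] with z hz using posDef_gram met ζ A B (O.smooth hc) hz
  · exact LocalData.coneYM₂_of_duality hε (smoothAt_localData met ζ A B (O.smooth hc) hy hi)
      (closed_localData met ζ A B (O.smooth hc) hy) (posDef_gram met ζ A B (O.smooth hc) hy)
      (hnear c hc i y hy hi)

end Glue

/-! ### The energy bound -/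

section Integration

theorem continuousOn_comp_pt {M : Type*} [TopologicalSpace M]
    {c : OpenPartialHomeomorph M (EuclideanHalfSpace 3)} {f : M → ℝ} (hf : Continuous f) :
    ContinuousOn (fun y => f (pt c y)) (c.extend I3).target :=
  fun _ hy =>
    (hf.continuousAt.comp_continuousWithinAt (continuousWithinAt_pt hy)).mono target_subset

variable {M : Type*} [TopologicalSpace M] [ChartedSpace (EuclideanHalfSpace 3) M]
  [IsManifold I3 ∞ M] [T2Space M] [SigmaCompactSpace M] (O : OrientedAtlas M)

theorem tsupport_partition_subset (c : O.charts) : tsupport (partition O c) ⊆ c.1.source :=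
  (SmoothPartitionOfUnity.exists_isSubordinate I3 isClosed_univ
    (fun c : O.charts => c.1.source) (fun c => c.1.open_source)
    (fun x _ => by
      obtain ⟨c, hc, hx⟩ := O.cover x
      exact mem_iUnion.2 ⟨⟨c, hc⟩, hx⟩)).choose_spec c

theorem mem_source_of_partition_ne_zero {c : O.charts} {x : M} (h : partition O c x ≠ 0) :
    x ∈ c.1.source :=
  tsupport_partition_subset O c (subset_tsupport _ h)

variable {O} {σ τ : OpenPartialHomeomorph M (EuclideanHalfSpace 3) → E3 → Form 3 ℝ}

theorem continuousOn_chartDensity {c : O.charts}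
    (hτ : ContinuousOn (fun y => τ c.1 y ![e 0, e 1, e 2]) (c.1.extend I3).target) :
    ContinuousOn (chartDensity O τ c) (c.1.extend I3).target :=
  (continuousOn_comp_pt (partition O c).contMDiff.continuous).mul hτ

theorem abs_chartDensity_le {c : O.charts} {y : E3}
    (h : |σ c.1 y ![e 0, e 1, e 2]| ≤ |τ c.1 y ![e 0, e 1, e 2]|) :
    |chartDensity O σ c y| ≤ |chartDensity O τ c y| := by
  rw [chartDensity, chartDensity, abs_mul, abs_mul]
  gcongr

/-- Domination of densities gives absolute integrability. -/
theorem FormIntegrable.of_abs_le (hτ : FormIntegrable O τ)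
    (hσ : ∀ c ∈ O.charts, ContinuousOn (fun y => σ c y ![e 0, e 1, e 2]) (c.extend I3).target)
    (h : ∀ c ∈ O.charts, ∀ y ∈ (c.extend I3).target,
      |σ c y ![e 0, e 1, e 2]| ≤ |τ c y ![e 0, e 1, e 2]|) : FormIntegrable O σ := by
  have hint : ∀ c : O.charts, IntegrableOn (chartDensity O σ c) (c.1.extend I3).target := by
    intro c
    refine Integrable.mono (hτ.1 c)
      ((continuousOn_chartDensity (hσ c c.2)).aestronglyMeasurable measurableSet_target) ?_
    filter_upwards [ae_restrict_mem measurableSet_target] with y hy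
    exact abs_chartDensity_le (h c c.2 y hy)
  refine ⟨hint, hτ.2.of_nonneg_of_le (fun c => integral_nonneg fun y => abs_nonneg _) fun c => ?_⟩
  exact setIntegral_mono_on (hint c).abs (hτ.1 c).abs measurableSet_target
    fun y hy => abs_chartDensity_le (h c c.2 y hy)

theorem FormIntegrable.summable (hτ : FormIntegrable O τ) :
    Summable fun c : O.charts => ∫ y in (c.1.extend I3).target, chartDensity O τ c y :=
  Summable.of_norm_bounded hτ.2 fun _ => norm_integral_le_integral_norm _

theorem formIntegral_sub_smul (hσ : FormIntegrable O σ) (hτ : FormIntegrable O τ) (a : ℝ) :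
    (Summable fun c : O.charts => ∫ y in (c.1.extend I3).target,
        (chartDensity O τ c y - a * chartDensity O σ c y)) ∧
      formIntegral O τ - a * formIntegral O σ = ∑' c : O.charts, ∫ y in (c.1.extend I3).target,
        (chartDensity O τ c y - a * chartDensity O σ c y) := by
  have h : ∀ c : O.charts, ∫ y in (c.1.extend I3).target,
      (chartDensity O τ c y - a * chartDensity O σ c y)
        = (∫ y in (c.1.extend I3).target, chartDensity O τ c y)
          - a * ∫ y in (c.1.extend I3).target, chartDensity O σ c y := fun c => by
    rw [integral_sub (hτ.1 c) ((hσ.1 c).const_mul a), integral_const_mul]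
  simp only [h]
  refine ⟨hτ.summable.sub (hσ.summable.mul_left a), ?_⟩
  rw [hτ.summable.tsum_sub (hσ.summable.mul_left a), tsum_mul_left]
  rfl

/-- The integrals of two forms whose densities are pointwise ordered. Equality of the integrals
forces equality of the densities. -/
theorem formIntegral_le_and_eq_iff (hσ : FormIntegrable O σ) (hτ : FormIntegrable O τ) {a : ℝ}
    (hσc : ∀ c ∈ O.charts, ContinuousOn (fun y => σ c y ![e 0, e 1, e 2]) (c.extend I3).target)
    (hτc : ∀ c ∈ O.charts, ContinuousOn (fun y => τ c y ![e 0, e 1, e 2]) (c.extend I3).target)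
    (h : ∀ c ∈ O.charts, ∀ y ∈ (c.extend I3).target,
      a * σ c y ![e 0, e 1, e 2] ≤ τ c y ![e 0, e 1, e 2]) :
    a * formIntegral O σ ≤ formIntegral O τ ∧
      (formIntegral O τ = a * formIntegral O σ ↔ ∀ c : O.charts, ∀ y ∈ (c.1.extend I3).target,
        chartDensity O τ c y = a * chartDensity O σ c y) := by
  obtain ⟨hs, heq⟩ := formIntegral_sub_smul hσ hτ a
  have hle : ∀ c : O.charts, ∀ y ∈ (c.1.extend I3).target,
      0 ≤ chartDensity O τ c y - a * chartDensity O σ c y := fun c y hy => by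
    have := mul_le_mul_of_nonneg_left (h c c.2 y hy) ((partition O).nonneg c (pt c.1 y))
    simp only [chartDensity]
    linarith
  have hnn : ∀ c : O.charts, 0 ≤ ∫ y in (c.1.extend I3).target,
      (chartDensity O τ c y - a * chartDensity O σ c y) := fun c =>
    setIntegral_nonneg measurableSet_target (hle c)
  refine ⟨sub_nonneg.1 (heq ▸ tsum_nonneg hnn), fun h0 c y hy => ?_, fun h0 => ?_⟩
  · have h1 : HasSum (fun c : O.charts => ∫ y in (c.1.extend I3).target,
        (chartDensity O τ c y - a * chartDensity O σ c y)) 0 := by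
      have := hs.hasSum
      rwa [← heq, h0, sub_self] at this
    have h2 := congrFun ((hasSum_zero_iff_of_nonneg hnn).1 h1) c
    have hcont : ContinuousOn (fun y => chartDensity O τ c y - a * chartDensity O σ c y)
        (c.1.extend I3).target := (continuousOn_chartDensity (hτc c c.2)).sub
      (continuousOn_const.mul (continuousOn_chartDensity (hσc c c.2)))
    have h3 := (setIntegral_eq_zero_iff_of_nonneg_ae
      ((ae_restrict_mem measurableSet_target).mono fun y hy => hle c y hy)
      ((hτ.1 c).sub ((hσ.1 c).const_mul a))).1 h2
    have h4 := Measure.eqOn_of_ae_eq h3 hcont continuousOn_const target_subset_closure_interior hy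
    exact sub_eq_zero.1 h4
  · have : ∀ c : O.charts, ∫ y in (c.1.extend I3).target,
        (chartDensity O τ c y - a * chartDensity O σ c y) = 0 := fun c =>
      setIntegral_eq_zero_of_forall_eq_zero fun y hy => sub_eq_zero.2 (h0 c y hy)
    simp only [this, tsum_zero] at heq
    linarith

variable {N : ℕ} {G : Subgroup (SO N)} {ι : Type*} {P : PrincipalBundle M G ι}
  (met : Metric M) (ζ : ClosedTwoForm M) (A : Connection P) (B : AdSection P) (κ : InvInner G)

/-- The duality condition is the pointwise equality of energy and charge densities; by the partition
of unity, it suffices to know this weighted by the partition functions. -/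
theorem duality_iff_chartDensity {ε : ℝ} (hε : ε * ε = 1) :
    (∀ c : O.charts, ∀ y ∈ (c.1.extend I3).target,
      chartDensity O (energyForm met ζ A B κ) c y
        = ε * 2 * chartDensity O (chargeForm met ζ A B κ) c y) ↔ Duality O met ζ A B ε := by
  constructor
  · intro h c hc i y hy hi
    refine (glue_energy_sub_charge met ζ A B κ (O.smooth hc) hy hi hε).2.1 ?_
    -- the equality of densities is transported from a chart with nonzero weight at the given point
    obtain ⟨c', hpos⟩ := (partition O).exists_pos_of_mem (mem_univ (pt c y))
    have hx := mem_source_of_partition_ne_zero O hpos.ne'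
    obtain ⟨h1, h2, -⟩ := glue_trans O met ζ A B κ hc c'.2 hy hx
    have h3 := h c' _ (extend_mem_target hx)
    rw [chartDensity, chartDensity, pt_extend hx] at h3
    have h4 : energyForm met ζ A B κ c'.1 (trans c c' y) ![e 0, e 1, e 2]
        = ε * 2 * chargeForm met ζ A B κ c'.1 (trans c c' y) ![e 0, e 1, e 2] :=
      mul_left_cancel₀ hpos.ne' (h3.trans (by simp only [trans]; ring))
    rw [h1, h2, h4]
    ring
  · intro h c y hy
    obtain ⟨i, hi⟩ := P.cover (pt c.1 y)
    have := (glue_energy_sub_charge met ζ A B κ (O.smooth c.2) hy hi hε).2.2 (h c c.2 i y hy hi)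
    rw [chartDensity, chartDensity, this]
    ring

/-- Finite action implies absolute convergence of the charge: by the pointwise inequality for both
signs of `ε`, the charge density is at most the energy density. -/
theorem formIntegrable_chargeForm (hE : FiniteAction O met ζ A B κ) :
    FormIntegrable O (chargeForm met ζ A B κ) := by
  refine FormIntegrable.of_abs_le hE
    (fun c hc => continuousOn_chargeForm met ζ A B κ (O.smooth hc)) fun c hc y hy => ?_
  obtain ⟨i, hi⟩ := P.cover (pt c y)
  have h1 := (glue_energy_sub_charge met ζ A B κ (O.smooth hc) hy hi (ε := 1) (by norm_num)).1
  have h2 := (glue_energy_sub_charge met ζ A B κ (O.smooth hc) hy hi (ε := -1) (by norm_num)).1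
  have h3 := le_abs_self (energyForm met ζ A B κ c y ![e 0, e 1, e 2])
  exact abs_le.2 ⟨by linarith, by linarith⟩

theorem charge_le_action (hE : FiniteAction O met ζ A B κ) {ε : ℝ} (hε : ε * ε = 1) :
    ε * (2 * charge O met ζ A B κ) ≤ action O met ζ A B κ ∧
      (action O met ζ A B κ = ε * (2 * charge O met ζ A B κ) ↔ Duality O met ζ A B ε) := by
  have := formIntegral_le_and_eq_iff (formIntegrable_chargeForm met ζ A B κ hE) hE (a := ε * 2)
    (fun c hc => continuousOn_chargeForm met ζ A B κ (O.smooth hc))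
    (fun c hc => continuousOn_energyForm met ζ A B κ (O.smooth hc)) (fun c hc y hy => by
      obtain ⟨i, hi⟩ := P.cover (pt c y)
      have := (glue_energy_sub_charge met ζ A B κ (O.smooth hc) hy hi hε).1
      linarith)
  rw [duality_iff_chartDensity met ζ A B κ hε, mul_assoc] at this
  exact this

end Integration

/-! ### Stokes' theorem on the half-space -/

section Stokes

theorem mem_halfSpace {y : E3} : y ∈ halfSpace ↔ 0 ≤ y 0 := by
  rw [halfSpace, range_modelWithCornersEuclideanHalfSpace]; rfl

theorem mem_interior_halfSpace {y : E3} (h : 0 < y 0) : halfSpace ∈ nhds y :=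
  Filter.mem_of_superset
    ((isOpen_lt continuous_const (by fun_prop : Continuous fun z : E3 => z 0)).mem_nhds h)
    fun _ hz => mem_halfSpace.2 (le_of_lt hz)

/-- The divergence theorem for a compactly supported vector field on the half-space. -/
theorem integral_divergence_halfSpace {g : Fin 3 → E3 → ℝ}
    (hg : ∀ i, ∀ y ∈ halfSpace, ContDiffWithinAt ℝ ∞ (g i) halfSpace y) {K : Set E3}
    (hK : IsCompact K) (h0 : ∀ i, ∀ y ∈ halfSpace, y ∉ K → g i y = 0) :
    ∫ y in halfSpace, ∑ i, fderivWithin ℝ (g i) halfSpace y (e i)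
      = -∫ z : EuclideanSpace ℝ (Fin 2), g 0 (bdryPt z) := by
  -- the box `[0, R] × [-R, R]²` contains the support of the field
  obtain ⟨R, hR, hKR⟩ := hK.isBounded.subset_ball_lt 0 0
  have hout : ∀ {y : E3} (j : Fin 3), R ≤ |y j| → y ∉ K := fun {y} j h hy => by
    have h1 := mem_ball_zero_iff.1 (hKR hy)
    have h2 := PiLp.norm_apply_le y j
    rw [Real.norm_eq_abs] at h2
    linarith
  have hdz : ∀ i, ∀ y ∈ halfSpace, ∀ j, R < |y j| → fderivWithin ℝ (g i) halfSpace y = 0 := by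
    intro i y hy j hj
    have h1 : g i =ᶠ[nhdsWithin y halfSpace] fun _ => (0 : ℝ) := by
      have h2 : ∀ᶠ z in nhds y, R < |z j| :=
        (isOpen_lt continuous_const (by fun_prop : Continuous fun z : E3 => |z j|)).mem_nhds hj
      filter_upwards [self_mem_nhdsWithin, h2.filter_mono nhdsWithin_le_nhds] with z hz hz'
      exact h0 i z hz (hout j hz'.le)
    rw [h1.fderivWithin_eq_of_mem hy]
    simp
  -- the divergence theorem of Mathlib is about `Fin 3 → ℝ`, with the sup norm
  let L : (Fin 3 → ℝ) ≃L[ℝ] E3 := (PiLp.continuousLinearEquiv 2 ℝ fun _ : Fin 3 => ℝ).symm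
  have hL : ∀ x i, L x i = x i := fun x i => rfl
  have hLe : ∀ i, L (Pi.single i 1) = e i := fun i => rfl
  have hmp : MeasurePreserving (L : (Fin 3 → ℝ) → E3) volume volume :=
    PiLp.volume_preserving_toLp (Fin 3)
  have hemb : MeasurableEmbedding (L : (Fin 3 → ℝ) → E3) := L.toHomeomorph.measurableEmbedding
  let a : Fin 3 → ℝ := ![0, -R, -R]
  let b : Fin 3 → ℝ := ![R, R, R]
  have hab : a ≤ b := fun i => by fin_cases i <;> simp [a, b] <;> linarith
  have hbox : ∀ {x}, x ∈ Icc a b → L x ∈ halfSpace := fun {x} hx => mem_halfSpace.2 (hx.1 0)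
  have hbox' : ∀ {x}, L x ∈ halfSpace → x ∉ Icc a b → ∃ j, R < |L x j| := by
    intro x hx hn
    by_contra! hcon
    refine hn ⟨fun i => ?_, fun i => ?_⟩
    · fin_cases i
      · exact mem_halfSpace.1 hx
      · exact (abs_le.1 (hcon 1)).1
      · exact (abs_le.1 (hcon 2)).1
    · fin_cases i
      · exact (abs_le.1 (hcon 0)).2
      · exact (abs_le.1 (hcon 1)).2
      · exact (abs_le.1 (hcon 2)).2
  have hmaps : MapsTo L (Icc a b) halfSpace := fun x hx => hbox hx
  have hdiv := integral_divergence_of_hasFDerivAt_off_countable a b hab (fun x i => g i (L x))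
    (fun x => ContinuousLinearMap.pi fun i =>
      (fderivWithin ℝ (g i) halfSpace (L x)).comp (L : (Fin 3 → ℝ) →L[ℝ] E3)) ∅ countable_empty
    (continuousOn_pi.2 fun i =>
      (ContinuousOn.comp (fun y hy => (hg i y hy).continuousWithinAt) L.continuous.continuousOn
        hmaps))
    (fun x hx => by
      refine hasFDerivAt_pi.2 fun i => ?_
      have hx0 : 0 < L x 0 := (hx.1 0 (mem_univ 0)).1
      have h1 := mem_interior_halfSpace hx0
      have h2 := ((diff_of_smooth (hg i _ (mem_of_mem_nhds h1))).hasFDerivWithinAt).hasFDerivAt h1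
      exact h2.comp x L.hasFDerivAt)
    (by
      refine ContinuousOn.integrableOn_Icc ?_
      refine continuousOn_finsetSum _ fun i _ => ?_
      have h1 : ContinuousOn (fun y => fderivWithin ℝ (g i) halfSpace y (e i)) halfSpace :=
        fun y hy => ((contDiffWithinAt_fderivWithin hy (hg i y hy)).continuousWithinAt).clm_apply
          continuousWithinAt_const
      exact h1.comp L.continuous.continuousOn hmaps)
  have hlhs : ∫ y in halfSpace, ∑ i, fderivWithin ℝ (g i) halfSpace y (e i)
      = ∫ x in Icc a b, ∑ i, fderivWithin ℝ (g i) halfSpace (L x) (e i) := by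
    rw [← hmp.setIntegral_preimage_emb hemb
      (fun y => ∑ i, fderivWithin ℝ (g i) halfSpace y (e i)) halfSpace]
    refine setIntegral_eq_of_subset_of_forall_sdiff_eq_zero
      (L.continuous.measurable I3.isClosed_range.measurableSet) hmaps fun x hx => ?_
    obtain ⟨j, hj⟩ := hbox' hx.1 hx.2
    exact Finset.sum_eq_zero fun i _ => by rw [hdz i _ hx.1 j hj]; rfl
  -- on the faces other than `{y 0 = 0}` the field vanishes
  have hface : ∀ (i j : Fin 3) (t : ℝ) (x : Fin 2 → ℝ), R ≤ |t| →
      (∀ k, a (i.succAbove k) ≤ x k) → (0 ≤ t ∨ i ≠ 0) → g j (L (i.insertNth t x)) = 0 := by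
    intro i j t x ht hx hi
    refine h0 j _ (mem_halfSpace.2 ?_) (hout i (by rw [hL]; simpa using ht))
    rw [hL]
    fin_cases i
    · simpa using hi
    · exact hx 0
    · exact hx 0
  have hz : ∀ (i : Fin 3) (t : ℝ), R ≤ |t| → (0 ≤ t ∨ i ≠ 0) →
      ∫ x in Icc (a ∘ i.succAbove) (b ∘ i.succAbove), g i (L (i.insertNth t x)) = 0 :=
    fun i t ht hi => setIntegral_eq_zero_of_forall_eq_zero fun x hx =>
      hface i i t x ht (fun k => hx.1 k) hi
  have hmp2 : MeasurePreserving (WithLp.toLp 2 : (Fin 2 → ℝ) → EuclideanSpace ℝ (Fin 2))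
      volume volume := PiLp.volume_preserving_toLp (Fin 2)
  have hbd : ∫ x in Icc (a ∘ (0 : Fin 3).succAbove) (b ∘ (0 : Fin 3).succAbove),
      g 0 (L ((0 : Fin 3).insertNth (a 0) x)) = ∫ z : EuclideanSpace ℝ (Fin 2), g 0 (bdryPt z) := by
    rw [← hmp2.integral_comp (MeasurableEquiv.toLp 2 (Fin 2 → ℝ)).measurableEmbedding,
      setIntegral_eq_integral_of_forall_compl_eq_zero]
    · congr 1
      ext x
      congr 1
      ext k
      rw [hL]
      fin_cases k <;> rfl
    · intro x hx
      have hm : L ((0 : Fin 3).insertNth (a 0) x) ∈ halfSpace := mem_halfSpace.2 le_rfl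
      obtain ⟨j, hj⟩ := hbox' hm fun h => hx ⟨fun k => by simpa using h.1 k.succ,
        fun k => by simpa using h.2 k.succ⟩
      exact h0 0 _ hm (hout j hj.le)
  have hbR : ∀ i, R ≤ |b i| := fun i => by
    fin_cases i <;> exact le_abs_self R
  have hb0 : ∀ i, 0 ≤ b i := fun i => by fin_cases i <;> exact hR.le
  rw [hlhs]
  refine hdiv.trans ?_
  rw [Fin.sum_univ_three, hz 0 _ (hbR 0) (.inl (hb0 0)), hz 1 _ (hbR 1) (.inl (hb0 1)),
    hz 2 _ (hbR 2) (.inl (hb0 2)), hz 1 (a 1) (by simp [a, abs_of_pos hR]) (.inr (by decide)),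
    hz 2 (a 2) (by simp [a, abs_of_pos hR]) (.inr (by decide)), hbd]
  ring

/-- Stokes' theorem on the half-space for a compactly supported `2`-form. -/
theorem integral_extDerivWithin_halfSpace {η : E3 → Form 2 ℝ}
    (hη : ∀ y ∈ halfSpace, ContDiffWithinAt ℝ ∞ η halfSpace y) {K : Set E3} (hK : IsCompact K)
    (h0 : ∀ y ∈ halfSpace, y ∉ K → η y = 0) :
    ∫ y in halfSpace, extDerivWithin η halfSpace y ![e 0, e 1, e 2]
      = -∫ z : EuclideanSpace ℝ (Fin 2), η (bdryPt z) ![e 1, e 2] := by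
  have h := integral_divergence_halfSpace
    (g := ![fun y => η y ![e 1, e 2], fun y => -(η y ![e 0, e 2]), fun y => η y ![e 0, e 1]])
    (fun i y hy => by
      fin_cases i
      · exact contDiffWithinAt_form_apply (hη y hy) _
      · exact (contDiffWithinAt_form_apply (hη y hy) _).neg
      · exact contDiffWithinAt_form_apply (hη y hy) _) hK
    (fun i y hy hy' => by fin_cases i <;> simp [h0 y hy hy'])
  refine Eq.trans (setIntegral_congr_fun I3.isClosed_range.measurableSet fun y hy => ?_) h
  simp only [Fin.sum_univ_three]
  rw [extDerivWithin_two_apply hy (hη y hy), sub_eq_add_neg]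
  congr 2
  exact (congrArg (fun l : E3 →L[ℝ] ℝ => l (e 1))
    (fderivWithin_fun_neg (uniqueDiffOn_halfSpace y hy))).symm

end Stokes

/-! ### Stokes' theorem and change of variables in charts -/

section ChartStokes

variable {M : Type*} [TopologicalSpace M] {c c' : OpenPartialHomeomorph M (EuclideanHalfSpace 3)}
  {y : E3}

theorem isCompact_image_extend {K : Set M} (hK : IsCompact K) (hKc : K ⊆ c.source) :
    IsCompact (c.extend I3 '' K) :=
  hK.image_of_continuousOn (c.continuousOn_extend.mono (by rwa [c.extend_source]))

theorem image_extend_subset {K : Set M} (hKc : K ⊆ c.source) :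
    c.extend I3 '' K ⊆ (c.extend I3).target := by
  rintro _ ⟨x, hx, rfl⟩
  exact extend_mem_target (hKc hx)

/-- A continuous function on a chart domain with compact support in it is integrable. -/
theorem integrableOn_target {K : Set M} (hK : IsCompact K) (hKc : K ⊆ c.source) {f : E3 → ℝ}
    (hf : ContinuousOn f (c.extend I3).target)
    (h0 : ∀ y ∈ (c.extend I3).target, pt c y ∉ K → f y = 0) :
    IntegrableOn f (c.extend I3).target := by
  refine IntegrableOn.of_forall_sdiff_eq_zero
    ((hf.mono (image_extend_subset hKc)).integrableOn_compact (isCompact_image_extend hK hKc))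
    measurableSet_target fun y hy => h0 y hy.1 fun h => hy.2 ⟨_, h, extend_pt hy.1⟩

/-- A form on the target of a chart which is smooth and has compact support there extends by zero to
a smooth form on the half-space, to which Stokes' theorem applies. -/
theorem integral_extDerivWithin_target {K : Set M} (hK : IsCompact K) (hKc : K ⊆ c.source)
    {η : E3 → Form 2 ℝ}
    (hη : ∀ y ∈ (c.extend I3).target, ContDiffWithinAt ℝ ∞ η halfSpace y)
    (h0 : ∀ y ∈ (c.extend I3).target, pt c y ∉ K → η y = 0) :
    ∫ y in (c.extend I3).target, extDerivWithin η halfSpace y ![e 0, e 1, e 2]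
      = -∫ z in bdryPt ⁻¹' (c.extend I3).target, η (bdryPt z) ![e 1, e 2] := by
  classical
  set T := (c.extend I3).target with hT
  have hK' := isCompact_image_extend hK hKc
  have hz : ∀ y, y ∉ c.extend I3 '' K → T.indicator η y = 0 := by
    intro y hy
    by_cases hyT : y ∈ T
    · rw [indicator_of_mem hyT]
      exact h0 y hyT fun h => hy ⟨_, h, extend_pt hyT⟩
    · exact indicator_of_notMem hyT _
  have heq : ∀ y ∈ T, T.indicator η =ᶠ[nhdsWithin y halfSpace] η := fun y hy => by
    filter_upwards [target_mem_nhdsWithin hy] with z hz using indicator_of_mem hz _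
  have heq0 : ∀ y ∉ T, T.indicator η =ᶠ[nhdsWithin y halfSpace] fun _ => 0 := fun y hy => by
    have : (c.extend I3 '' K)ᶜ ∈ nhds y :=
      hK'.isClosed.isOpen_compl.mem_nhds fun h => hy (image_extend_subset hKc h)
    filter_upwards [nhdsWithin_le_nhds this] with z using hz z
  have h := integral_extDerivWithin_halfSpace (η := T.indicator η) (fun y hy => by
      by_cases hyT : y ∈ T
      · exact (hη y hyT).congr_of_eventuallyEq (heq y hyT) (indicator_of_mem hyT _)
      · exact contDiffWithinAt_const.congr_of_eventuallyEq (heq0 y hyT) (indicator_of_notMem hyT _))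
    hK' (fun y _ => hz y)
  rw [setIntegral_eq_of_subset_of_forall_sdiff_eq_zero I3.isClosed_range.measurableSet
    (target_subset (c := c)) (fun y hy => by
      rw [(heq0 y hy.2).extDerivWithin_eq_of_mem hy.1]
      simp [extDerivWithin, ContinuousAlternatingMap.alternatizeUncurryFin_apply])] at h
  rw [setIntegral_congr_fun measurableSet_target fun y hy => by
    rw [← (heq y hy).extDerivWithin_eq_of_mem (target_subset hy)], h,
    ← setIntegral_eq_integral_of_forall_compl_eq_zero (s := bdryPt ⁻¹' T) fun z hz => by
      rw [indicator_of_notMem (show bdryPt z ∉ T from hz)]; rfl]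
  congr 1
  have hm : MeasurableSet (bdryPt ⁻¹' T) :=
    (by unfold bdryPt; fun_prop : Continuous bdryPt).measurable measurableSet_target
  exact setIntegral_congr_fun hm fun z hz => by
    rw [indicator_of_mem (show bdryPt z ∈ T from hz)]

/-- The `3`-form `df ∧ μ` for a function `f` and a `2`-form `μ` on `M`, in the chart `c`. -/
def differentialWedge (f : M → ℝ)
    (μ : OpenPartialHomeomorph M (EuclideanHalfSpace 3) → E3 → Form 2 ℝ)
    (c : OpenPartialHomeomorph M (EuclideanHalfSpace 3)) (y : E3) : Form 3 ℝ :=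
  wedge (ContinuousLinearMap.mul ℝ ℝ) (fderivWithin ℝ (fun z => f (pt c z)) halfSpace y) (μ c y)

variable {f : M → ℝ} {μ : OpenPartialHomeomorph M (EuclideanHalfSpace 3) → E3 → Form 2 ℝ}

theorem differentialWedge_eq_zero (hy : y ∈ (c.extend I3).target) (h : pt c y ∉ tsupport f) :
    differentialWedge f μ c y = 0 := by
  have h1 : (fun z => f (pt c z)) =ᶠ[nhdsWithin y halfSpace] fun _ => 0 := by
    filter_upwards [eventually_pt_mem (isClosed_tsupport f).isOpen_compl hy h] with z hz
    exact image_eq_zero_of_notMem_tsupport hz.2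
  rw [differentialWedge, h1.fderivWithin_eq_of_mem (target_subset hy)]
  ext v
  simp [wedge_apply]

variable [ChartedSpace (EuclideanHalfSpace 3) M]

theorem continuousOn_differentialWedge (hc : c ∈ smoothCharts M) (hf : ContMDiff I3 𝓘(ℝ) ∞ f)
    (hμ : ∀ y ∈ (c.extend I3).target, ContDiffWithinAt ℝ ∞ (μ c) halfSpace y) :
    ContinuousOn (fun y => differentialWedge f μ c y ![e 0, e 1, e 2]) (c.extend I3).target := by
  intro y hy
  exact ((contDiffWithinAt_form_apply (contDiffWithinAt_wedge _ (contDiffWithinAt_fderivWithin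
    (target_subset hy) (contDiffWithinAt_comp_pt hc hy (hf _)))
    (hμ y hy)) _).continuousWithinAt).mono target_subset

/-- `d (f μ) = df ∧ μ + f dμ`. -/
theorem extDerivWithin_smul_form (hc : c ∈ smoothCharts M) (hy : y ∈ (c.extend I3).target)
    (hf : ContMDiff I3 𝓘(ℝ) ∞ f)
    (hμ : ContDiffWithinAt ℝ ∞ (μ c) halfSpace y) :
    extDerivWithin (fun z => f (pt c z) • μ c z) halfSpace y ![e 0, e 1, e 2]
      = differentialWedge f μ c y ![e 0, e 1, e 2]
        + f (pt c y) * extDerivWithin (μ c) halfSpace y ![e 0, e 1, e 2] := by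
  have hyh := target_subset hy
  have hf' := contDiffWithinAt_comp_pt hc hy (hf _)
  have hmul : ∀ v w u, fderivWithin ℝ (fun z => (f (pt c z) • μ c z) ![v, w]) halfSpace y u
      = f (pt c y) * fderivWithin ℝ (fun z => μ c z ![v, w]) halfSpace y u
        + fderivWithin ℝ (fun z => f (pt c z)) halfSpace y u * μ c y ![v, w] := fun v w u => by
    have := fderivWithin_fun_mul (uniqueDiffOn_halfSpace y hyh) (diff_of_smooth hf')
      (diff_of_smooth (contDiffWithinAt_form_apply hμ ![v, w]))
    refine (congrArg (fun l : E3 →L[ℝ] ℝ => l u) this).trans ?_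
    simp [mul_comm]
  refine (extDerivWithin_two_apply hyh (hf'.smul hμ) _ _ _).trans ?_
  rw [extDerivWithin_two_apply hyh hμ,
    differentialWedge, wedge_two_apply]
  refine (congrArg₂ (· + ·) (congrArg₂ (· - ·) (hmul _ _ _) (hmul _ _ _)) (hmul _ _ _)).trans ?_
  simp only [ContinuousLinearMap.mul_apply']
  ring

theorem differentialWedge_trans (hc : c ∈ smoothCharts M) (hc' : c' ∈ smoothCharts M)
    (hy : y ∈ (c.extend I3).target) (h' : pt c y ∈ c'.source) (hf : ContMDiff I3 𝓘(ℝ) ∞ f)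
    (hμ : μ c y = (μ c' (trans c c' y)).compContinuousLinearMap
      (fderivWithin ℝ (trans c c') halfSpace y)) :
    differentialWedge f μ c y ![e 0, e 1, e 2] = (fderivWithin ℝ (trans c c') halfSpace y).det
      * differentialWedge f μ c' (trans c c' y) ![e 0, e 1, e 2] := by
  have hy' : trans c c' y ∈ (c'.extend I3).target := extend_mem_target h'
  have hnear := eventually_pt_mem c'.open_source hy h'
  have hφ := (diff_of_smooth (contDiffWithinAt_trans hc hc' hy h')).hasFDerivWithinAt
  have h1 := (diff_of_smooth (contDiffWithinAt_comp_pt hc' hy' (hf _))).hasFDerivWithinAt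
    |>.comp_of_tendsto y hφ (tendsto_nhdsWithin_iff.2 ⟨hφ.continuousWithinAt,
      hnear.mono fun z hz => target_subset (extend_mem_target hz.2)⟩)
  have h2 : (fun z => f (pt c z)) =ᶠ[nhdsWithin y halfSpace] (fun z => f (pt c' z)) ∘ trans c c' :=
    hnear.mono fun z hz => congrArg f (pt_trans hz.2).symm
  have h3 : fderivWithin ℝ (fun z => f (pt c z)) halfSpace y
      = (fderivWithin ℝ (fun z => f (pt c' z)) halfSpace (trans c c' y)).comp
        (fderivWithin ℝ (trans c c') halfSpace y) := by
    rw [h2.fderivWithin_eq_of_mem (target_subset hy)]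
    exact h1.fderivWithin (uniqueDiffOn_halfSpace y (target_subset hy))
  rw [differentialWedge, h3, hμ, wedge_pullback, pullback_three_e]
  rfl

/-- The change of variables formula for densities which transform as `3`-forms and are supported in
the overlap of two charts. -/
theorem integral_target_eq (hc : c ∈ smoothCharts M) (hc' : c' ∈ smoothCharts M)
    (hpos : ∀ y ∈ (c.extend I3).target, pt c y ∈ c'.source →
      0 < (fderivWithin ℝ (trans c c') halfSpace y).det) {W W' : E3 → ℝ}
    (hW : ∀ y ∈ (c.extend I3).target, pt c y ∈ c'.source →
      W y = (fderivWithin ℝ (trans c c') halfSpace y).det * W' (trans c c' y))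
    (h0 : ∀ y ∈ (c.extend I3).target, pt c y ∉ c'.source → W y = 0)
    (h0' : ∀ y ∈ (c'.extend I3).target, pt c' y ∉ c.source → W' y = 0) :
    ∫ y in (c.extend I3).target, W y = ∫ y in (c'.extend I3).target, W' y := by
  have hmeas : ∀ c c' : OpenPartialHomeomorph M (EuclideanHalfSpace 3),
      MeasurableSet ((c.extend I3).target ∩ pt c ⁻¹' c'.source) := by
    intro c c'
    obtain ⟨u, hu, h⟩ := continuousOn_iff'.1 (c.continuousOn_extend_symm (I := I3)) _ c'.open_source
    rw [inter_comm]
    exact h ▸ hu.measurableSet.inter measurableSet_target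
  set U := (c.extend I3).target ∩ pt c ⁻¹' c'.source with hU
  -- the coordinate change is a bijection between the two images of the overlap
  have himg : trans c c' '' U = (c'.extend I3).target ∩ pt c' ⁻¹' c.source := by
    ext z
    constructor
    · rintro ⟨y, ⟨hy, hy'⟩, rfl⟩
      refine ⟨extend_mem_target hy', ?_⟩
      rw [mem_preimage, pt_trans hy']
      exact pt_mem_source hy
    · rintro ⟨hz, hz'⟩
      refine ⟨c.extend I3 (pt c' z), ⟨extend_mem_target hz', ?_⟩, ?_⟩
      · rw [mem_preimage, pt_extend hz']
        exact pt_mem_source hz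
      · rw [trans, pt_extend hz', extend_pt hz]
  have hinj : InjOn (trans c c') U := fun y hy z hz h => by
    have := congrArg (pt c') h
    rw [pt_trans hy.2, pt_trans hz.2] at this
    rw [← extend_pt hy.1, ← extend_pt hz.1, this]
  have hcv := integral_image_eq_integral_abs_det_fderiv_smul volume (hmeas c c')
    (fun y hy => ((diff_of_smooth (contDiffWithinAt_trans hc hc' hy.1 hy.2)).hasFDerivWithinAt).mono
      (inter_subset_left.trans target_subset)) hinj W'
  rw [himg] at hcv
  rw [setIntegral_eq_of_subset_of_forall_sdiff_eq_zero measurableSet_target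
      (inter_subset_left : U ⊆ (c.extend I3).target)
      (fun y hy => h0 y hy.1 fun h => hy.2 ⟨hy.1, h⟩),
    setIntegral_eq_of_subset_of_forall_sdiff_eq_zero measurableSet_target
      (inter_subset_left : (c'.extend I3).target ∩ pt c' ⁻¹' c.source ⊆ (c'.extend I3).target)
      (fun y hy => h0' y hy.1 fun h => hy.2 ⟨hy.1, h⟩), hcv]
  refine setIntegral_congr_fun (hmeas c c') fun y hy => ?_
  rw [hW y hy.1 hy.2]
  simp only [smul_eq_mul]
  rw [abs_of_pos (hpos y hy.1 hy.2)]

end ChartStokes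

/-! ### Stokes' theorem on a compact manifold -/

section CompactStokes

variable {M : Type*} [TopologicalSpace M] [ChartedSpace (EuclideanHalfSpace 3) M]
  [IsManifold I3 ∞ M] [T2Space M] [SigmaCompactSpace M] [CompactSpace M] (O : OrientedAtlas M)

/-- On a compact manifold only finitely many functions of the partition of unity are nonzero. -/
theorem exists_finset_partition : ∃ s : Finset O.charts, (∀ c ∉ s, ∀ x, partition O c x = 0) ∧
    ∀ x, ∑ c ∈ s, partition O c x = 1 := by
  have hfin := (partition O).locallyFinite.finite_nonempty_of_compact
  have h0 : ∀ c ∉ hfin.toFinset, ∀ x, partition O c x = 0 := by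
    intro c hc x
    by_contra h
    exact hc (hfin.mem_toFinset.2 ⟨x, h⟩)
  refine ⟨hfin.toFinset, h0, fun x => ?_⟩
  rw [← (partition O).sum_eq_one (mem_univ x), finsum_eq_sum_of_support_subset]
  intro c hc
  by_contra h
  exact hc (h0 c h x)

theorem isCompact_tsupport_partition (c : O.charts) : IsCompact (tsupport (partition O c)) :=
  (isClosed_tsupport _).isCompact

variable {O} {τ : OpenPartialHomeomorph M (EuclideanHalfSpace 3) → E3 → Form 3 ℝ}

/-- Continuous `3`-forms on a compact manifold are integrable. -/
theorem formIntegrable_of_continuousOn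
    (hτ : ∀ c ∈ O.charts, ContinuousOn (fun y => τ c y ![e 0, e 1, e 2]) (c.extend I3).target) :
    FormIntegrable O τ := by
  obtain ⟨s, hs, -⟩ := exists_finset_partition O
  refine ⟨fun c => integrableOn_target (isCompact_tsupport_partition O c)
    (tsupport_partition_subset O c) (continuousOn_chartDensity (hτ c c.2)) fun y hy h => ?_,
    summable_of_ne_finset_zero (s := s) fun c hc => ?_⟩
  · rw [chartDensity, image_eq_zero_of_notMem_tsupport h, zero_mul]
  · simp [chartDensity, hs c hc]

variable {μ : OpenPartialHomeomorph M (EuclideanHalfSpace 3) → E3 → Form 2 ℝ}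

/-- The differentials of the partition functions contribute nothing in total: inserting the
partition once more and exchanging the order of summation moves each term to the chart of the
inserted function, where the sum of the differentials vanishes. -/
theorem sum_integral_differentialWedge {s : Finset O.charts}
    (hs1 : ∀ x, ∑ c ∈ s, partition O c x = 1)
    (hμ : ∀ c ∈ O.charts, ∀ y ∈ (c.extend I3).target, ContDiffWithinAt ℝ ∞ (μ c) halfSpace y)
    (hμt : ∀ c ∈ O.charts, ∀ c' ∈ O.charts, ∀ y ∈ (c.extend I3).target, pt c y ∈ c'.source →
      μ c y = (μ c' (trans c c' y)).compContinuousLinearMap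
        (fderivWithin ℝ (trans c c') halfSpace y)) :
    ∑ c ∈ s, ∫ y in (c.1.extend I3).target,
      differentialWedge (partition O c) μ c.1 y ![e 0, e 1, e 2] = 0 := by
  have hρ : ∀ c : O.charts, ContMDiff I3 𝓘(ℝ) ∞ (partition O c) := fun c =>
    (partition O c).contMDiff
  have hcont : ∀ b c d : O.charts, ContinuousOn (fun y => partition O b (pt c.1 y)
      * differentialWedge (partition O d) μ c.1 y ![e 0, e 1, e 2]) (c.1.extend I3).target :=
    fun b c d => (continuousOn_comp_pt (hρ b).continuous).mul
      (continuousOn_differentialWedge (O.smooth c.2) (hρ d) (hμ c c.2))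
  have hint1 : ∀ b c : O.charts, IntegrableOn (fun y => partition O b (pt c.1 y)
      * differentialWedge (partition O c) μ c.1 y ![e 0, e 1, e 2]) (c.1.extend I3).target :=
    fun b c => integrableOn_target (isCompact_tsupport_partition O c)
      (tsupport_partition_subset O c) (hcont b c c) fun y hy h => by
        rw [differentialWedge_eq_zero hy h]; simp
  have hint2 : ∀ b d : O.charts, IntegrableOn (fun y => partition O b (pt b.1 y)
      * differentialWedge (partition O d) μ b.1 y ![e 0, e 1, e 2]) (b.1.extend I3).target :=
    fun b d => integrableOn_target (isCompact_tsupport_partition O b)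
      (tsupport_partition_subset O b) (hcont b b d) fun y hy h => by
        rw [image_eq_zero_of_notMem_tsupport h, zero_mul]
  have hswap : ∀ b c : O.charts,
      ∫ y in (c.1.extend I3).target, partition O b (pt c.1 y)
        * differentialWedge (partition O c) μ c.1 y ![e 0, e 1, e 2]
      = ∫ y in (b.1.extend I3).target, partition O b (pt b.1 y)
        * differentialWedge (partition O c) μ b.1 y ![e 0, e 1, e 2] := by
    intro b c
    refine integral_target_eq (O.smooth c.2) (O.smooth b.2)
      (fun y hy h => det_trans_pos O c.2 b.2 hy h) (fun y hy h => ?_) (fun y hy h => ?_)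
      (fun y hy h => ?_)
    · rw [differentialWedge_trans (O.smooth c.2) (O.smooth b.2) hy h (hρ c)
        (hμt c c.2 b b.2 y hy h), pt_trans h]
      ring
    · rw [image_eq_zero_of_notMem_tsupport fun h' => h (tsupport_partition_subset O b h'), zero_mul]
    · rw [differentialWedge_eq_zero hy fun h' => h (tsupport_partition_subset O c h')]; simp
  -- `∑ dρ_c = d 1 = 0`
  have hzero : ∀ b : O.charts, ∀ y ∈ (b.1.extend I3).target,
      ∑ c ∈ s, differentialWedge (partition O c) μ b.1 y ![e 0, e 1, e 2] = 0 := by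
    intro b y hy
    have h1 : ∑ c ∈ s, fderivWithin ℝ (fun z => partition O c (pt b.1 z)) halfSpace y = 0 := by
      rw [← fderivWithin_fun_sum (uniqueDiffOn_halfSpace y (target_subset hy)) fun c _ =>
        diff_of_smooth (contDiffWithinAt_comp_pt (O.smooth b.2) hy (hρ c _))]
      simp [hs1]
    have h2 : ∀ v, ∑ c ∈ s, fderivWithin ℝ (fun z => partition O c (pt b.1 z)) halfSpace y v = 0 :=
      fun v => by rw [← sum_apply, h1]; rfl
    simp only [differentialWedge, wedge_two_apply, ContinuousLinearMap.mul_apply',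
      Finset.sum_add_distrib, Finset.sum_sub_distrib, ← Finset.sum_mul, h2]
    ring
  calc ∑ c ∈ s, ∫ y in (c.1.extend I3).target,
        differentialWedge (partition O c) μ c.1 y ![e 0, e 1, e 2]
      = ∑ c ∈ s, ∑ b ∈ s, ∫ y in (c.1.extend I3).target, partition O b (pt c.1 y)
        * differentialWedge (partition O c) μ c.1 y ![e 0, e 1, e 2] := by
        refine Finset.sum_congr rfl fun c _ => ?_
        rw [← integral_finsetSum _ fun b _ => hint1 b c]
        simp only [← Finset.sum_mul, hs1, one_mul]
    _ = ∑ b ∈ s, ∑ c ∈ s, ∫ y in (b.1.extend I3).target, partition O b (pt b.1 y)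
        * differentialWedge (partition O c) μ b.1 y ![e 0, e 1, e 2] := by
        rw [Finset.sum_comm]
        exact Finset.sum_congr rfl fun b _ => Finset.sum_congr rfl fun c _ => hswap b c
    _ = 0 := by
        refine Finset.sum_eq_zero fun b _ => ?_
        rw [← integral_finsetSum _ fun c _ => hint2 b c]
        refine setIntegral_eq_zero_of_forall_eq_zero fun y hy => ?_
        rw [← Finset.mul_sum, hzero b y hy, mul_zero]

/-- Stokes' theorem on a compact oriented manifold with boundary. -/
theorem formIntegral_extDerivWithin
    (hμ : ∀ c ∈ O.charts, ∀ y ∈ (c.extend I3).target, ContDiffWithinAt ℝ ∞ (μ c) halfSpace y)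
    (hμt : ∀ c ∈ O.charts, ∀ c' ∈ O.charts, ∀ y ∈ (c.extend I3).target, pt c y ∈ c'.source →
      μ c y = (μ c' (trans c c' y)).compContinuousLinearMap
        (fderivWithin ℝ (trans c c') halfSpace y))
    (hτ : ∀ c ∈ O.charts, ∀ y ∈ (c.extend I3).target, extDerivWithin (μ c) halfSpace y = τ c y)
    (hτc : ∀ c ∈ O.charts, ContinuousOn (fun y => τ c y ![e 0, e 1, e 2]) (c.extend I3).target) :
    formIntegral O τ = boundaryIntegral O μ := by
  obtain ⟨s, hs, hs1⟩ := exists_finset_partition O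
  have hρ : ∀ c : O.charts, ContMDiff I3 𝓘(ℝ) ∞ (partition O c) := fun c =>
    (partition O c).contMDiff
  have hstokes : ∀ c : O.charts,
      (∫ y in (c.1.extend I3).target, differentialWedge (partition O c) μ c.1 y ![e 0, e 1, e 2])
        + ∫ y in (c.1.extend I3).target, chartDensity O τ c y
      = -∫ z in bdryPt ⁻¹' (c.1.extend I3).target,
        partition O c (pt c.1 (bdryPt z)) * μ c.1 (bdryPt z) ![e 1, e 2] := by
    intro c
    have h1 := integral_extDerivWithin_target (isCompact_tsupport_partition O c)
      (tsupport_partition_subset O c) (η := fun y => partition O c (pt c.1 y) • μ c.1 y)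
      (fun y hy => (contDiffWithinAt_comp_pt (O.smooth c.2) hy (hρ c _)).smul (hμ c c.2 y hy))
      (fun y hy h => by rw [image_eq_zero_of_notMem_tsupport h, zero_smul])
    refine Eq.trans ?_ h1
    rw [← integral_add]
    · refine setIntegral_congr_fun measurableSet_target fun y hy => ?_
      simp only [chartDensity, ← hτ c c.2 y hy]
      exact (extDerivWithin_smul_form (O.smooth c.2) hy (hρ c) (hμ c c.2 y hy)).symm
    · exact integrableOn_target (isCompact_tsupport_partition O c) (tsupport_partition_subset O c)
        (continuousOn_differentialWedge (O.smooth c.2) (hρ c) (hμ c c.2))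
        fun y hy h => by rw [differentialWedge_eq_zero hy h]; rfl
    · exact (formIntegrable_of_continuousOn hτc).1 c
  rw [formIntegral, boundaryIntegral, tsum_eq_sum (s := s) fun c hc => by
      simp [chartDensity, hs c hc], tsum_eq_sum (s := s) fun c hc => by simp [hs c hc],
    ← Finset.sum_congr rfl fun c _ => hstokes c, Finset.sum_add_distrib,
    sum_integral_differentialWedge hs1 hμ hμt, zero_add]

variable {N : ℕ} {G : Subgroup (SO N)} {ι : Type*} {P : PrincipalBundle M G ι}
  (met : Metric M) (ζ : ClosedTwoForm M) (A : Connection P) (B : AdSection P) (κ : InvInner G)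

theorem finiteAction_of_compactSpace : FiniteAction O met ζ A B κ :=
  formIntegrable_of_continuousOn fun _ hc => continuousOn_energyForm met ζ A B κ (O.smooth hc)

theorem charge_eq_boundaryTerm : charge O met ζ A B κ = boundaryTerm O met ζ A B κ :=
  formIntegral_extDerivWithin
    (fun _ hc _ hy => contDiffWithinAt_boundaryForm met ζ A B κ (O.smooth hc) hy)
    (fun _ hc _ hc' _ hy h' => (glue_trans O met ζ A B κ hc hc' hy h').2.2)
    (fun _ hc _ hy => extDerivWithin_boundaryForm met ζ A B κ (O.smooth hc) hy)
    (fun _ hc => continuousOn_chargeForm met ζ A B κ (O.smooth hc))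

end CompactStokes

end ConeYM

end

theorem mainTheorem3 {M : Type*} [TopologicalSpace M] [ChartedSpace (EuclideanHalfSpace 3) M]
    [IsManifold ConeYM.I3 ∞ M] [T2Space M] [SigmaCompactSpace M]
    (O : ConeYM.OrientedAtlas M) (met : ConeYM.Metric M) (ζ : ConeYM.ClosedTwoForm M)
    {N : ℕ} (G : Subgroup (ConeYM.SO N)) (hG : IsCompact (G : Set (ConeYM.SO N)))
    {ι : Type*} (P : ConeYM.PrincipalBundle M G ι)
    (A : ConeYM.Connection P) (B : ConeYM.AdSection P) :
    (∀ ε : ℝ, ε = 1 ∨ ε = -1 → ConeYM.Duality O met ζ A B ε →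
      ConeYM.ConeYM₁ O met ζ A B ∧ ConeYM.ConeYM₂ O met ζ A B) ∧
    (∀ κ : ConeYM.InvInner G,
      (ConeYM.FiniteAction O met ζ A B κ →
        ConeYM.FormIntegrable O (ConeYM.chargeForm met ζ A B κ) ∧
        ∀ ε : ℝ, ε = 1 ∨ ε = -1 →
          ε * (2 * ConeYM.charge O met ζ A B κ) ≤ ConeYM.action O met ζ A B κ ∧
          (ConeYM.action O met ζ A B κ = ε * (2 * ConeYM.charge O met ζ A B κ) ↔
            ConeYM.Duality O met ζ A B ε)) ∧
      (CompactSpace M →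
        ConeYM.FiniteAction O met ζ A B κ ∧
        ConeYM.charge O met ζ A B κ = ConeYM.boundaryTerm O met ζ A B κ)) := by
  refine ⟨fun ε hε => ConeYM.coneYM_of_duality met ζ A B (by rcases hε with rfl | rfl <;> norm_num),
    fun κ => ⟨fun hE => ⟨ConeYM.formIntegrable_chargeForm met ζ A B κ hE, fun ε hε =>
      ConeYM.charge_le_action met ζ A B κ hE (by rcases hε with rfl | rfl <;> norm_num)⟩,
    fun _ => ⟨ConeYM.finiteAction_of_compactSpace met ζ A B κ,
      ConeYM.charge_eq_boundaryTerm met ζ A B κ⟩⟩⟩
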